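/- Let $AP$ be a finite set of atomic propositions and let $M$ be an operator precedence matrix (OPM) on $2^{AP}$, i.e. a partial function $2^{AP}\times 2^{AP}\to\{\lessdot,\doteq,\gtrdot\}$, extended to the end marker $\#$ by $\#\lessdot a$ and $a\gtrdot\#$ for every $a\in 2^{AP}$, and $\#\doteq\#$. For a word $w\in(2^{AP})^*$ of length $n$, number the positions of $\#w\#$ by $0,\dots,n+1$. Write $\chi(i,j)$ if $i<j$ are the two ends of a (simple or composed) chain of $\#w\#$. The word $w$ is compatible with $M$ if $M$ is defined on any two consecutive letters of $w$ and on the ends of any chain of $\#w\#$. OPTL formulas are built from the propositions in $AP\cup\{\#\}$ ($\#$ holds exactly in positions $0$ and $n+1$) by $\neg$, $\wedge$, next and back, matching next and matching back (which refer to the maximal chain starting, resp. ending, in the current position), linear until and since, summary until and since (for every set $O\subseteq\{\lessdot,\doteq,\gtrdot\}$), and hierarchical yield-precedence and take-precedence until and since. Let $|\varphi|$ be the number of occurrences of operators and propositions in $\varphi$; write $w\models\varphi$ if $\varphi$ holds in position $1$ of $\#w\#$. The closure $\mathrm{Cl}(\varphi)$ is the smallest set that contains $\varphi$ and all propositions in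 $AP\cup\{\#\}$, contains the negation of each of its elements that is not itself a negation, contains the operands of each of its elements, and contains, for each of its elements formed with an operator other than $\neg,\wedge$, next and back, the following. For a linear until (since) $\eta$: the next (back) of $\eta$. For a summary until (since) $\eta$: the next and the matching next (the back and the matching back) of $\eta$. For a matching next or matching back $\eta$: two auxiliary symbols associated with $\eta$. For a hierarchical yield-precedence until (since) $\eta$: two (three) auxiliary symbols associated with $\eta$, and the next of the first of them. For a hierarchical take-precedence until or since $\eta$: two auxiliary symbols associated with $\eta$, and the matching back of each of the two operands of $\eta$. $\mathrm{Atoms}(\varphi)$ is the set of all $\Phi\subseteq\mathrm{Cl}(\varphi)$ that contain exactly one of $\psi,\neg\psi$ whenever $\neg\psi\in \mathrm{Cl}(\varphi)$; contain $\psi\wedge\theta\in\mathrm{Cl}(\varphi)$ iff they contain $\psi$ and $\theta$; contain a linear until (since) $\eta\in\mathrm{Cl}(\varphi)$ of $\psi,\theta$ iff they contain $\theta$, or both $\psi$ and the next (back) of $\eta$; contain a summary until (since) $\eta\in\mathrm{Cl}(\varphi)$ of $\psi,\theta$ if they contain $\theta$, or both $\psi$ and the matching next (matching back) of $\eta$,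 and contain it only if they satisfy this condition or contain both $\psi$ and the next (back) of $\eta$; and, with each hierarchical yield-precedence formula, contain the next of its first auxiliary symbol. There is an absolute constant $C$ such that for every finite set $AP$, every OPM $M$ on $2^{AP}$ and every OPTL formula $\varphi$ over $AP$ (hierarchical operators included): 1. $\mathrm{Cl}(\varphi)$ is finite and $|\mathrm{Cl}(\varphi)|\le C(|\varphi|+|AP|)$; hence $\mathrm{Atoms}(\varphi)$ is finite. 2. There is a nondeterministic operator precedence automaton $\mathcal A_\varphi$ over $(2^{AP},M)$ whose set of states is $\mathrm{Atoms}(\varphi)$, such that: every initial state contains $\varphi$; every final state contains the proposition $\#$, no other proposition and no next formula; every push or shift transition from $\Phi$ to $\Theta$ reading $a$ satisfies $\Phi\cap(AP\cup\{\#\})=a$, contains the next of $\psi$ in $\Phi$ iff $\psi\in\Theta$ (whenever the next of $\psi$ is in $\mathrm{Cl}(\varphi)$), and contains the back of $\psi$ in $\Theta$ iff $\psi\in\Phi$ (whenever the back of $\psi$ is in $\mathrm{Cl}(\varphi)$); and every pop transition leaves the propositions of the current state unchanged. 3. $\mathcal A_\varphi$ accepts exactly the finite words over $2^{AP}$ that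 are compatible with $M$ and satisfy $\varphi$; in particular, if $M$ is total, exactly the finite words that satisfy $\varphi$. 4. The size of $\mathcal A_\varphi$ (number of states plus number of transitions) is at most $2^{C(|\varphi|+|AP|)}$; thus, for fixed $AP$, it is $2^{O(|\varphi|)}$, for formulas with hierarchical operators as for those without. -/

import Mathlib

namespace OPTL

/-! ## Operator precedence alphabets, chains, compatible words -/

/-- The three precedence relations: `lt` (yields precedence), `eq` (equal in precedence),
`gt` (takes precedence). -/
inductive Prec
  | lt
  | eq
  | gt

/-- An operator precedence matrix on the alphabet `L`: a partial function giving the precedence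
relation between two letters. -/
def OPM (L : Type*) := L → L → Option Prec

/-- The matrix extended to the end marker `#` (written `none`): the initial `#` yields precedence
to every letter, every letter takes precedence on the final `#`, and `#` is equal in precedence
to `#`. -/
def OPM.ext {L : Type*} (M : OPM L) : Option L → Option L → Option Prec
  | none, none => some Prec.eq
  | none, some _ => some Prec.lt
  | some _, none => some Prec.gt
  | some a, some b => M a b

/-- The letter in position `i` of the word `# w #`, whose positions are `0, …, w.length + 1`. -/
def letterAt {L : Type*} (w : List L) : ℕ → Option L
  | 0 => none
  | i + 1 => w[i]?

/-- The precedence relation between two positions of `# w #`. -/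
def rel {L : Type*} (M : OPM L) (w : List L) (i j : ℕ) : Option Prec :=
  M.ext (letterAt w i) (letterAt w j)

/-- Positions `i` and `j` form the context of a (simple or composed) chain
`c₀ s₀ c₁ s₁ … c_ℓ s_ℓ c_{ℓ+1}`, where `c k` is the position of the letter `c_k`: each `s_k` is
empty or is the body of a chain with context `c_k`, `c_{k+1}`. -/
inductive Chain {L : Type*} (M : OPM L) (w : List L) : ℕ → ℕ → Prop
  | intro (l : ℕ) (c : ℕ → ℕ) (hl : 1 ≤ l)
      (mono : ∀ k, k ≤ l → c k < c (k + 1))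
      (first : rel M w (c 0) (c 1) = some Prec.lt)
      (middle : ∀ k, 1 ≤ k → k < l → rel M w (c k) (c (k + 1)) = some Prec.eq)
      (last : rel M w (c l) (c (l + 1)) = some Prec.gt)
      (gaps : ∀ k, k ≤ l → c k + 1 ≠ c (k + 1) → Chain M w (c k) (c (k + 1))) :
      Chain M w (c 0) (c (l + 1))

/-- The chain relation on the positions `0, …, w.length + 1` of `# w #`. -/
def chi {L : Type*} (M : OPM L) (w : List L) (i j : ℕ) : Prop :=
  j ≤ w.length + 1 ∧ Chain M w i j

/-- The maximal forward chain relation. -/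
def chiFwd {L : Type*} (M : OPM L) (w : List L) (i j : ℕ) : Prop :=
  IsGreatest {k | chi M w i k} j

/-- The maximal backward chain relation. -/
def chiBwd {L : Type*} (M : OPM L) (w : List L) (i j : ℕ) : Prop :=
  IsLeast {k | chi M w k j} i

/-- `w` is compatible with `M`: the relation is defined between any two consecutive letters of `w`
and between the two ends of any chain of `# w #`. -/
def Compatible {L : Type*} (M : OPM L) (w : List L) : Prop :=
  (∀ i, 1 ≤ i → i + 1 ≤ w.length → (rel M w i (i + 1)).isSome) ∧
    ∀ i j, chi M w i j → (rel M w i j).isSome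

/-! ## Operator precedence automata -/

/-- A (nondeterministic) operator precedence automaton with alphabet `(L, M)` and states `Q`. -/
structure OPA {L : Type*} (M : OPM L) (Q : Type*) where
  init : Set Q
  final : Set Q
  push : Set (Q × L × Q)
  shift : Set (Q × L × Q)
  pop : Set (Q × Q × Q)

/-- Configurations: the unread input (the closing `#` is implicit), the current state, and the
stack above the bottom symbol, top first. -/
structure Config (L Q : Type*) where
  input : List L
  state : Q
  stack : List (L × Q)

/-- The moves of an automaton. The next symbol to read is `input.head?` and the symbol on top of
the stack is `stack.head?.map Prod.fst`, where `none` stands for `#`. -/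
inductive OPA.Step {L Q : Type*} {M : OPM L} (A : OPA M Q) : Config L Q → Config L Q → Prop
  | push (a : L) (x : List L) (p q : Q) (s : List (L × Q))
      (prec : M.ext (s.head?.map Prod.fst) (some a) = some Prec.lt)
      (tr : (p, a, q) ∈ A.push) :
      OPA.Step A ⟨a :: x, p, s⟩ ⟨x, q, (a, p) :: s⟩
  | shift (a b : L) (x : List L) (p q r : Q) (s : List (L × Q))
      (prec : M.ext (some a) (some b) = some Prec.eq)
      (tr : (q, b, r) ∈ A.shift) :
      OPA.Step A ⟨b :: x, q, (a, p) :: s⟩ ⟨x, r, (b, p) :: s⟩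
  | pop (a : L) (x : List L) (p q r : Q) (s : List (L × Q))
      (prec : M.ext (some a) x.head? = some Prec.gt)
      (tr : (q, p, r) ∈ A.pop) :
      OPA.Step A ⟨x, q, (a, p) :: s⟩ ⟨x, r, s⟩

/-- The language accepted by an automaton. -/
def OPA.language {L Q : Type*} {M : OPM L} (A : OPA M Q) : Set (List L) :=
  {x | ∃ p ∈ A.init, ∃ q ∈ A.final, Relation.ReflTransGen A.Step ⟨x, p, []⟩ ⟨[], q, []⟩}

/-- The size of a finite automaton: its number of states plus its number of transitions. -/
noncomputable def OPA.size {L Q : Type*} {M : OPM L} (A : OPA M Q) : ℕ :=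
  Nat.card Q + A.push.ncard + A.shift.ncard + A.pop.ncard

/-! ## Syntax and semantics of OPTL -/

/-- OPTL formulas. The propositions are those of `AP` and the terminal symbol `#`
(the proposition `none`). -/
inductive Formula (AP : Type*)
  | prop (p : Option AP)
  | neg (ψ : Formula AP)
  | and (ψ θ : Formula AP)
  /-- linear next -/
  | next (ψ : Formula AP)
  /-- linear back -/
  | back (ψ : Formula AP)
  /-- matching next -/
  | chainNext (ψ : Formula AP)
  /-- matching back -/
  | chainBack (ψ : Formula AP)
  /-- linear until -/
  | until (ψ θ : Formula AP)
  /-- linear since -/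
  | since (ψ θ : Formula AP)
  /-- operator precedence summary until -/
  | sumUntil (O : Set Prec) (ψ θ : Formula AP)
  /-- operator precedence summary since -/
  | sumSince (O : Set Prec) (ψ θ : Formula AP)
  /-- hierarchical yield-precedence until -/
  | yieldUntil (ψ θ : Formula AP)
  /-- hierarchical yield-precedence since -/
  | yieldSince (ψ θ : Formula AP)
  /-- hierarchical take-precedence until -/
  | takeUntil (ψ θ : Formula AP)
  /-- hierarchical take-precedence since -/
  | takeSince (ψ θ : Formula AP)

/-- The length of a formula: the number of its operators and propositions, with repetitions. -/
def Formula.length {AP : Type*} : Formula AP → ℕ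
  | prop _ => 1
  | neg ψ | next ψ | back ψ | chainNext ψ | chainBack ψ => ψ.length + 1
  | and ψ θ | Formula.until ψ θ | since ψ θ | sumUntil _ ψ θ | sumSince _ ψ θ
  | yieldUntil ψ θ | yieldSince ψ θ | takeUntil ψ θ | takeSince ψ θ => ψ.length + θ.length + 1

/-- The positions `p 0 < p 1 < … < p m` form a path in the word `# w #`. -/
def IsPath {L : Type*} (w : List L) (m : ℕ) (p : ℕ → ℕ) : Prop :=
  (∀ k, k < m → p k < p (k + 1)) ∧ p m ≤ w.length + 1

/-- Linear paths between `i` and `j`. -/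
def LinearPath {L : Type*} (w : List L) (i j m : ℕ) (p : ℕ → ℕ) : Prop :=
  IsPath w m p ∧ p 0 = i ∧ p m = j ∧ ∀ k, k < m → p (k + 1) = p k + 1

/-- Forward summary paths between `i` and `j`: from `p k` the path jumps to the end of the maximal
forward chain starting there if this end does not exceed `j`; otherwise it goes to the next
position, which must be in a relation belonging to `O`. -/
def FwdSummaryPath {L : Type*} (M : OPM L) (w : List L) (O : Set Prec) (i j m : ℕ)
    (p : ℕ → ℕ) : Prop :=
  IsPath w m p ∧ p 0 = i ∧ p m = j ∧ ∀ k, k < m →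
    (chiFwd M w (p k) (p (k + 1)) ∧ p (k + 1) ≤ j) ∨
    ((¬ ∃ h, chiFwd M w (p k) h ∧ h ≤ j) ∧ p (k + 1) = p k + 1 ∧
      ∃ r ∈ O, rel M w (p k) (p (k + 1)) = some r)

/-- Backward summary paths between `j` and `i`, where `j ≤ i`; symmetric to the forward ones. -/
def BwdSummaryPath {L : Type*} (M : OPM L) (w : List L) (O : Set Prec) (j i m : ℕ)
    (p : ℕ → ℕ) : Prop :=
  IsPath w m p ∧ p 0 = j ∧ p m = i ∧ ∀ k, k < m →
    (chiBwd M w (p k) (p (k + 1)) ∧ j ≤ p k) ∨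
    ((¬ ∃ h, chiBwd M w h (p (k + 1)) ∧ j ≤ h) ∧ p (k + 1) = p k + 1 ∧
      ∃ r ∈ O, rel M w (p k) (p (k + 1)) = some r)

/-- `x` ends a chain starting in `i`, and `i` yields precedence to `x`. -/
def YieldEnd {L : Type*} (M : OPM L) (w : List L) (i x : ℕ) : Prop :=
  rel M w i x = some Prec.lt ∧ chi M w i x

/-- `x` starts a chain ending in `j`, and `x` takes precedence on `j`. -/
def TakeStart {L : Type*} (M : OPM L) (w : List L) (j x : ℕ) : Prop :=
  rel M w x j = some Prec.gt ∧ chi M w x j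

/-- Hierarchical yield-precedence paths for position `i`: consecutive positions among those
satisfying `YieldEnd M w i`. -/
def YieldPath {L : Type*} (M : OPM L) (w : List L) (i m : ℕ) (p : ℕ → ℕ) : Prop :=
  IsPath w m p ∧ i < p 0 ∧ (∀ k, k ≤ m → YieldEnd M w i (p k)) ∧
    ∀ k, k < m → ∀ x, p k < x → x < p (k + 1) → ¬ YieldEnd M w i x

/-- Hierarchical take-precedence paths for position `j`: consecutive positions among those
satisfying `TakeStart M w j`. -/
def TakePath {L : Type*} (M : OPM L) (w : List L) (j m : ℕ) (p : ℕ → ℕ) : Prop :=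
  IsPath w m p ∧ p m < j ∧ (∀ k, k ≤ m → TakeStart M w j (p k)) ∧
    ∀ k, k < m → ∀ x, p k < x → x < p (k + 1) → ¬ TakeStart M w j x

/-- The until operator on a set `P` of paths: `B` holds at the end of some path in `P` and `A`
holds in all its previous positions. -/
def untilOn (P : ℕ → (ℕ → ℕ) → Prop) (A B : ℕ → Prop) : Prop :=
  ∃ m p, P m p ∧ (∀ k, k < m → A (p k)) ∧ B (p m)

/-- The since operator on a set `P` of paths: `B` holds at the beginning of some path in `P` and
`A` holds in all its subsequent positions. -/
def sinceOn (P : ℕ → (ℕ → ℕ) → Prop) (A B : ℕ → Prop) : Prop :=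
  ∃ m p, P m p ∧ B (p 0) ∧ ∀ k, 1 ≤ k → k ≤ m → A (p k)

/-- The propositions holding in position `i` of `# w #`: only `#` in the two extreme positions,
the elements of the letter read there in the other ones. -/
def label {AP : Type*} (w : List (Set AP)) (i : ℕ) : Set (Option AP) :=
  match letterAt w i with
  | none => {none}
  | some a => some '' a

/-- Satisfaction of a formula in a position `i ≤ w.length + 1` of `# w #`. -/
def Sat {AP : Type*} (M : OPM (Set AP)) (w : List (Set AP)) : Formula AP → ℕ → Prop
  | .prop p, i => p ∈ label w i
  | .neg ψ, i => ¬ Sat M w ψ i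
  | .and ψ θ, i => Sat M w ψ i ∧ Sat M w θ i
  | .next ψ, i => i + 1 ≤ w.length + 1 ∧ Sat M w ψ (i + 1)
  | .back ψ, i => 1 ≤ i ∧ Sat M w ψ (i - 1)
  | .chainNext ψ, i => ∃ j, chiFwd M w i j ∧ Sat M w ψ j
  | .chainBack ψ, i => ∃ j, chiBwd M w j i ∧ Sat M w ψ j
  | .until ψ θ, i => untilOn (fun m p => ∃ j, LinearPath w i j m p) (Sat M w ψ) (Sat M w θ)
  | .since ψ θ, i => sinceOn (fun m p => ∃ j, LinearPath w j i m p) (Sat M w ψ) (Sat M w θ)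
  | .sumUntil O ψ θ, i =>
      untilOn (fun m p => ∃ j, FwdSummaryPath M w O i j m p) (Sat M w ψ) (Sat M w θ)
  | .sumSince O ψ θ, i =>
      sinceOn (fun m p => ∃ j, BwdSummaryPath M w O j i m p) (Sat M w ψ) (Sat M w θ)
  | .yieldUntil ψ θ, i =>
      untilOn (fun m p => YieldPath M w i m p ∧ ∀ x, i < x → x < p 0 → ¬ YieldEnd M w i x)
        (Sat M w ψ) (Sat M w θ)
  | .yieldSince ψ θ, i =>
      sinceOn (fun m p => YieldPath M w i m p ∧ ∀ x, p m < x → ¬ YieldEnd M w i x)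
        (Sat M w ψ) (Sat M w θ)
  | .takeUntil ψ θ, i =>
      untilOn (fun m p => TakePath M w i m p ∧ ∀ x, x < p 0 → ¬ TakeStart M w i x)
        (Sat M w ψ) (Sat M w θ)
  | .takeSince ψ θ, i =>
      sinceOn (fun m p => TakePath M w i m p ∧ ∀ x, p m < x → x < i → ¬ TakeStart M w i x)
        (Sat M w ψ) (Sat M w θ)

/-- A word satisfies a formula if the formula holds in its first position (the position after the
initial `#`). -/
def Models {AP : Type*} (M : OPM (Set AP)) (w : List (Set AP)) (φ : Formula AP) : Prop :=
  Sat M w φ 1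

/-! ## Closure and atoms -/

/-- Names of the auxiliary operators: `pend` marks a requirement tracked on the stack, `fin` marks
its end, `acc` records its partial fulfilment. -/
inductive Tag
  | pend
  | fin
  | acc

/-- OPTL formulas extended with auxiliary operators: `aux t η` is the auxiliary variant `t` of the
formula `η`. -/
inductive XFormula (AP : Type*)
  | prop (p : Option AP)
  | neg (ψ : XFormula AP)
  | and (ψ θ : XFormula AP)
  | next (ψ : XFormula AP)
  | back (ψ : XFormula AP)
  | chainNext (ψ : XFormula AP)
  | chainBack (ψ : XFormula AP)
  | until (ψ θ : XFormula AP)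
  | since (ψ θ : XFormula AP)
  | sumUntil (O : Set Prec) (ψ θ : XFormula AP)
  | sumSince (O : Set Prec) (ψ θ : XFormula AP)
  | yieldUntil (ψ θ : XFormula AP)
  | yieldSince (ψ θ : XFormula AP)
  | takeUntil (ψ θ : XFormula AP)
  | takeSince (ψ θ : XFormula AP)
  | aux (t : Tag) (η : XFormula AP)

/-- An OPTL formula seen as an extended formula. -/
def Formula.toX {AP : Type*} : Formula AP → XFormula AP
  | prop p => .prop p
  | neg ψ => .neg ψ.toX
  | and ψ θ => .and ψ.toX θ.toX
  | next ψ => .next ψ.toX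
  | back ψ => .back ψ.toX
  | chainNext ψ => .chainNext ψ.toX
  | chainBack ψ => .chainBack ψ.toX
  | Formula.until ψ θ => .until ψ.toX θ.toX
  | since ψ θ => .since ψ.toX θ.toX
  | sumUntil O ψ θ => .sumUntil O ψ.toX θ.toX
  | sumSince O ψ θ => .sumSince O ψ.toX θ.toX
  | yieldUntil ψ θ => .yieldUntil ψ.toX θ.toX
  | yieldSince ψ θ => .yieldSince ψ.toX θ.toX
  | takeUntil ψ θ => .takeUntil ψ.toX θ.toX
  | takeSince ψ θ => .takeSince ψ.toX θ.toX

/-- The formulas that belong to every closed set containing the formula `η`, beside its negation: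
its operands, the formulas expressing its expansion, and its auxiliary operators. -/
inductive Requires {AP : Type*} : XFormula AP → XFormula AP → Prop
  | neg (ψ) : Requires (.neg ψ) ψ
  | and_left (ψ θ) : Requires (.and ψ θ) ψ
  | and_right (ψ θ) : Requires (.and ψ θ) θ
  | next (ψ) : Requires (.next ψ) ψ
  | back (ψ) : Requires (.back ψ) ψ
  | chainNext (ψ) : Requires (.chainNext ψ) ψ
  | chainNext_pend (ψ) : Requires (.chainNext ψ) (.aux .pend (.chainNext ψ))
  | chainNext_fin (ψ) : Requires (.chainNext ψ) (.aux .fin (.chainNext ψ))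
  | chainBack (ψ) : Requires (.chainBack ψ) ψ
  | chainBack_pend (ψ) : Requires (.chainBack ψ) (.aux .pend (.chainBack ψ))
  | chainBack_fin (ψ) : Requires (.chainBack ψ) (.aux .fin (.chainBack ψ))
  | until_left (ψ θ) : Requires (.until ψ θ) ψ
  | until_right (ψ θ) : Requires (.until ψ θ) θ
  | until_next (ψ θ) : Requires (.until ψ θ) (.next (.until ψ θ))
  | since_left (ψ θ) : Requires (.since ψ θ) ψ
  | since_right (ψ θ) : Requires (.since ψ θ) θ
  | since_back (ψ θ) : Requires (.since ψ θ) (.back (.since ψ θ))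
  | sumUntil_left (O) (ψ θ) : Requires (.sumUntil O ψ θ) ψ
  | sumUntil_right (O) (ψ θ) : Requires (.sumUntil O ψ θ) θ
  | sumUntil_chain (O) (ψ θ) : Requires (.sumUntil O ψ θ) (.chainNext (.sumUntil O ψ θ))
  | sumUntil_next (O) (ψ θ) : Requires (.sumUntil O ψ θ) (.next (.sumUntil O ψ θ))
  | sumSince_left (O) (ψ θ) : Requires (.sumSince O ψ θ) ψ
  | sumSince_right (O) (ψ θ) : Requires (.sumSince O ψ θ) θ
  | sumSince_chain (O) (ψ θ) : Requires (.sumSince O ψ θ) (.chainBack (.sumSince O ψ θ))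
  | sumSince_back (O) (ψ θ) : Requires (.sumSince O ψ θ) (.back (.sumSince O ψ θ))
  | yieldUntil_left (ψ θ) : Requires (.yieldUntil ψ θ) ψ
  | yieldUntil_right (ψ θ) : Requires (.yieldUntil ψ θ) θ
  | yieldUntil_pend (ψ θ) : Requires (.yieldUntil ψ θ) (.aux .pend (.yieldUntil ψ θ))
  | yieldUntil_next (ψ θ) : Requires (.yieldUntil ψ θ) (.next (.aux .pend (.yieldUntil ψ θ)))
  | yieldUntil_fin (ψ θ) : Requires (.yieldUntil ψ θ) (.aux .fin (.yieldUntil ψ θ))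
  | yieldSince_left (ψ θ) : Requires (.yieldSince ψ θ) ψ
  | yieldSince_right (ψ θ) : Requires (.yieldSince ψ θ) θ
  | yieldSince_pend (ψ θ) : Requires (.yieldSince ψ θ) (.aux .pend (.yieldSince ψ θ))
  | yieldSince_next (ψ θ) : Requires (.yieldSince ψ θ) (.next (.aux .pend (.yieldSince ψ θ)))
  | yieldSince_fin (ψ θ) : Requires (.yieldSince ψ θ) (.aux .fin (.yieldSince ψ θ))
  | yieldSince_acc (ψ θ) : Requires (.yieldSince ψ θ) (.aux .acc (.yieldSince ψ θ))
  | takeUntil_left (ψ θ) : Requires (.takeUntil ψ θ) (.chainBack ψ)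
  | takeUntil_right (ψ θ) : Requires (.takeUntil ψ θ) (.chainBack θ)
  | takeUntil_pend (ψ θ) : Requires (.takeUntil ψ θ) (.aux .pend (.takeUntil ψ θ))
  | takeUntil_fin (ψ θ) : Requires (.takeUntil ψ θ) (.aux .fin (.takeUntil ψ θ))
  | takeSince_left (ψ θ) : Requires (.takeSince ψ θ) (.chainBack ψ)
  | takeSince_right (ψ θ) : Requires (.takeSince ψ θ) (.chainBack θ)
  | takeSince_pend (ψ θ) : Requires (.takeSince ψ θ) (.aux .pend (.takeSince ψ θ))
  | takeSince_fin (ψ θ) : Requires (.takeSince ψ θ) (.aux .fin (.takeSince ψ θ))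

/-- Membership in the closure of `φ`: the smallest set containing `φ` and all propositions, closed
under `Requires`, and closed under negation of formulas that are not themselves negations. -/
inductive InClosure {AP : Type*} (φ : Formula AP) : XFormula AP → Prop
  | self : InClosure φ φ.toX
  | prop (p : Option AP) : InClosure φ (.prop p)
  | neg (ψ : XFormula AP) : InClosure φ ψ → (∀ θ, ψ ≠ .neg θ) → InClosure φ (.neg ψ)
  | requires (η ψ : XFormula AP) : InClosure φ η → Requires η ψ → InClosure φ ψ

/-- The closure of `φ`. -/
def closure {AP : Type*} (φ : Formula AP) : Set (XFormula AP) :=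
  {ψ | InClosure φ ψ}

/-- Consistent subsets of the closure: they contain exactly one of `ψ` and `¬ ψ`, and they respect
conjunctions and the expansions of the until and since operators. In the case of the summary
operators, the linear step is subject to a condition on the precedence relation between consecutive
positions, which is not visible in a single atom. -/
structure IsAtom {AP : Type*} (φ : Formula AP) (Φ : Set (XFormula AP)) : Prop where
  subset : Φ ⊆ closure φ
  neg : ∀ ψ, .neg ψ ∈ closure φ → (ψ ∈ Φ ↔ .neg ψ ∉ Φ)
  and : ∀ ψ θ, .and ψ θ ∈ closure φ → (.and ψ θ ∈ Φ ↔ ψ ∈ Φ ∧ θ ∈ Φ)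
  until_iff : ∀ ψ θ, .until ψ θ ∈ closure φ →
    (.until ψ θ ∈ Φ ↔ θ ∈ Φ ∨ ψ ∈ Φ ∧ .next (.until ψ θ) ∈ Φ)
  since_iff : ∀ ψ θ, .since ψ θ ∈ closure φ →
    (.since ψ θ ∈ Φ ↔ θ ∈ Φ ∨ ψ ∈ Φ ∧ .back (.since ψ θ) ∈ Φ)
  sumUntil_mp : ∀ O ψ θ, .sumUntil O ψ θ ∈ Φ →
    θ ∈ Φ ∨ ψ ∈ Φ ∧ .chainNext (.sumUntil O ψ θ) ∈ Φ ∨ ψ ∈ Φ ∧ .next (.sumUntil O ψ θ) ∈ Φ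
  sumUntil_mpr : ∀ O ψ θ, .sumUntil O ψ θ ∈ closure φ →
    θ ∈ Φ ∨ ψ ∈ Φ ∧ .chainNext (.sumUntil O ψ θ) ∈ Φ → .sumUntil O ψ θ ∈ Φ
  sumSince_mp : ∀ O ψ θ, .sumSince O ψ θ ∈ Φ →
    θ ∈ Φ ∨ ψ ∈ Φ ∧ .chainBack (.sumSince O ψ θ) ∈ Φ ∨ ψ ∈ Φ ∧ .back (.sumSince O ψ θ) ∈ Φ
  sumSince_mpr : ∀ O ψ θ, .sumSince O ψ θ ∈ closure φ →
    θ ∈ Φ ∨ ψ ∈ Φ ∧ .chainBack (.sumSince O ψ θ) ∈ Φ → .sumSince O ψ θ ∈ Φ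
  yieldUntil : ∀ ψ θ, .yieldUntil ψ θ ∈ Φ → .next (.aux .pend (.yieldUntil ψ θ)) ∈ Φ
  yieldSince : ∀ ψ θ, .yieldSince ψ θ ∈ Φ → .next (.aux .pend (.yieldSince ψ θ)) ∈ Φ

/-- The set of atoms of the closure of `φ`, as a type. -/
def Atom {AP : Type*} (φ : Formula AP) : Type _ :=
  {Φ : Set (XFormula AP) // IsAtom φ Φ}

/-- The propositions (possibly including `#`) contained in an atom. -/
def Atom.props {AP : Type*} {φ : Formula AP} (Φ : Atom φ) : Set (Option AP) :=
  {p | XFormula.prop p ∈ Φ.1}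

/-- A transition from `Φ` to `Θ` may read `a`: the propositions of `Φ` are those of `a`, and the
next and back formulas of the closure are fulfilled. -/
structure Atom.MayRead {AP : Type*} {φ : Formula AP} (Φ : Atom φ) (a : Set AP) (Θ : Atom φ) :
    Prop where
  props : Φ.props = some '' a
  next : ∀ ψ, .next ψ ∈ closure φ → (.next ψ ∈ Φ.1 ↔ ψ ∈ Θ.1)
  back : ∀ ψ, .back ψ ∈ closure φ → (.back ψ ∈ Θ.1 ↔ ψ ∈ Φ.1)

/-- The automaton uses its states as atoms: initial states contain `φ`; final states contain the
terminal symbol only and no next formula; push and shift transitions read the propositions of the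
current atom and fulfil next and back formulas; pop transitions preserve the propositions. -/
structure OPA.RespectsAtoms {AP : Type*} {M : OPM (Set AP)} {φ : Formula AP}
    (A : OPA M (Atom φ)) : Prop where
  init : ∀ Φ ∈ A.init, φ.toX ∈ Φ.1
  final : ∀ Φ ∈ A.final, Φ.props = {none} ∧ ∀ ψ, XFormula.next ψ ∉ Φ.1
  push : ∀ Φ a Θ, (Φ, a, Θ) ∈ A.push → Φ.MayRead a Θ
  shift : ∀ Φ a Θ, (Φ, a, Θ) ∈ A.shift → Φ.MayRead a Θ
  pop : ∀ Φ Θ Ψ, (Φ, Θ, Ψ) ∈ A.pop → Ψ.props = Φ.props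

end OPTL

/-! A run of an operator precedence automaton passes through configurations described by a pair `(k,
j)`: the position `k` of the topmost stack symbol and the next position `j` to read. These pairs are
the adjacent ones (`Act`): consecutive positions or ends of a chain. Accepting a word therefore
amounts to labelling its adjacent pairs with states subject to local conditions: reading `j` leads
from `(i, j)` to `(j, j + 1)`, and popping at `(k, j)` a body that was begun by pushing `h` over `i`
leads to `(i, j)`, with the label of `(i, h)` as the stacked state. This is `mem_language_iff`; it
removes stacks and runs from the rest of the argument.

The reduction rests on `adj_structure`. Chains do not cross; among the right neighbours of `i`, all
but the farthest are in relation `lt` with `i`; among the left neighbours of `j`, all but the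
farthest are in relation `gt` with `j`. Compatibility supplies the missing existence: every left end
has a neighbour not in `lt`, every right end one not in `gt`, and these are unique. At the first
kind of pair everything owed by `i` can be settled (`Close`); at the second kind `j` is about to be
read and everything about its left context is known (`Leave`).

Formulas are handled by recurrences along the same moves. Ordinary formulas in the label of `(i, j)`
speak of `j`, while auxiliary symbols speak of the pair: `fin` says that it is a chain and not a
step; `pend` of a matching next or of a yield since remembers that the formula holds in `i`, and
`pend` of a matching back that its operand holds in `i`; `pend` of the other hierarchical operators
and `acc` of a yield since are partial evaluations of the operator over the neighbours of `i` beyond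
or before `j`, or over those of `j` beyond or before `i`. Each auxiliary symbol is fixed at one end
of its scan, transported by pops and compared with the formula at the other end. No sets or counters
are needed, and this is why hierarchical operators cost a bounded number of symbols each.

Soundness: in a labelling that fulfils the conditions (`Coherent`), induction along the moves shows
that each symbol has its intended meaning, whence `holds_iff_sat`. Completeness: labelling each pair
with what is true there (`truth`) fulfils all conditions by the same recurrences. For the size,
every operator of the formula contributes at most nine elements to the closure, up to negation, and
an atom is a subset of the closure. -/

namespace OPTL

section Chains

variable {L : Type*} {M : OPM L} {w : List L}

/-! ## The structure of chains -/

/-- Position `j` follows `i` immediately or is the end of a chain starting in `i`. -/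
def Adj (M : OPM L) (w : List L) (i j : ℕ) : Prop :=
  j = i + 1 ∨ Chain M w i j

/-- Adjacent positions equal in precedence. -/
def EqAdj (M : OPM L) (w : List L) (i j : ℕ) : Prop :=
  Adj M w i j ∧ rel M w i j = some Prec.eq

/-- The body of a chain with left context `i`, starting in `h` and read up to `k`. -/
def Open (M : OPM L) (w : List L) (i h k : ℕ) : Prop :=
  Adj M w i h ∧ rel M w i h = some Prec.lt ∧ Relation.ReflTransGen (EqAdj M w) h k

theorem seq_lt {c : ℕ → ℕ} {l : ℕ} (mono : ∀ k, k ≤ l → c k < c (k + 1)) :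
    ∀ k, k ≤ l → c 0 < c (k + 1) := by
  intro k
  induction k with
  | zero => intro h; exact mono 0 h
  | succ k ih => intro h; exact (ih (by omega)).trans (mono _ h)

/-- A chain has a nonempty body (`1 ≤ l`), so its ends are never consecutive. This is what separates
the two ways of being adjacent and lets `i + 1 ≠ j` stand for "is a chain". -/
theorem Chain.add_one_lt {i j : ℕ} (h : Chain M w i j) : i + 1 < j := by
  cases h with
  | intro l c hl mono =>
    have h0 := mono 0 (by omega)
    have h1 := seq_lt (c := fun k => c (k + 1)) (l := l - 1)
      (fun k hk => mono (k + 1) (by omega)) (l - 1) le_rfl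
    simp only [zero_add, Nat.sub_add_cancel hl] at h0 h1
    omega

theorem Adj.lt {i j : ℕ} (h : Adj M w i j) : i < j := by
  rcases h with rfl | h
  · omega
  · have := h.add_one_lt; omega

theorem Adj.chain {i j : ℕ} (h : Adj M w i j) (hj : i + 1 ≠ j) : Chain M w i j :=
  h.resolve_left fun h => hj h.symm

theorem eqAdj_le {h k : ℕ} (hk : Relation.ReflTransGen (EqAdj M w) h k) : h ≤ k := by
  induction hk with
  | refl => exact le_rfl
  | tail _ h ih => exact ih.trans h.1.lt.le

theorem Open.lt {i h k : ℕ} (o : Open M w i h k) : i < h := o.1.lt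

theorem Open.le {i h k : ℕ} (o : Open M w i h k) : h ≤ k := eqAdj_le o.2.2

theorem Open.of_lt {i h : ℕ} (ha : Adj M w i h) (hr : rel M w i h = some Prec.lt) :
    Open M w i h h := ⟨ha, hr, .refl⟩

theorem Open.of_eq {i h k k' : ℕ} (o : Open M w i h k) (ha : Adj M w k k')
    (hr : rel M w k k' = some Prec.eq) : Open M w i h k' := ⟨o.1, o.2.1, o.2.2.tail ⟨ha, hr⟩⟩

/-- The indexed body of a chain is traded for a walk along equal-precedence neighbours. With the
converse `Open.chain`, chains can be grown and cut one parser move at a time. -/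
theorem Chain.exists_open {i j : ℕ} (h : Chain M w i j) :
    ∃ h k, Open M w i h k ∧ Adj M w k j ∧ rel M w k j = some Prec.gt := by
  cases h with
  | intro l c hl mono first middle last gaps =>
    have ha : ∀ k, k ≤ l → Adj M w (c k) (c (k + 1)) := fun k hk =>
      (em (c (k + 1) = c k + 1)).imp id fun h => gaps k hk (Ne.symm h)
    refine ⟨c 1, c l, ⟨ha 0 (by omega), first, ?_⟩, ha l le_rfl, last⟩
    have : ∀ k, k + 1 ≤ l → Relation.ReflTransGen (EqAdj M w) (c 1) (c (k + 1)) := by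
      intro k
      induction k with
      | zero => intro _; exact .refl
      | succ k ih =>
        intro hk
        exact (ih (by omega)).tail ⟨ha _ (by omega), middle _ (by omega) (by omega)⟩
    have := this (l - 1) (by omega)
    rwa [Nat.sub_add_cancel hl] at this

theorem Open.chain {i h k j : ℕ} (o : Open M w i h k) (ha : Adj M w k j)
    (hr : rel M w k j = some Prec.gt) : Chain M w i j := by
  -- The indexed sequence is rebuilt from the walk, one entry per step; the right context `j` is
  -- appended at the end.
  have key : ∃ (l : ℕ) (c : ℕ → ℕ), 1 ≤ l ∧ c 0 = i ∧ c 1 = h ∧ c l = k ∧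
      (∀ t, t < l → Adj M w (c t) (c (t + 1))) ∧
      ∀ t, 1 ≤ t → t < l → rel M w (c t) (c (t + 1)) = some Prec.eq := by
    obtain ⟨h1, h2, h3⟩ := o
    clear ha hr
    induction h3 with
    | refl =>
      refine ⟨1, fun t => if t = 0 then i else h, le_rfl, rfl, rfl, rfl, ?_, ?_⟩
      · intro t ht
        obtain rfl : t = 0 := by omega
        simpa using h1
      · intro t h1 h2; omega
    | @tail b d _ hbd ih =>
      obtain ⟨l, c, hl, h0, h1', hlk, hA, hE⟩ := ih
      refine ⟨l + 1, fun t => if t ≤ l then c t else d, by omega, by simpa using h0,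
        by simpa [hl] using h1', by simp, ?_, ?_⟩
      · intro t ht
        rcases Nat.lt_succ_iff_lt_or_eq.1 ht with h | rfl
        · simpa [h.le, Nat.succ_le_iff.2 h] using hA t h
        · simpa [hlk] using hbd.1
      · intro t ht1 ht
        rcases Nat.lt_succ_iff_lt_or_eq.1 ht with h | rfl
        · simpa [h.le, Nat.succ_le_iff.2 h] using hE t ht1 h
        · simpa [hlk] using hbd.2
  obtain ⟨l, c, hl, h0, h1, hlk, hA, hE⟩ := key
  have hA' : ∀ t, t ≤ l → Adj M w ((fun t => if t ≤ l then c t else j) t)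
      ((fun t => if t ≤ l then c t else j) (t + 1)) := by
    intro t ht
    rcases Nat.lt_or_eq_of_le ht with h | rfl
    · simpa [h.le, Nat.succ_le_iff.2 h] using hA t h
    · simpa [hlk] using ha
  have := Chain.intro (M := M) (w := w) l (fun t => if t ≤ l then c t else j) hl
    (fun t ht => (hA' t ht).lt) (by simpa [hl, h0, h1] using o.2.1)
    (fun t ht1 ht => by simpa [ht.le, Nat.succ_le_iff.2 ht] using hE t ht1 ht)
    (by simpa [hlk] using hr) (fun t ht hne => (hA' t ht).chain hne)
  simpa [h0] using this

theorem eqAdj_locate {h k : ℕ} (hk : Relation.ReflTransGen (EqAdj M w) h k) {x : ℕ}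
    (h1 : h ≤ x) (h2 : x ≤ k) :
    (∃ p q, Adj M w p q ∧ h ≤ p ∧ p < x ∧ x < q ∧ q ≤ k) ∨
      Relation.ReflTransGen (EqAdj M w) h x ∧ Relation.ReflTransGen (EqAdj M w) x k := by
  induction hk with
  | refl =>
    obtain rfl : x = h := by omega
    exact .inr ⟨.refl, .refl⟩
  | @tail b d hb hbd ih =>
    rcases le_or_gt x b with hx | hx
    · rcases ih hx with ⟨p, q, h⟩ | h
      · exact .inl ⟨p, q, h.1, h.2.1, h.2.2.1, h.2.2.2.1, h.2.2.2.2.trans hbd.1.lt.le⟩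
      · exact .inr ⟨h.1, h.2.tail hbd⟩
    · rcases Nat.lt_or_eq_of_le h2 with hx2 | rfl
      · exact .inl ⟨b, d, hbd.1, eqAdj_le hb, hx, hx2, le_rfl⟩
      · exact .inr ⟨hb.tail hbd, .refl⟩

/-- A position inside a chain lies strictly inside one of its gaps or belongs to its body. -/
theorem Open.locate {i h k j x : ℕ} (o : Open M w i h k) (ha : Adj M w k j)
    (hr : rel M w k j = some Prec.gt) (h1 : i < x) (h2 : x < j) :
    (∃ p q, Adj M w p q ∧ i ≤ p ∧ p < x ∧ x < q ∧ q ≤ j ∧ (h < x → h ≤ p) ∧ (x < k → q ≤ k) ∧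
        (h ≤ p ∨ q ≤ k)) ∨
      (∃ q, Adj M w x q ∧ rel M w x q ≠ some Prec.lt ∧ q ≤ j ∧ (x < k → q ≤ k)) ∧
        ∃ p, Adj M w p x ∧ rel M w p x ≠ some Prec.gt ∧ i ≤ p ∧ (h < x → h ≤ p) := by
  have hi := o.lt
  have hk := o.le
  have hj := ha.lt
  rcases lt_or_ge x h with hx | hx
  · exact .inl ⟨i, h, o.1, le_rfl, h1, hx, by omega, by omega, by omega, by omega⟩
  rcases lt_or_ge k x with hx' | hx'
  · exact .inl ⟨k, j, ha, by omega, hx', h2, le_rfl, by omega, by omega, by omega⟩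
  rcases eqAdj_locate o.2.2 hx hx' with ⟨p, q, h3, h4, h5, h6, h7⟩ | ⟨h3, h4⟩
  · exact .inl ⟨p, q, h3, by omega, h5, h6, by omega, by omega, by omega, by omega⟩
  · refine .inr ⟨?_, ?_⟩
    · rcases Relation.ReflTransGen.cases_head h4 with rfl | ⟨q, h5, h6⟩
      · exact ⟨j, ha, by simp [hr], le_rfl, by omega⟩
      · have := eqAdj_le h6
        exact ⟨q, h5.1, by simp [h5.2], by omega, by omega⟩
    · rcases Relation.ReflTransGen.cases_tail h3 with rfl | ⟨p, h5, h6⟩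
      · exact ⟨i, o.1, by simp [o.2.1], le_rfl, by omega⟩
      · have := eqAdj_le h5
        exact ⟨p, h6.1, by simp [h6.2], by omega, by omega⟩

/-- The three facts need one another, so they are proved together by induction on a bound `N` for
the total span of the positions involved. A conflict between two adjacent pairs is pushed into the
decomposition of one of them, where `Open.locate` finds either a smaller crossing or two neighbours
of one position whose relation contradicts the induction hypothesis. -/
theorem adj_structure (N : ℕ) :
    (∀ i x j y, Adj M w i j → Adj M w x y → i < x → x < j → j < y → y ≤ i + N → False) ∧
    (∀ i j j', Adj M w i j → Adj M w i j' → j < j' → j' ≤ i + N →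
      rel M w i j = some Prec.lt) ∧
    (∀ i i' j, Adj M w i j → Adj M w i' j → i' < i → j ≤ i' + N →
      rel M w i j = some Prec.gt) := by
  induction N using Nat.strong_induction_on with
  | _ N IH =>
  have IHX : ∀ i x j y, Adj M w i j → Adj M w x y → i < x → x < j → j < y → y < i + N → False :=
    fun i x j y h1 h2 h3 h4 h5 h6 => (IH (y - i) (by omega)).1 i x j y h1 h2 h3 h4 h5 (by omega)
  have IHU : ∀ i j j', Adj M w i j → Adj M w i j' → j < j' → j' < i + N →
      rel M w i j = some Prec.lt := fun i j j' h1 h2 h3 h4 =>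
    (IH (j' - i) (by have := h2.lt; omega)).2.1 i j j' h1 h2 h3 (by omega)
  have IHV : ∀ i i' j, Adj M w i j → Adj M w i' j → i' < i → j < i' + N →
      rel M w i j = some Prec.gt := fun i i' j h1 h2 h3 h4 =>
    (IH (j - i') (by have := h1.lt; omega)).2.2 i i' j h1 h2 h3 (by omega)
  clear IH
  -- Passing to a gap of the left chain may leave `N` unchanged, so there is a second induction, on
  -- the length of the left chain. Gaps are strictly shorter by the last clause of `Open.locate`. If
  -- `x` is in the body instead, it has a right neighbour before `y` that is not in `lt`.
  have X : ∀ D i x j y, j ≤ i + D → Adj M w i j → Adj M w x y → i < x → x < j → j < y →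
      y ≤ i + N → False := by
    intro D
    induction D with
    | zero => intros; omega
    | succ D ihD =>
      intro i x j y hD hij hxy h1 h2 h3 h4
      obtain ⟨h, k, o, ha, hr⟩ := (hij.chain (by omega)).exists_open
      have := o.lt
      have := ha.lt
      rcases o.locate ha hr h1 h2 with ⟨p, q, hpq, h5⟩ | ⟨⟨q, hq, h5, h6⟩, -⟩
      · exact ihD p x q y (by omega) hpq hxy (by omega) (by omega) (by omega) (by omega)
      · exact h5 (IHU x q y hq hxy (by omega) (by omega))
  have X' := fun i x j y hij => X (j - i) i x j y (by omega) hij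
  refine ⟨X', ?_, ?_⟩
  · intro i j j' hj hj' hlt hN
    have := hj.lt
    obtain ⟨h, k, o, ha, hr⟩ := (hj'.chain (by omega)).exists_open
    have := o.lt
    have := ha.lt
    have := o.le
    rcases lt_trichotomy j h with hh | rfl | hh
    · exact IHU i j h hj o.1 hh (by omega)
    · exact o.2.1
    obtain ⟨h₂, k₂, o₂, ha₂, hr₂⟩ := (hj.chain (by omega)).exists_open
    have := o₂.lt
    have := ha₂.lt
    have := o₂.le
    exfalso
    -- Two chains start in `i`. If their first body positions differ, the one nearer to `i` makes
    -- the other lie in a crossing gap or have two conflicting left neighbours. If they agree, the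
    -- two bodies are followed in parallel.
    rcases lt_trichotomy h₂ h with hh₂ | rfl | hh₂
    · rcases o₂.locate ha₂ hr₂ (x := h) (by omega) (by omega) with
          ⟨p, q, hpq, h5⟩ | ⟨-, p, hp, h5, h6⟩
      · exact IHX i p h q o.1 hpq (by omega) (by omega) (by omega) (by omega)
      · exact h5 (IHV p i h hp o.1 (by omega) (by omega))
    -- Both walks are deterministic: a position with two right neighbours is in `lt` with the nearer
    -- one, but a step of the body is `eq` and the exit is `gt`. So they leave the body at the same
    -- place.
    · have walk : ∀ a, Relation.ReflTransGen (EqAdj M w) a k → i < a →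
          Relation.ReflTransGen (EqAdj M w) a k₂ → j = j' := by
        intro a hak
        induction hak using Relation.ReflTransGen.head_induction_on with
        | refl =>
          intro hi h2
          rcases Relation.ReflTransGen.cases_head h2 with rfl | ⟨b, h5, h6⟩
          · by_contra hne
            have := IHU k j j' ha₂ ha (by omega) (by omega)
            simp [hr₂] at this
          · have := eqAdj_le h6
            have := IHU k b j' h5.1 ha (by omega) (by omega)
            simp [h5.2] at this
        | @head a c hac hck ih =>
          intro hi h2
          have := hac.1.lt
          have := eqAdj_le hck
          rcases Relation.ReflTransGen.cases_head h2 with rfl | ⟨b, h5, h6⟩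
          · rcases lt_trichotomy c j with h | rfl | h
            · have := IHU _ c j hac.1 ha₂ h (by omega)
              simp [hac.2] at this
            · simp [hac.2] at hr₂
            · have := IHU _ j c ha₂ hac.1 h (by omega)
              simp [hr₂] at this
          · have := eqAdj_le h6
            rcases lt_trichotomy c b with h | rfl | h
            · have := IHU _ c b hac.1 h5.1 h (by omega)
              simp [hac.2] at this
            · exact ih (by omega) h6
            · have := IHU _ b c h5.1 hac.1 h (by omega)
              simp [h5.2] at this
      have := walk _ o.2.2 (by omega) o₂.2.2
      omega
    · rcases o.locate ha hr (x := h₂) (by omega) (by omega) with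
          ⟨p, q, hpq, h5⟩ | ⟨-, p, hp, h5, h6⟩
      -- Here `q` may be as far as `j'`, so the noncrossing statement for the full span `N`, just
      -- proved, is required rather than the induction hypothesis.
      · exact X' i p h₂ q o₂.1 hpq (by omega) (by omega) (by omega) (by omega)
      · exact h5 (IHV p i h₂ hp o₂.1 (by omega) (by omega))
  · intro i i' j hj hj' hlt hN
    have := hj.lt
    obtain ⟨h, k, o, ha, hr⟩ := (hj'.chain (by omega)).exists_open
    have := o.lt
    have := ha.lt
    have := o.le
    rcases lt_trichotomy k i with hh | rfl | hh
    · exact IHV i k j hj ha hh (by omega)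
    · exact hr
    obtain ⟨h₂, k₂, o₂, ha₂, hr₂⟩ := (hj.chain (by omega)).exists_open
    have := o₂.lt
    have := ha₂.lt
    have := o₂.le
    exfalso
    rcases lt_trichotomy k₂ k with hh₂ | rfl | hh₂
    · rcases o.locate ha hr (x := k₂) (by omega) (by omega) with
          ⟨p, q, hpq, h5⟩ | ⟨⟨q, hq, h5, h6⟩, -⟩
      · exact X' p k₂ q j hpq ha₂ (by omega) (by omega) (by omega) (by omega)
      · exact h5 (IHU k₂ q j hq ha₂ (by omega) (by omega))
    -- The mirror image: the bodies are followed backwards from a common last position, using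
    -- uniqueness of left neighbours not in `gt`.
    · have walk : ∀ b, Relation.ReflTransGen (EqAdj M w) h b → b < j →
          Relation.ReflTransGen (EqAdj M w) h₂ b → i = i' := by
        intro b hhb
        have hb' := eqAdj_le hhb
        induction hhb with
        | refl =>
          intro hi h2
          rcases Relation.ReflTransGen.cases_tail h2 with h3 | ⟨b, h5, h6⟩
          · by_contra hne
            subst h3
            have := IHV i i' h o₂.1 o.1 (by omega) (by omega)
            simp [o₂.2.1] at this
          · have := eqAdj_le h5
            have := IHV b i' h h6.1 o.1 (by omega) (by omega)
            simp [h6.2] at this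
        | @tail c a hhc hca ih =>
          intro hi h2
          have := hca.1.lt
          have := eqAdj_le hhc
          rcases Relation.ReflTransGen.cases_tail h2 with h3 | ⟨b, h5, h6⟩
          · subst h3
            rcases lt_trichotomy c i with h | rfl | h
            · have := IHV i c _ o₂.1 hca.1 h (by omega)
              simp [o₂.2.1] at this
            · have := hca.2
              simp [o₂.2.1] at this
            · have := IHV c i _ hca.1 o₂.1 h (by omega)
              simp [hca.2] at this
          · have := eqAdj_le h5
            rcases lt_trichotomy c b with h | rfl | h
            · have := IHV _ _ _ h6.1 hca.1 h (by omega)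
              simp [h6.2] at this
            · exact ih (by omega) (by omega) h5
            · have := IHV _ _ _ hca.1 h6.1 h (by omega)
              simp [hca.2] at this
      have := walk _ o.2.2 (by omega) o₂.2.2
      omega
    · rcases o₂.locate ha₂ hr₂ (x := k) (by omega) (by omega) with
          ⟨p, q, hpq, h5⟩ | ⟨⟨q, hq, h5, h6⟩, -⟩
      · exact IHX p k q j hpq ha (by omega) (by omega) (by omega) (by omega)
      · exact h5 (IHU k q j hq ha (by omega) (by omega))

/-- Chains do not cross. -/
theorem Adj.noncrossing {i j x y : ℕ} (h : Adj M w i j) (h' : Adj M w x y) (h1 : i < x)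
    (h2 : x < j) : y ≤ j := by
  by_contra h3
  exact (adj_structure (M := M) (w := w) (y - i)).1 i x j y h h' h1 h2 (by omega) (by omega)

/-! ### Uniqueness of extremal neighbours and of the stack entry -/

theorem Adj.rel_eq_lt {i j j' : ℕ} (h : Adj M w i j) (h' : Adj M w i j') (h1 : j < j') :
    rel M w i j = some Prec.lt :=
  (adj_structure (M := M) (w := w) (j' - i)).2.1 i j j' h h' h1 (by omega)

theorem Adj.rel_eq_gt {i i' j : ℕ} (h : Adj M w i j) (h' : Adj M w i' j) (h1 : i' < i) :
    rel M w i j = some Prec.gt :=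
  (adj_structure (M := M) (w := w) (j - i')).2.2 i i' j h h' h1 (by omega)

/-- A right neighbour not in `lt` is the farthest one, hence unique. Together with `Adj.le_left`,
this selects the pair from which obligations of `i` are closed and the pair from which `j` is read.
-/
theorem Adj.right_le {i j j' : ℕ} (h : Adj M w i j) (hr : rel M w i j ≠ some Prec.lt)
    (h' : Adj M w i j') : j' ≤ j := by
  by_contra h1
  exact hr (h.rel_eq_lt h' (by omega))

theorem Adj.le_left {i i' j : ℕ} (h : Adj M w i j) (hr : rel M w i j ≠ some Prec.gt)
    (h' : Adj M w i' j) : i ≤ i' := by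
  by_contra h1
  exact hr (h.rel_eq_gt h' (by omega))

/-- Between the first body position of a chain and its right context, no position is adjacent to
its left context. -/
theorem Open.right_gap {i h k j x : ℕ} (o : Open M w i h k) (ha : Adj M w k j)
    (hr : rel M w k j = some Prec.gt) (hx : Adj M w i x) (h1 : h < x) : j ≤ x := by
  by_contra h2
  have := o.lt
  rcases o.locate ha hr (x := x) (by omega) (by omega) with ⟨p, q, hpq, h5⟩ | ⟨-, p, hp, h5, h6⟩
  · have := hx.noncrossing hpq (by omega) (by omega)
    omega
  · exact h5 (hp.rel_eq_gt hx (by omega))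

/-- Between the left context of a chain and its last body position, no position is adjacent to
its right context. -/
theorem Open.left_gap {i h k j x : ℕ} (o : Open M w i h k) (ha : Adj M w k j)
    (hr : rel M w k j = some Prec.gt) (hx : Adj M w x j) (h1 : x < k) : x ≤ i := by
  by_contra h2
  have := ha.lt
  rcases o.locate ha hr (x := x) (by omega) (by omega) with ⟨p, q, hpq, h5⟩ | ⟨⟨q, hq, h5, h6⟩, -⟩
  · have := hpq.noncrossing hx (by omega) (by omega)
    omega
  · exact h5 (hq.rel_eq_lt hx (by omega))

/-- Reading the body backwards involves no choice: each left neighbour not in `gt` is the farthest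
left neighbour, and its relation (`eq` or `lt`) decides whether the body continues or starts. Hence
the topmost position alone determines the stack entry, and a pop condition speaks of a single triple
of pairs. -/
theorem Open.unique {i h i' h' k : ℕ} (o : Open M w i h k) (o' : Open M w i' h' k) :
    i = i' ∧ h = h' := by
  obtain ⟨ha, hl, hw⟩ := o
  obtain ⟨ha', hl', hw'⟩ := o'
  induction hw with
  | refl =>
    rcases Relation.ReflTransGen.cases_tail hw' with rfl | ⟨b, h5, h6⟩
    · exact ⟨le_antisymm (ha.le_left (by simp [hl]) ha') (ha'.le_left (by simp [hl']) ha), rfl⟩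
    · obtain rfl := le_antisymm (ha.le_left (by simp [hl]) h6.1) (h6.1.le_left (by simp [h6.2]) ha)
      have := h6.2
      simp [hl] at this
  | @tail c a _ hca ih =>
    rcases Relation.ReflTransGen.cases_tail hw' with h3 | ⟨b, h5, h6⟩
    · subst h3
      obtain rfl := le_antisymm (ha'.le_left (by simp [hl']) hca.1)
        (hca.1.le_left (by simp [hca.2]) ha')
      have := hca.2
      simp [hl'] at this
    · obtain rfl := le_antisymm (hca.1.le_left (by simp [hca.2]) h6.1)
        (h6.1.le_left (by simp [h6.2]) hca.1)
      exact ih h5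

end Chains

section Labelling

variable {L : Type*} {M : OPM L} {w : List L}

/-! ## Runs of automata as labellings of the adjacent pairs of positions -/

/-- Adjacent positions of `# w #`. -/
def Act (M : OPM L) (w : List L) (i j : ℕ) : Prop :=
  Adj M w i j ∧ j ≤ w.length + 1

theorem Chain.act {i j : ℕ} (h : Chain M w i j) (hj : j ≤ w.length + 1) : Act M w i j :=
  ⟨.inr h, hj⟩

theorem act_succ {i : ℕ} (h : i ≤ w.length) : Act M w i (i + 1) :=
  ⟨.inl rfl, by omega⟩

theorem letterAt_none {j : ℕ} (h : w.length < j) : letterAt w j = none := by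
  cases j with
  | zero => rfl
  | succ j => simp only [letterAt, List.getElem?_eq_none_iff]; omega

theorem letterAt_some {j : ℕ} (h : 1 ≤ j) (h' : j ≤ w.length) : ∃ a, letterAt w j = some a := by
  cases j with
  | zero => omega
  | succ j => exact ⟨w[j], by simp [letterAt]⟩

theorem letterAt_bounds {j : ℕ} {a : L} (h : letterAt w j = some a) : 1 ≤ j ∧ j ≤ w.length := by
  constructor
  · by_contra h1
    obtain rfl : j = 0 := by omega
    simp [letterAt] at h
  · by_contra h1
    rw [letterAt_none (by omega)] at h
    cases h

theorem rel_last {i : ℕ} (h : 1 ≤ i) (h' : i ≤ w.length) :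
    rel M w i (w.length + 1) = some Prec.gt := by
  obtain ⟨a, ha⟩ := letterAt_some h h'
  simp [rel, ha, letterAt_none, OPM.ext]

theorem rel_zero_last : rel M w 0 (w.length + 1) = some Prec.eq := by
  simp [rel, letterAt, OPM.ext]

theorem rel_zero {j : ℕ} {a : L} (h : letterAt w j = some a) : rel M w 0 j = some Prec.lt := by
  simp only [rel, h]
  rfl

/-- Pairs that involve `#` always have a relation, so the two clauses of compatibility merge into
one condition on adjacent pairs. -/
theorem compatible_iff : Compatible M w ↔ ∀ i j, Act M w i j → (rel M w i j).isSome := by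
  constructor
  · rintro ⟨h1, h2⟩ i j ⟨rfl | hc, hj⟩
    · rcases Nat.eq_zero_or_pos i with rfl | hi
      · unfold rel
        cases letterAt w 1 <;> simp [letterAt, OPM.ext]
      · rcases Nat.lt_or_eq_of_le hj with hj | hj
        · exact h1 i hi (by omega)
        · have : letterAt w (i + 1) = none := letterAt_none (by omega)
          unfold rel
          cases h : letterAt w i <;> simp [this, OPM.ext]
    · exact h2 i j ⟨hj, hc⟩
  · intro h
    exact ⟨fun i _ hi => h _ _ (act_succ (by omega)), fun i j hij => h _ _ ⟨.inr hij.2, hij.1⟩⟩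

/-- The requirements of an automaton on the labels of the pairs reached from the pair `(i, j)`. -/
structure Local {Q : Type*} (A : OPA M Q) (w : List L) (S : ℕ → ℕ → Q) (i j : ℕ) : Prop where
  push : ∀ a, letterAt w j = some a → rel M w i j = some Prec.lt →
    (S i j, a, S j (j + 1)) ∈ A.push
  shift : ∀ a, letterAt w j = some a → rel M w i j = some Prec.eq →
    (S i j, a, S j (j + 1)) ∈ A.shift
  pop : ∀ i₀ h, Open M w i₀ h i → rel M w i j = some Prec.gt →
    (S i j, S i₀ h, S i₀ j) ∈ A.pop

/-- The stack `st` with topmost position `k` and states taken from the labelling `S`. -/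
inductive Represents {Q : Type*} (M : OPM L) (w : List L) (S : ℕ → ℕ → Q) :
    List (L × Q) → ℕ → Prop
  | nil : Represents M w S [] 0
  | cons (a : L) (st : List (L × Q)) (i h k : ℕ) : Represents M w S st i → Open M w i h k →
      letterAt w k = some a → Represents M w S ((a, S i h) :: st) k

theorem Represents.congr {Q : Type*} {S S' : ℕ → ℕ → Q} {st : List (L × Q)} {k : ℕ}
    (r : Represents M w S st k) (h : ∀ i j, j ≤ k → S i j = S' i j) :
    Represents M w S' st k := by
  induction r with
  | nil => exact .nil
  | cons a st i h' k _ o hk ih =>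
    have := o.le
    have := o.lt
    rw [h i h' o.le]
    exact .cons a st i h' k (ih fun _ _ hj => h _ _ (by omega)) o hk

theorem Represents.top {Q : Type*} {S : ℕ → ℕ → Q} {st : List (L × Q)} {k : ℕ}
    (r : Represents M w S st k) : st.head?.map Prod.fst = letterAt w k := by
  cases r with
  | nil => rfl
  | cons a st i h' k _ o hk => simp [hk]

theorem drop_eq_cons {j : ℕ} {a : L} (h : letterAt w j = some a) :
    w.drop (j - 1) = a :: w.drop j := by
  obtain ⟨h1, h2⟩ := letterAt_bounds h
  cases j with
  | zero => omega
  | succ j =>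
    simp only [letterAt] at h
    obtain ⟨h3, rfl⟩ := List.getElem?_eq_some_iff.1 h
    simp

theorem head?_drop {j : ℕ} (h : 1 ≤ j) : (w.drop (j - 1)).head? = letterAt w j := by
  cases j with
  | zero => omega
  | succ j => simp [letterAt]

/-- A labelling represents a configuration with all preceding requirements fulfilled. -/
def Traced {Q : Type*} (A : OPA M Q) (w : List L) (p : Q) (c : Config L Q) : Prop :=
  ∃ (S : ℕ → ℕ → Q) (k j : ℕ), S 0 1 = p ∧ Act M w k j ∧ c.input = w.drop (j - 1) ∧
    c.state = S k j ∧ Represents M w S c.stack k ∧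
    ∀ i' j', Act M w i' j' → j' < j ∨ j' = j ∧ k < i' →
      (rel M w i' j').isSome ∧ Local A w S i' j'

theorem Local.congr {Q : Type*} {A : OPA M Q} {S S' : ℕ → ℕ → Q} {i j : ℕ}
    (h : Local A w S i j) (h1 : S i j = S' i j) (h2 : S j (j + 1) = S' j (j + 1))
    (h3 : ∀ i₀ h, Open M w i₀ h i → S i₀ h = S' i₀ h)
    (h4 : ∀ i₀ h, Open M w i₀ h i → rel M w i j = some Prec.gt → S i₀ j = S' i₀ j) :
    Local A w S' i j where
  push a ha hr := by rw [← h1, ← h2]; exact h.push a ha hr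
  shift a ha hr := by rw [← h1, ← h2]; exact h.shift a ha hr
  pop i₀ h₀ o hr := by rw [← h1, ← h3 _ _ o, ← h4 _ _ o hr]; exact h.pop i₀ h₀ o hr

theorem update_ne {Q : Type*} {S : ℕ → ℕ → Q} {i j i' j' : ℕ} {q : Q} (h : i' ≠ i ∨ j' ≠ j) :
    Function.update S i (Function.update (S i) j q) i' j' = S i' j' := by
  by_cases hi : i' = i
  · subst hi
    simp [h.resolve_left (by simp)]
  · simp [hi]

/-- Push and shift share the bookkeeping: one new label is written at `(j, j + 1)`, and all pairs
with right end `j` become settled. Since the relation at `(k, j)` is not `gt`, `k` is the farthest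
left neighbour of `j`; the pairs further to the right were settled by earlier pops. -/
theorem Traced.step_read {Q : Type*} {A : OPA M Q} {S : ℕ → ℕ → Q} {k j : ℕ} {r : Q} {a : L}
    (ha : letterAt w j = some a) (hact : Act M w k j)
    (hr : rel M w k j = some Prec.lt ∧ (S k j, a, r) ∈ A.push ∨
      rel M w k j = some Prec.eq ∧ (S k j, a, r) ∈ A.shift)
    (hG : ∀ i' j', Act M w i' j' → j' < j ∨ j' = j ∧ k < i' →
      (rel M w i' j').isSome ∧ Local A w S i' j') :
    ∃ S' : ℕ → ℕ → Q, (∀ i' j', j' ≤ j → S' i' j' = S i' j') ∧ S' j (j + 1) = r ∧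
      ∀ i' j', Act M w i' j' → j' < j + 1 ∨ j' = j + 1 ∧ j < i' →
        (rel M w i' j').isSome ∧ Local A w S' i' j' := by
  have hgt : rel M w k j ≠ some Prec.gt := by rcases hr with h | h <;> simp [h.1]
  have hS : ∀ i' j', j' ≤ j → Function.update S j (Function.update (S j) (j + 1) r) i' j' =
      S i' j' := fun i' j' hj => update_ne (.inr (by omega))
  have hS' : Function.update S j (Function.update (S j) (j + 1) r) j (j + 1) = r := by simp
  refine ⟨Function.update S j (Function.update (S j) (j + 1) r), hS, hS', ?_⟩
  intro i' j' h' hlt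
  have hij := h'.1.lt
  have hL : ∀ i₀ h, Open M w i₀ h i' → h ≤ j := fun _ _ o => by have := o.le; omega
  rcases Nat.lt_or_eq_of_le (show j' ≤ j by omega) with hjj | rfl
  · obtain ⟨h1, h2⟩ := hG i' j' h' (.inl hjj)
    exact ⟨h1, h2.congr (hS _ _ (by omega)).symm (hS _ _ (by omega)).symm
      (fun i₀ h o => (hS _ _ (hL _ _ o)).symm) (fun i₀ h o _ => (hS _ _ (by omega)).symm)⟩
  rcases lt_trichotomy i' k with hk | rfl | hk
  · have := hact.1.le_left hgt h'.1
    omega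
  · rcases hr with ⟨h1, h2⟩ | ⟨h1, h2⟩
    · refine ⟨by simp [h1], ?_, ?_, ?_⟩
      · intro b hb _
        rw [ha] at hb
        cases hb
        rwa [hS', hS _ _ le_rfl]
      · intro b _ h; simp [h1] at h
      · intro _ _ _ h; simp [h1] at h
    · refine ⟨by simp [h1], ?_, ?_, ?_⟩
      · intro b _ h; simp [h1] at h
      · intro b hb _
        rw [ha] at hb
        cases hb
        rwa [hS', hS _ _ le_rfl]
      · intro _ _ _ h; simp [h1] at h
  -- A nearer left neighbour is in `gt`, so only its pop requirement is nonvacuous, and that one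
  -- does not involve the new label.
  · obtain ⟨h1, h2⟩ := hG i' j' h' (.inr ⟨rfl, hk⟩)
    have := h'.1.rel_eq_gt hact.1 hk
    refine ⟨h1, ?_, ?_, ?_⟩
    · intro b _ h; simp [this] at h
    · intro b _ h; simp [this] at h
    · intro i₀ h o hh
      rw [hS _ _ le_rfl, hS _ _ le_rfl, hS _ _ (hL _ _ o)]
      exact h2.pop _ _ o hh

theorem of_cons_eq_drop {j : ℕ} {a : L} {x : List L} (hj : 1 ≤ j) (h : a :: x = w.drop (j - 1)) :
    letterAt w j = some a ∧ x = w.drop j := by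
  have h1 : letterAt w j = some a := by rw [← head?_drop hj, ← h]; rfl
  rw [drop_eq_cons h1] at h
  exact ⟨h1, (List.cons.inj h).2⟩

/-- The labelling is written while the run proceeds, in the order of the parser: increasing right
end, then decreasing left end. Every move writes one fresh pair and settles the pair it leaves. -/
theorem Traced.step {Q : Type*} {A : OPA M Q} {p : Q} {c d : Config L Q} (hc : Traced A w p c)
    (h : A.Step c d) : Traced A w p d := by
  obtain ⟨S, k, j, h0, hact, hin, hst, hrep, hG⟩ := hc
  have hkj := hact.1.lt
  cases h with
  | push a x p q s prec tr =>
    simp only at hin hst hrep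
    obtain ⟨ha, rfl⟩ := of_cons_eq_drop (by omega) hin
    have hjl := letterAt_bounds ha
    have hrel : rel M w k j = some Prec.lt := by rw [rel, ← hrep.top, ha]; exact prec
    subst hst
    obtain ⟨S', h1, h2, h3⟩ := Traced.step_read ha hact (.inl ⟨hrel, tr⟩) hG
    refine ⟨S', j, j + 1, by rw [h1 _ _ (by omega), h0], act_succ (by omega), rfl, h2.symm, ?_, h3⟩
    simp only
    rw [← h1 _ _ le_rfl]
    exact .cons a s k j j (hrep.congr fun _ _ _ => (h1 _ _ (by omega)).symm)
      (.of_lt hact.1 hrel) ha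
  | shift a b x p q r s prec tr =>
    simp only at hin hst hrep
    obtain ⟨ha, rfl⟩ := of_cons_eq_drop (by omega) hin
    have hjl := letterAt_bounds ha
    cases hrep with
    | cons _ _ i h _ hrep o hk =>
    have hrel : rel M w k j = some Prec.eq := by rw [rel, hk, ha]; exact prec
    subst hst
    obtain ⟨S', h1, h2, h3⟩ := Traced.step_read ha hact (.inr ⟨hrel, tr⟩) hG
    refine ⟨S', j, j + 1, by rw [h1 _ _ (by omega), h0], act_succ (by omega), rfl, h2.symm, ?_, h3⟩
    have := o.le
    have := o.lt
    simp only
    rw [← h1 _ _ (by omega)]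
    exact .cons b s i h j (hrep.congr fun _ _ _ => (h1 _ _ (by omega)).symm)
      (o.of_eq hact.1 hrel) ha
  | pop a x p q r s prec tr =>
    simp only at hin hst hrep
    cases hrep with
    | cons _ _ i h _ hrep o hk =>
    have hrel : rel M w k j = some Prec.gt := by
      rw [rel, hk, ← head?_drop (by omega), ← hin]; exact prec
    subst hst
    have := o.le
    have := o.lt
    have hS : ∀ i' j', i' ≠ i ∨ j' ≠ j →
        Function.update S i (Function.update (S i) j r) i' j' = S i' j' :=
      fun i' j' hj => update_ne hj
    have hS' : Function.update S i (Function.update (S i) j r) i j = r := by simp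
    refine ⟨Function.update S i (Function.update (S i) j r), i, j, ?_,
      (o.chain hact.1 hrel).act hact.2, hin, hS'.symm, ?_, ?_⟩
    · rw [hS _ _ (by omega), h0]
    · exact hrep.congr fun _ _ _ => (hS _ _ (by omega)).symm
    · intro i' j' h' hlt
      have hij := h'.1.lt
      by_cases hk' : j' < j ∨ k < i'
      · obtain ⟨h1, h2⟩ := hG i' j' h' (by omega)
        refine ⟨h1, h2.congr (hS _ _ (by omega)).symm (hS _ _ (by omega)).symm
          (fun i₀ h o' => (hS _ _ ?_).symm) (fun i₀ h o' hgt => ?_)⟩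
        · have := o'.le; omega
        · rw [hS]
          -- An already settled pop must not have written the label now overwritten. If it concerned
          -- the same `j`, its target is at or after `k` by `Open.left_gap`, hence different from
          -- `i`.
          by_cases hjj : j' = j
          · subst hjj
            left
            have := o'.left_gap h'.1 hgt hact.1 (by omega)
            omega
          · exact .inr hjj
      · obtain rfl : j' = j := by omega
        -- No left neighbour of `j` lies strictly between `i` and `k`, so the pop settles only the
        -- pair `(k, j)`.
        obtain rfl : i' = k := by
          by_contra hne
          have := o.left_gap hact.1 hrel h'.1 (by omega)
          omega
        refine ⟨by simp [hrel], ?_, ?_, ?_⟩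
        · intro b _ h; simp [hrel] at h
        · intro b _ h; simp [hrel] at h
        · intro i₀ h₀ o' _
          obtain ⟨rfl, rfl⟩ := o.unique o'
          rw [hS', hS _ _ (by omega), hS _ _ (by omega)]
          exact tr

/-- The parser is deterministic once the labels are given. Termination is measured by twice the
unread positions plus the stack height: reading lowers the first summand by two and adds at most one
symbol, and a pop removes a symbol. -/
theorem run_of_labelling {Q : Type*} {A : OPA M Q} {S : ℕ → ℕ → Q}
    (hc : ∀ i j, Act M w i j → (rel M w i j).isSome)
    (hL : ∀ i j, Act M w i j → Local A w S i j) :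
    ∀ (N : ℕ) (k j : ℕ) (st : List (L × Q)), 2 * (w.length + 1 - j) + st.length ≤ N →
      Act M w k j → Represents M w S st k →
      Relation.ReflTransGen A.Step ⟨w.drop (j - 1), S k j, st⟩ ⟨[], S 0 (w.length + 1), []⟩ := by
  intro N
  induction N using Nat.strong_induction_on with
  | _ N IH =>
  intro k j st hN hact hrep
  have hkj := hact.1.lt
  have hjl := hact.2
  have htop := hrep.top
  have hloc := hL k j hact
  rcases Nat.lt_or_eq_of_le hact.2 with hj | hj
  · obtain ⟨a, ha⟩ := letterAt_some (w := w) (j := j) (by omega) (by omega)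
    rw [drop_eq_cons ha]
    obtain ⟨r, hr⟩ := Option.isSome_iff_exists.1 (hc k j hact)
    cases r with
    | lt =>
      refine .head (.push a _ _ _ _ ?_ (hloc.push a ha hr))
        (IH (N - 1) (by omega) j (j + 1) _ ?_ (act_succ (by omega))
          (.cons a st k j j hrep (.of_lt hact.1 hr) ha))
      · rw [htop, ← ha]; exact hr
      · simp only [List.length_cons]; omega
    | eq =>
      cases hrep with
      | nil => rw [rel_zero ha] at hr; cases hr
      | cons b st i h _ hrep o hk =>
      refine .head (.shift b a _ _ _ _ _ ?_ (hloc.shift a ha hr))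
        (IH (N - 1) (by omega) j (j + 1) _ ?_ (act_succ (by omega))
          (.cons a st i h j hrep (o.of_eq hact.1 hr) ha))
      · rw [rel, hk, ha] at hr; exact hr
      · simp only [List.length_cons] at hN ⊢; omega
    | gt =>
      cases hrep with
      | nil => rw [rel_zero ha] at hr; cases hr
      | cons b st i h _ hrep o hk =>
      rw [← drop_eq_cons ha]
      simp only [List.length_cons] at hN
      refine .head (.pop b _ _ _ _ _ ?_ (hloc.pop i h o hr))
        (IH (N - 1) (by omega) i j st (by omega) ((o.chain hact.1 hr).act hact.2) hrep)
      rw [head?_drop (by omega)]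
      rw [rel, hk] at hr; exact hr
  · subst hj
    cases hrep with
    | nil => simp [Relation.ReflTransGen.refl]
    | cons b st i h _ hrep o hk =>
      have hb := letterAt_bounds hk
      have hr := rel_last (M := M) hb.1 hb.2
      simp only [List.length_cons] at hN
      refine .head (.pop b _ _ _ _ _ ?_ (hloc.pop i h o hr))
        (IH (N - 1) (by omega) i _ st (by omega) ((o.chain hact.1 hr).act hact.2) hrep)
      rw [head?_drop (by omega)]
      rw [rel, hk] at hr; exact hr

/-- A word is accepted iff it is compatible with the matrix and its adjacent pairs of positions
admit a labelling fulfilling all local requirements. -/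
theorem mem_language_iff {Q : Type*} (A : OPA M Q) :
    w ∈ A.language ↔ Compatible M w ∧ ∃ S : ℕ → ℕ → Q, S 0 1 ∈ A.init ∧
      S 0 (w.length + 1) ∈ A.final ∧ ∀ i j, Act M w i j → Local A w S i j := by
  rw [compatible_iff]
  constructor
  · rintro ⟨p, hp, q, hq, hrun⟩
    have h0 : Traced A w p ⟨w, p, []⟩ := by
      refine ⟨fun _ _ => p, 0, 1, rfl, act_succ (by omega), rfl, rfl, .nil, ?_⟩
      intro i j h h'
      have := h.1.lt
      omega
    have h1 : Traced A w p ⟨[], q, []⟩ := by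
      generalize (⟨[], q, []⟩ : Config L Q) = c at hrun ⊢
      induction hrun with
      | refl => exact h0
      | tail _ h ih => exact ih.step h
    obtain ⟨S, k, j, h0, hact, hin, hst, hrep, hG⟩ := h1
    cases hrep
    have hjl := hact.2
    have hlt := hact.1.lt
    have hj : j = w.length + 1 := by
      have := List.drop_eq_nil_iff.1 hin.symm
      omega
    subst hj
    -- Only `(0, w.length + 1)` was not left by any move. Its relation is `eq` and no letter is read
    -- there, so its local conditions are vacuous.
    have key : ∀ i' j', Act M w i' j' → (rel M w i' j').isSome ∧ Local A w S i' j' := by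
      intro i' j' h'
      by_cases hlt : j' < w.length + 1 ∨ j' = w.length + 1 ∧ 0 < i'
      · exact hG i' j' h' hlt
      · have := h'.2
        obtain rfl : j' = w.length + 1 := by omega
        obtain rfl : i' = 0 := by omega
        refine ⟨by simp [rel_zero_last], ?_, ?_, ?_⟩
        · intro a ha; simp [letterAt_none] at ha
        · intro a ha; simp [letterAt_none] at ha
        · intro _ _ _ h; simp [rel_zero_last] at h
    exact ⟨fun i j h => (key i j h).1, S, h0 ▸ hp, hst ▸ hq, fun i j h => (key i j h).2⟩
  · rintro ⟨hc, S, h0, hf, hL⟩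
    exact ⟨_, h0, _, hf, run_of_labelling hc hL _ 0 1 [] le_rfl (act_succ (by omega)) .nil⟩

end Labelling

section Existence

variable {L : Type*} {M : OPM L} {w : List L}

/-! ## Adjacent positions in compatible words -/

theorem Compatible.rel_cases (hc : Compatible M w) {i j : ℕ} (h : Act M w i j) :
    rel M w i j = some Prec.lt ∨ rel M w i j = some Prec.eq ∨ rel M w i j = some Prec.gt := by
  obtain ⟨r, hr⟩ := Option.isSome_iff_exists.1 (compatible_iff.1 hc i j h)
  cases r <;> simp [hr]

theorem rel_zero_ne_gt {j : ℕ} : rel M w 0 j ≠ some Prec.gt := by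
  rw [rel, show letterAt w 0 = none from rfl]
  cases letterAt w j <;> simp [OPM.ext]

theorem rel_last_ne_lt {i : ℕ} : rel M w i (w.length + 1) ≠ some Prec.lt := by
  have : letterAt w (w.length + 1) = none := letterAt_none (by omega)
  cases h : letterAt w i <;> simp [rel, this, h, OPM.ext]

/-- As long as the relation is `gt`, a pop replaces `i` by the smaller left context of its body. The
descent stops at `0` at the latest, since `#` never takes precedence. -/
theorem exists_left_aux {j : ℕ} (ho : ∀ k, 1 ≤ k → k < j → ∃ i h, Open M w i h k) :
    ∀ i, Act M w i j → ∃ i', Act M w i' j ∧ rel M w i' j ≠ some Prec.gt := by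
  intro i
  induction i using Nat.strong_induction_on with
  | _ i IH =>
  intro hact
  by_cases hr : rel M w i j = some Prec.gt
  · have hi : 1 ≤ i := by
      by_contra h0
      obtain rfl : i = 0 := by omega
      exact rel_zero_ne_gt hr
    obtain ⟨i₀, h, o⟩ := ho i hi hact.1.lt
    have := o.le
    have := o.lt
    exact IH i₀ (by omega) ((o.chain hact.1 hr).act hact.2)
  · exact ⟨i, hact, hr⟩

theorem Compatible.exists_open (hc : Compatible M w) :
    ∀ k, 1 ≤ k → k ≤ w.length → ∃ i h, Open M w i h k := by
  intro k
  induction k using Nat.strong_induction_on with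
  | _ k IH =>
  intro h1 h2
  have hact := act_succ (M := M) (w := w) (i := k - 1) (by omega)
  rw [Nat.sub_add_cancel h1] at hact
  -- At the farthest left neighbour, `lt` opens a new body and `eq` extends the body ending there,
  -- which exists by induction.
  obtain ⟨i, hi, hr⟩ := exists_left_aux (fun k' h h' => IH k' h' h (by omega)) _ hact
  have hik := hi.1.lt
  rcases hc.rel_cases hi with h | h | h
  · exact ⟨i, k, .of_lt hi.1 h⟩
  · have : 1 ≤ i := by
      by_contra h0
      obtain rfl : i = 0 := by omega
      obtain ⟨a, ha⟩ := letterAt_some h1 h2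
      rw [rel_zero ha] at h
      cases h
    obtain ⟨i₀, h₀, o⟩ := IH i hik this (by omega)
    exact ⟨i₀, h₀, o.of_eq hi.1 h⟩
  · exact absurd h hr

theorem Compatible.exists_left (hc : Compatible M w) {j : ℕ} (h1 : 1 ≤ j)
    (h2 : j ≤ w.length + 1) : ∃ i, Act M w i j ∧ rel M w i j ≠ some Prec.gt := by
  have hact := act_succ (M := M) (w := w) (i := j - 1) (by omega)
  rw [Nat.sub_add_cancel h1] at hact
  exact exists_left_aux (fun k h h' => hc.exists_open k h (by omega)) _ hact

/-- An open body is followed to the right: at the neighbour not in `lt` it is either extended or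
closed. It cannot be extended past the word, because the final `#` is met with `gt`. -/
theorem exists_close_aux {N : ℕ} (hN : ∀ k, N < k → k ≤ w.length →
      ∃ j, Act M w k j ∧ rel M w k j ≠ some Prec.lt) (hc : Compatible M w) {i h : ℕ} :
    ∀ d k, w.length + 1 ≤ k + d → Open M w i h k → N < k → k ≤ w.length →
      ∃ k' j, Open M w i h k' ∧ Act M w k' j ∧ rel M w k' j = some Prec.gt := by
  intro d
  induction d with
  | zero => intros; omega
  | succ d ih =>
    intro k hd o h1 h2
    obtain ⟨j, hj, hr⟩ := hN k h1 h2
    have hkj := hj.1.lt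
    rcases hc.rel_cases hj with h | h | h
    · exact absurd h hr
    · refine ih j (by omega) (o.of_eq hj.1 h) (by omega) ?_
      by_contra h3
      obtain rfl : j = w.length + 1 := by have := hj.2; omega
      rw [rel_last (by omega) h2] at h
      cases h
    · exact ⟨k, j, o, hj, h⟩

/-- If `k` yields to `j`, the body opened by `j` closes at some later `j'`, and `(k, j')` is again
adjacent. Moving on in this way reaches a pair not in `lt`, at the latest in the final `#`. Closing
that body needs the same statement for positions after `k`, hence the outer induction on `w.length -
k`. -/
theorem Compatible.exists_right (hc : Compatible M w) {k : ℕ} (hk : k ≤ w.length) :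
    ∃ j, Act M w k j ∧ rel M w k j ≠ some Prec.lt := by
  induction h : w.length - k using Nat.strong_induction_on generalizing k with
  | _ N IH =>
  have key : ∀ d j, w.length + 1 ≤ j + d → Act M w k j →
      ∃ j, Act M w k j ∧ rel M w k j ≠ some Prec.lt := by
    intro d
    induction d with
    | zero =>
      intro j hd hj
      obtain rfl : j = w.length + 1 := by have := hj.2; omega
      exact ⟨_, hj, rel_last_ne_lt⟩
    | succ d ih =>
      intro j hd hj
      by_cases hr : rel M w k j = some Prec.lt
      · have hkj := hj.1.lt
        have hjl : j ≤ w.length := by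
          by_contra h3
          obtain rfl : j = w.length + 1 := by have := hj.2; omega
          exact rel_last_ne_lt hr
        obtain ⟨k', j', o, hj', hr'⟩ := exists_close_aux (N := k)
          (fun k' h1 h2 => IH _ (by omega) h2 rfl) hc (w.length + 1) j (by omega)
          (.of_lt hj.1 hr) hkj hjl
        have := o.le
        have := hj'.1.lt
        exact ih j' (by omega) ((o.chain hj'.1 hr').act hj'.2)
      · exact ⟨j, hj, hr⟩
  exact key (w.length + 1) (k + 1) (by omega) (act_succ hk)

theorem Compatible.exists_close (hc : Compatible M w) {i h : ℕ} (ha : Act M w i h)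
    (hr : rel M w i h = some Prec.lt) :
    ∃ k j, Open M w i h k ∧ Act M w k j ∧ rel M w k j = some Prec.gt := by
  have := ha.1.lt
  refine exists_close_aux (N := 0) (fun k _ h2 => hc.exists_right h2) hc (w.length + 1) h
    (by omega) (.of_lt ha.1 hr) (by omega) ?_
  by_contra h3
  obtain rfl : h = w.length + 1 := by have := ha.2; omega
  exact rel_last_ne_lt hr

theorem chi_iff {i j : ℕ} : chi M w i j ↔ Act M w i j ∧ i + 1 ≠ j :=
  ⟨fun h => ⟨⟨.inr h.2, h.1⟩, h.2.add_one_lt.ne⟩, fun h => ⟨h.1.2, h.1.1.chain h.2⟩⟩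

/-- The farthest neighbour is the end of the maximal chain unless it is just the next position, in
which case there is no chain at all. Thus the matching operators need to be inspected at one pair
only. -/
theorem chiFwd_iff {i j : ℕ} (h : Act M w i j) (hr : rel M w i j ≠ some Prec.lt) (j' : ℕ) :
    chiFwd M w i j' ↔ j' = j ∧ i + 1 ≠ j := by
  constructor
  · intro h'
    have h1 := chi_iff.1 h'.1
    have h2 := h.1.right_le hr h1.1.1
    have h3 := h1.1.1.lt
    have h4 : i + 1 ≠ j := by omega
    have := h'.2 (chi_iff.2 ⟨h, h4⟩)
    exact ⟨by omega, h4⟩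
  · rintro ⟨rfl, h1⟩
    exact ⟨chi_iff.2 ⟨h, h1⟩, fun k hk => h.1.right_le hr (chi_iff.1 hk).1.1⟩

theorem chiBwd_iff {i j : ℕ} (h : Act M w i j) (hr : rel M w i j ≠ some Prec.gt) (i' : ℕ) :
    chiBwd M w i' j ↔ i' = i ∧ i + 1 ≠ j := by
  constructor
  · intro h'
    have h1 := chi_iff.1 h'.1
    have h2 := h.1.le_left hr h1.1.1
    have h3 := h1.1.1.lt
    have h4 : i + 1 ≠ j := by omega
    have := h'.2 (chi_iff.2 ⟨h, h4⟩)
    exact ⟨by omega, h4⟩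
  · rintro ⟨rfl, h1⟩
    exact ⟨chi_iff.2 ⟨h, h1⟩, fun k hk => h.1.le_left hr (chi_iff.1 hk).1.1⟩

end Existence

section Paths

/-! ## Paths through the positions satisfying a predicate -/

/-- The positions `p 0 < … < p m` are consecutive among those satisfying `E`. -/
def Consecutive (E : ℕ → Prop) (m : ℕ) (p : ℕ → ℕ) : Prop :=
  (∀ k, k < m → p k < p (k + 1)) ∧ (∀ k, k ≤ m → E (p k)) ∧
    ∀ k, k < m → ∀ x, p k < x → x < p (k + 1) → ¬ E x

theorem Consecutive.mono {E : ℕ → Prop} {m : ℕ} {p : ℕ → ℕ} (h : Consecutive E m p) :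
    ∀ {a b : ℕ}, a < b → b ≤ m → p a < p b := by
  intro a b hab
  induction hab with
  | refl => intro hb; exact h.1 a hb
  | step _ ih => intro hb; exact (ih (Nat.le_of_succ_le hb)).trans (h.1 _ hb)

theorem Consecutive.covers {E : ℕ → Prop} {m : ℕ} {p : ℕ → ℕ} (h : Consecutive E m p) {x : ℕ}
    (hx : E x) (h0 : p 0 ≤ x) : ∀ {n : ℕ}, n ≤ m → x ≤ p n → ∃ k, k ≤ n ∧ p k = x := by
  intro n
  induction n with
  | zero => intro _ h1; exact ⟨0, le_rfl, le_antisymm h0 h1⟩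
  | succ n ih =>
    intro hn h1
    rcases le_or_gt x (p n) with h2 | h2
    · obtain ⟨k, hk, h3⟩ := ih (by omega) h2
      exact ⟨k, by omega, h3⟩
    · rcases Nat.lt_or_eq_of_le h1 with h3 | h3
      · exact absurd hx (h.2.2 n hn x h2 h3)
      · exact ⟨n + 1, le_rfl, h3.symm⟩

theorem exists_consecutive {E : ℕ → Prop} {a : ℕ} (ha : E a) :
    ∀ b, a ≤ b → E b → ∃ m p, Consecutive E m p ∧ p 0 = a ∧ p m = b := by
  intro b
  induction b using Nat.strong_induction_on with
  | _ b IH =>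
  intro hab hb
  rcases Nat.lt_or_eq_of_le hab with hlt | rfl
  · classical
    -- The predecessor of `b` in `E` is the greatest element of `E` below `b`.
    have hex : ∃ c, c < b ∧ E c ∧ a ≤ c ∧ ∀ x, c < x → x < b → ¬ E x := by
      refine ⟨Nat.findGreatest E (b - 1), ?_, Nat.findGreatest_spec (show a ≤ b - 1 by omega) ha,
        Nat.le_findGreatest (by omega) ha, fun x h1 h2 =>
          Nat.findGreatest_is_greatest h1 (by omega)⟩
      have := Nat.findGreatest_le (P := E) (b - 1)
      omega
    obtain ⟨c, h1, h2, h3, h4⟩ := hex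
    obtain ⟨m, p, hp, hp0, hpm⟩ := IH c h1 h3 h2
    refine ⟨m + 1, fun k => if k ≤ m then p k else b, ⟨?_, ?_, ?_⟩, by simpa using hp0, by simp⟩
    · intro k hk
      rcases Nat.lt_succ_iff_lt_or_eq.1 hk with h | rfl
      · simpa [h.le, Nat.succ_le_iff.2 h] using hp.1 k h
      · simpa [hpm] using h1
    · intro k hk
      by_cases h : k ≤ m
      · simpa [h] using hp.2.1 k h
      · simpa [h] using hb
    · intro k hk
      rcases Nat.lt_succ_iff_lt_or_eq.1 hk with h | rfl
      · simpa [h.le, Nat.succ_le_iff.2 h] using hp.2.2 k h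
      · simpa [hpm] using h4
  · exact ⟨0, fun _ => a, ⟨by omega, fun _ _ => ha, by omega⟩, rfl, rfl⟩

/-- A path through consecutive positions of `E` from the first one is determined by its last
position, so paths can be eliminated in favour of a bounded quantification over `E`. -/
theorem untilOn_consecutive_iff {P : ℕ → (ℕ → ℕ) → Prop} {E A B : ℕ → Prop}
    (hP : ∀ m p, P m p ↔ Consecutive E m p ∧ ∀ x, x < p 0 → ¬ E x) :
    untilOn P A B ↔ ∃ k, E k ∧ B k ∧ ∀ x, x < k → E x → A x := by
  constructor
  · rintro ⟨m, p, hp, hA, hB⟩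
    obtain ⟨hc, h0⟩ := (hP m p).1 hp
    refine ⟨p m, hc.2.1 m le_rfl, hB, fun x hx hE => ?_⟩
    obtain ⟨k, hk, rfl⟩ := hc.covers hE (by by_contra h; exact h0 x (by omega) hE) le_rfl hx.le
    refine hA k (lt_of_le_of_ne hk ?_)
    rintro rfl
    omega
  · rintro ⟨k, hE, hB, hA⟩
    classical
    have hex : ∃ x, E x := ⟨k, hE⟩
    obtain ⟨m, p, hc, h0, hm⟩ := exists_consecutive (Nat.find_spec hex) k (Nat.find_le hE) hE
    refine ⟨m, p, (hP m p).2 ⟨hc, fun x hx => Nat.find_min hex (h0 ▸ hx)⟩, fun x hx => ?_, hm ▸ hB⟩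
    exact hA _ (hm ▸ hc.mono hx le_rfl) (hc.2.1 x hx.le)

/-- The bound `N` guarantees that `E` has a last position, where the path must end. -/
theorem sinceOn_consecutive_iff {P : ℕ → (ℕ → ℕ) → Prop} {E A B : ℕ → Prop} {N : ℕ}
    (hN : ∀ x, E x → x ≤ N)
    (hP : ∀ m p, P m p ↔ Consecutive E m p ∧ ∀ x, p m < x → ¬ E x) :
    sinceOn P A B ↔ ∃ k, E k ∧ B k ∧ ∀ x, k < x → E x → A x := by
  constructor
  · rintro ⟨m, p, hp, hB, hA⟩
    obtain ⟨hc, h0⟩ := (hP m p).1 hp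
    refine ⟨p 0, hc.2.1 0 (by omega), hB, fun x hx hE => ?_⟩
    obtain ⟨k, hk, rfl⟩ := hc.covers hE hx.le le_rfl (by by_contra h; exact h0 x (by omega) hE)
    refine hA k (Nat.pos_of_ne_zero ?_) hk
    rintro rfl
    omega
  · rintro ⟨k, hE, hB, hA⟩
    classical
    obtain ⟨m, p, hc, h0, hm⟩ := exists_consecutive hE (Nat.findGreatest E N)
      (Nat.le_findGreatest (hN k hE) hE) (Nat.findGreatest_spec (hN k hE) hE)
    refine ⟨m, p, (hP m p).2 ⟨hc, fun x hx hEx => ?_⟩, h0 ▸ hB, fun x h1 hx => ?_⟩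
    · exact Nat.findGreatest_is_greatest (hm ▸ hx) (hN x hEx) hEx
    · exact hA _ (h0 ▸ hc.mono h1 hx) (hc.2.1 x hx)

end Paths

section Hierarchical

variable {L : Type*} {M : OPM L} {w : List L} {A B : ℕ → Prop} {i h k j : ℕ}

/-! ## Hierarchical operators -/

/-- The until operator on the yield-precedence positions of `i` from `j` on. -/
def YieldU (M : OPM L) (w : List L) (A B : ℕ → Prop) (i j : ℕ) : Prop :=
  ∃ k, j ≤ k ∧ YieldEnd M w i k ∧ B k ∧ ∀ x, j ≤ x → x < k → YieldEnd M w i x → A x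

/-- The since operator on the yield-precedence positions of `i` before `j`. -/
def YieldS (M : OPM L) (w : List L) (A B : ℕ → Prop) (i j : ℕ) : Prop :=
  ∃ k, k < j ∧ YieldEnd M w i k ∧ B k ∧ ∀ x, k < x → x < j → YieldEnd M w i x → A x

/-- The until operator on the take-precedence positions of `j` after `i`. -/
def TakeU (M : OPM L) (w : List L) (A B : ℕ → Prop) (i j : ℕ) : Prop :=
  ∃ k, i < k ∧ TakeStart M w j k ∧ B k ∧ ∀ x, i < x → x < k → TakeStart M w j x → A x

/-- The since operator on the take-precedence positions of `j` up to `i`. -/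
def TakeS (M : OPM L) (w : List L) (A B : ℕ → Prop) (i j : ℕ) : Prop :=
  ∃ k, k ≤ i ∧ TakeStart M w j k ∧ B k ∧ ∀ x, k < x → x ≤ i → TakeStart M w j x → A x

theorem yieldEnd_iff : YieldEnd M w i j ↔ rel M w i j = some Prec.lt ∧ Act M w i j ∧ i + 1 ≠ j := by
  rw [YieldEnd, chi_iff]

theorem takeStart_iff : TakeStart M w j i ↔
      rel M w i j = some Prec.gt ∧ Act M w i j ∧ i + 1 ≠ j := by
  rw [TakeStart, chi_iff]

theorem YieldEnd.lt (h : YieldEnd M w i j) : i < j := (yieldEnd_iff.1 h).2.1.1.lt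

theorem TakeStart.lt (h : TakeStart M w j i) : i < j := (takeStart_iff.1 h).2.1.1.lt

theorem YieldEnd.le (h : YieldEnd M w i j) : j ≤ w.length + 1 := (yieldEnd_iff.1 h).2.1.2

/-! ### Hierarchical paths as scans over the neighbours of a position -/

theorem yieldUntil_iff :
    untilOn (fun m p => YieldPath M w i m p ∧ ∀ x, i < x → x < p 0 → ¬ YieldEnd M w i x) A B ↔
      YieldU M w A B i (i + 1) := by
  rw [untilOn_consecutive_iff (E := YieldEnd M w i)]
  · constructor
    · rintro ⟨k, h1, h2, h3⟩
      exact ⟨k, h1.lt, h1, h2, fun x _ => h3 x⟩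
    · rintro ⟨k, _, h1, h2, h3⟩
      exact ⟨k, h1, h2, fun x hx hE => h3 x hE.lt hx hE⟩
  · intro m p
    constructor
    · rintro ⟨⟨h1, h2, h3, h4⟩, h5⟩
      exact ⟨⟨h1.1, h3, h4⟩, fun x hx hE => h5 x hE.lt hx hE⟩
    · rintro ⟨⟨h1, h2, h3⟩, h4⟩
      exact ⟨⟨⟨h1, (h2 m le_rfl).le⟩, (h2 0 (by omega)).lt, h2, h3⟩, fun x _ => h4 x⟩

theorem yieldSince_iff :
    sinceOn (fun m p => YieldPath M w i m p ∧ ∀ x, p m < x → ¬ YieldEnd M w i x) A B ↔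
      -- The upper bound of the scan is strict, so `w.length + 2` includes the final `#`.
      YieldS M w A B i (w.length + 2) := by
  rw [sinceOn_consecutive_iff (E := YieldEnd M w i) (fun x hx => hx.le)]
  · constructor
    · rintro ⟨k, h1, h2, h3⟩
      exact ⟨k, Nat.lt_succ_of_le h1.le, h1, h2, fun x hx _ => h3 x hx⟩
    · rintro ⟨k, _, h1, h2, h3⟩
      exact ⟨k, h1, h2, fun x hx hE => h3 x hx (Nat.lt_succ_of_le hE.le) hE⟩
  · intro m p
    constructor
    · rintro ⟨⟨h1, h2, h3, h4⟩, h5⟩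
      exact ⟨⟨h1.1, h3, h4⟩, h5⟩
    · rintro ⟨⟨h1, h2, h3⟩, h4⟩
      exact ⟨⟨⟨h1, (h2 m le_rfl).le⟩, (h2 0 (by omega)).lt, h2, h3⟩, h4⟩

theorem TakeStart.right_le (h : TakeStart M w j i) : j ≤ w.length + 1 := (takeStart_iff.1 h).2.1.2

theorem takeUntil_iff :
    untilOn (fun m p => TakePath M w j m p ∧ ∀ x, x < p 0 → ¬ TakeStart M w j x) A B ↔
      ∃ k, TakeStart M w j k ∧ B k ∧ ∀ x, x < k → TakeStart M w j x → A x := by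
  rw [untilOn_consecutive_iff (E := TakeStart M w j)]
  intro m p
  constructor
  · rintro ⟨⟨h1, h2, h3, h4⟩, h5⟩
    exact ⟨⟨h1.1, h3, h4⟩, h5⟩
  · rintro ⟨⟨h1, h2, h3⟩, h4⟩
    have := (h2 m le_rfl).lt
    have := (h2 m le_rfl).right_le
    exact ⟨⟨⟨h1, by omega⟩, (h2 m le_rfl).lt, h2, h3⟩, h4⟩

theorem takeSince_iff :
    sinceOn (fun m p => TakePath M w j m p ∧ ∀ x, p m < x → x < j → ¬ TakeStart M w j x) A B ↔
      TakeS M w A B (j - 1) j := by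
  rw [sinceOn_consecutive_iff (E := TakeStart M w j) (N := j - 1) (fun x hx =>
      Nat.le_pred_of_lt hx.lt)]
  · constructor
    · rintro ⟨k, h1, h2, h3⟩
      exact ⟨k, Nat.le_pred_of_lt h1.lt, h1, h2, fun x hx _ => h3 x hx⟩
    · rintro ⟨k, _, h1, h2, h3⟩
      exact ⟨k, h1, h2, fun x hx hE => h3 x hx (Nat.le_pred_of_lt hE.lt) hE⟩
  · intro m p
    constructor
    · rintro ⟨⟨h1, h2, h3, h4⟩, h5⟩
      exact ⟨⟨h1.1, h3, h4⟩, fun x hx hE => h5 x hx hE.lt hE⟩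
    · rintro ⟨⟨h1, h2, h3⟩, h4⟩
      have := (h2 m le_rfl).lt
      have := (h2 m le_rfl).right_le
      exact ⟨⟨⟨h1, by omega⟩, (h2 m le_rfl).lt, h2, h3⟩, fun x hx _ => h4 x hx⟩

/-- By `Open.right_gap` the next neighbour of `i` after `h` is `j`. So the scan from `h` examines
`h`, unless it is merely `i + 1` and thus not the end of a chain, and continues as the scan from
`j`. This is the recurrence carried by a pop. -/
theorem YieldU.step (o : Open M w i h k) (ha : Act M w k j) (hr : rel M w k j = some Prec.gt) :
    YieldU M w A B i h ↔
      if i + 1 ≠ h then B h ∨ A h ∧ YieldU M w A B i j else YieldU M w A B i j := by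
  have hgap : ∀ x, YieldEnd M w i x → h < x → j ≤ x := fun x hx hlt =>
    o.right_gap ha.1 hr (yieldEnd_iff.1 hx).2.1.1 hlt
  have hkj := ha.1.lt
  have hhk := o.le
  have hjn := ha.2
  have hh : YieldEnd M w i h ↔ i + 1 ≠ h := by
    rw [yieldEnd_iff]
    exact ⟨fun h => h.2.2, fun h' => ⟨o.2.1, ⟨o.1, by omega⟩, h'⟩⟩
  have hlift : (YieldEnd M w i h → A h) → YieldU M w A B i j → YieldU M w A B i h := by
    rintro hA ⟨x, h1, h2, h3, h4⟩
    refine ⟨x, by omega, h2, h3, fun y hy hyx hE => ?_⟩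
    rcases Nat.lt_or_eq_of_le hy with hy | rfl
    · exact h4 y (hgap y hE hy) hyx hE
    · exact hA hE
  split_ifs with hne
  · constructor
    · rintro ⟨x, h1, h2, h3, h4⟩
      rcases Nat.lt_or_eq_of_le h1 with h1 | rfl
      · have := hgap x h2 h1
        exact .inr ⟨h4 h le_rfl h1 (hh.2 hne), x, this, h2, h3, fun y hy => h4 y (by omega)⟩
      · exact .inl h3
    · rintro (h1 | ⟨h1, h2⟩)
      · exact ⟨h, le_rfl, hh.2 hne, h1, fun x _ _ => by omega⟩
      · exact hlift (fun _ => h1) h2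
  · constructor
    · rintro ⟨x, h1, h2, h3, h4⟩
      rcases Nat.lt_or_eq_of_le h1 with h1 | rfl
      · exact ⟨x, hgap x h2 h1, h2, h3, fun y hy => h4 y (by omega)⟩
      · exact absurd (hh.1 h2) hne
    · exact hlift fun h => absurd (hh.1 h) hne

/-- At the farthest neighbour the forward scan is exhausted: this is the boundary value of the
recurrence. -/
theorem not_yieldU (ha : Act M w i j) (hr : rel M w i j ≠ some Prec.lt) : ¬ YieldU M w A B i j := by
  rintro ⟨k, h1, h2, -⟩
  obtain ⟨h3, h4, -⟩ := yieldEnd_iff.1 h2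
  have := ha.1.right_le hr h4.1
  obtain rfl : k = j := by omega
  exact hr h3

theorem YieldS.step (o : Open M w i h k) (ha : Act M w k j) (hr : rel M w k j = some Prec.gt) :
    YieldS M w A B i j ↔
      if i + 1 ≠ h then B h ∨ A h ∧ YieldS M w A B i h else YieldS M w A B i h := by
  have hgap : ∀ x, YieldEnd M w i x → x < j → x ≤ h := fun x hx hlt => by
    by_contra h1
    have := o.right_gap ha.1 hr (yieldEnd_iff.1 hx).2.1.1 (by omega)
    omega
  have hkj := ha.1.lt
  have hhk := o.le
  have hjn := ha.2
  have hh : YieldEnd M w i h ↔ i + 1 ≠ h := by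
    rw [yieldEnd_iff]
    exact ⟨fun h => h.2.2, fun h' => ⟨o.2.1, ⟨o.1, by omega⟩, h'⟩⟩
  have hlift : (YieldEnd M w i h → A h) → YieldS M w A B i h → YieldS M w A B i j := by
    rintro hA ⟨x, h1, h2, h3, h4⟩
    refine ⟨x, by omega, h2, h3, fun y hy hyx hE => ?_⟩
    rcases Nat.lt_or_eq_of_le (hgap y hE hyx) with hy' | rfl
    · exact h4 y hy hy' hE
    · exact hA hE
  split_ifs with hne
  · constructor
    · rintro ⟨x, h1, h2, h3, h4⟩
      rcases Nat.lt_or_eq_of_le (hgap x h2 h1) with h5 | rfl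
      · exact .inr ⟨h4 h h5 (by omega) (hh.2 hne), x, h5, h2, h3, fun y hy h => h4 y hy (by omega)⟩
      · exact .inl h3
    · rintro (h1 | ⟨h1, h2⟩)
      · refine ⟨h, by omega, hh.2 hne, h1, fun x hx hxj hE => ?_⟩
        have := hgap x hE hxj
        omega
      · exact hlift (fun _ => h1) h2
  · constructor
    · rintro ⟨x, h1, h2, h3, h4⟩
      rcases Nat.lt_or_eq_of_le (hgap x h2 h1) with h5 | rfl
      · exact ⟨x, h5, h2, h3, fun y hy h => h4 y hy (by omega)⟩
      · exact absurd (hh.1 h2) hne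
    · exact hlift fun h => absurd (hh.1 h) hne

theorem not_yieldS : ¬ YieldS M w A B i (i + 1) := by
  rintro ⟨k, h1, h2, -⟩
  have := h2.lt
  omega

/-- At the farthest neighbour the scan to the left has seen every yield-precedence position of `i`,
so the accumulated value is the value of the operator. -/
theorem yieldS_full (ha : Act M w i j) (hr : rel M w i j ≠ some Prec.lt) :
    YieldS M w A B i (w.length + 2) ↔ YieldS M w A B i j := by
  have hlt : ∀ x, YieldEnd M w i x → x < j := by
    intro x hx
    obtain ⟨h1, h2, -⟩ := yieldEnd_iff.1 hx
    refine lt_of_le_of_ne (ha.1.right_le hr h2.1) ?_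
    rintro rfl
    exact hr h1
  constructor
  · rintro ⟨k, h1, h2, h3, h4⟩
    exact ⟨k, hlt k h2, h2, h3, fun x h5 h6 h7 => h4 x h5 (Nat.lt_succ_of_le h7.le) h7⟩
  · rintro ⟨k, h1, h2, h3, h4⟩
    exact ⟨k, Nat.lt_succ_of_le h2.le, h2, h3, fun x h5 h6 h7 => h4 x h5 (hlt x h7) h7⟩

theorem takeStart_iff_ne (ha : Act M w k j) (hr : rel M w k j = some Prec.gt) :
    TakeStart M w j k ↔ k + 1 ≠ j := by
  rw [takeStart_iff]
  exact ⟨fun h => h.2.2, fun h' => ⟨hr, ha, h'⟩⟩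

/-- By `Open.left_gap` the first neighbour of `j` after `i` is `k`. If `k + 1 = j`, no chain ending
in `j` starts after `i`, so the scan is empty; otherwise it examines `k` and goes on after `k`. -/
theorem TakeU.step (o : Open M w i h k) (ha : Act M w k j) (hr : rel M w k j = some Prec.gt) :
    TakeU M w A B i j ↔ k + 1 ≠ j ∧ (B k ∨ A k ∧ TakeU M w A B k j) := by
  have hgap : ∀ x, TakeStart M w j x → i < x → k ≤ x := fun x hx hlt => by
    by_contra h1
    have := o.left_gap ha.1 hr (takeStart_iff.1 hx).2.1.1 (by omega)
    omega
  have hkj := ha.1.lt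
  have hhk := o.le
  have hik := o.lt
  have hk := takeStart_iff_ne ha hr
  constructor
  · rintro ⟨x, h1, h2, h3, h4⟩
    have h5 := hgap x h2 h1
    have hne : k + 1 ≠ j := by
      rintro rfl
      have := h2.lt
      obtain rfl : x = k := by omega
      exact hk.1 h2 rfl
    refine ⟨hne, ?_⟩
    rcases Nat.lt_or_eq_of_le h5 with h5 | rfl
    · exact .inr ⟨h4 k (by omega) h5 (hk.2 hne), x, h5, h2, h3, fun y hy => h4 y (by omega)⟩
    · exact .inl h3
  · rintro ⟨hne, h1 | ⟨h1, x, h2, h3, h4, h5⟩⟩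
    · refine ⟨k, by omega, hk.2 hne, h1, fun x hx hxk hE => ?_⟩
      have := hgap x hE hx
      omega
    · refine ⟨x, by omega, h3, h4, fun y hy hyx hE => ?_⟩
      rcases Nat.lt_or_eq_of_le (hgap y hE hy) with h6 | rfl
      · exact h5 y h6 hyx hE
      · exact h1

theorem not_takeU (hj : j = i + 1) : ¬ TakeU M w A B i j := by
  rintro ⟨k, h1, h2, -⟩
  have := h2.lt
  omega

theorem takeU_full (ha : Act M w i j) (hr : rel M w i j ≠ some Prec.gt) :
    (∃ k, TakeStart M w j k ∧ B k ∧ ∀ x, x < k → TakeStart M w j x → A x) ↔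
      TakeU M w A B i j := by
  have hlt : ∀ x, TakeStart M w j x → i < x := by
    intro x hx
    obtain ⟨h1, h2, -⟩ := takeStart_iff.1 hx
    refine lt_of_le_of_ne (ha.1.le_left hr h2.1) ?_
    rintro rfl
    exact hr h1
  constructor
  · rintro ⟨k, h2, h3, h4⟩
    exact ⟨k, hlt k h2, h2, h3, fun x _ => h4 x⟩
  · rintro ⟨k, h1, h2, h3, h4⟩
    exact ⟨k, h2, h3, fun x h5 h6 => h4 x (hlt x h6) h5 h6⟩

/-- The scan towards the left jumps from `k` to `i`, since no neighbour of `j` lies between them.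
Its value at `(k, j)` is therefore computed from the pair reached by the pop, opposite to
`TakeU.step`. -/
theorem TakeS.step (o : Open M w i h k) (ha : Act M w k j) (hr : rel M w k j = some Prec.gt) :
    TakeS M w A B k j ↔ if k + 1 ≠ j then B k ∨ A k ∧ TakeS M w A B i j else TakeS M w A B i j := by
  have hgap : ∀ x, TakeStart M w j x → x < k → x ≤ i := fun x hx hlt =>
    o.left_gap ha.1 hr (takeStart_iff.1 hx).2.1.1 hlt
  have hhk := o.le
  have hik := o.lt
  have hk := takeStart_iff_ne ha hr
  have hlift : (TakeStart M w j k → A k) → TakeS M w A B i j → TakeS M w A B k j := by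
    rintro hA ⟨x, h1, h2, h3, h4⟩
    refine ⟨x, by omega, h2, h3, fun y hy hyx hE => ?_⟩
    rcases Nat.lt_or_eq_of_le hyx with hy' | rfl
    · exact h4 y hy (hgap y hE hy') hE
    · exact hA hE
  split_ifs with hne
  · constructor
    · rintro ⟨x, h1, h2, h3, h4⟩
      rcases Nat.lt_or_eq_of_le h1 with h5 | rfl
      · exact .inr ⟨h4 k h5 le_rfl (hk.2 hne), x, hgap x h2 h5, h2, h3,
          fun y hy h => h4 y hy (by omega)⟩
      · exact .inl h3
    · rintro (h1 | ⟨h1, h2⟩)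
      · exact ⟨k, le_rfl, hk.2 hne, h1, fun x hx hxj => by omega⟩
      · exact hlift (fun _ => h1) h2
  · constructor
    · rintro ⟨x, h1, h2, h3, h4⟩
      rcases Nat.lt_or_eq_of_le h1 with h5 | rfl
      · exact ⟨x, hgap x h2 h5, h2, h3, fun y hy h => h4 y hy (by omega)⟩
      · exact absurd (hk.1 h2) hne
    · exact hlift fun h => absurd (hk.1 h) hne

theorem not_takeS (ha : Act M w i j) (hr : rel M w i j ≠ some Prec.gt) : ¬ TakeS M w A B i j := by
  rintro ⟨k, h1, h2, -⟩
  obtain ⟨h3, h4, -⟩ := takeStart_iff.1 h2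
  have := ha.1.le_left hr h4.1
  obtain rfl : k = i := by omega
  exact hr h3

end Hierarchical

section Recurrences

variable {L : Type*} {M : OPM L} {w : List L} {A B : ℕ → Prop} {i j : ℕ}

/-! ## Linear and summary operators -/

theorem until_iff (hi : i ≤ w.length + 1) :
    untilOn (fun m p => ∃ j, LinearPath w i j m p) A B ↔
      B i ∨ A i ∧ i + 1 ≤ w.length + 1 ∧
        untilOn (fun m p => ∃ j, LinearPath w (i + 1) j m p) A B := by
  constructor
  · rintro ⟨m, p, ⟨j, hp, h0, hm, hs⟩, hA, hB⟩
    cases m with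
    | zero => exact .inl (h0 ▸ hB)
    | succ m =>
      have h1 : p 1 = i + 1 := by rw [hs 0 (by omega), h0]
      have hmono : ∀ t, t ≤ m → i + 1 ≤ p (t + 1) := by
        intro t
        induction t with
        | zero => intro _; exact h1.ge
        | succ t ih => intro ht; have := hp.1 (t + 1) (by omega); have := ih (by omega); omega
      have := hmono m le_rfl
      have := hp.2
      refine .inr ⟨h0 ▸ hA 0 (by omega), by omega, m, fun t => p (t + 1),
        ⟨j, ⟨fun k hk => hp.1 _ (by omega), hp.2⟩, h1, hm, fun k hk => hs _ (by omega)⟩,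
        fun k hk => hA _ (by omega), hB⟩
  · rintro (hB | ⟨hA, hi', m, p, ⟨j, hp, h0, hm, hs⟩, hA', hB⟩)
    · exact ⟨0, fun _ => i, ⟨i, ⟨by omega, hi⟩, rfl, rfl, by omega⟩, by omega, hB⟩
    · refine ⟨m + 1, fun t => t.casesOn i p, ⟨j, ⟨?_, hp.2⟩, rfl, hm, ?_⟩, ?_, hB⟩
      · rintro (_ | k) hk
        · show i < p 0
          omega
        · exact hp.1 k (by omega)
      · rintro (_ | k) hk
        · exact h0
        · exact hs k (by omega)
      · rintro (_ | k) hk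
        · exact hA
        · exact hA' k (by omega)

theorem since_iff (hi : i ≤ w.length + 1) :
    sinceOn (fun m p => ∃ j, LinearPath w j i m p) A B ↔
      B i ∨ A i ∧ 1 ≤ i ∧ sinceOn (fun m p => ∃ j, LinearPath w j (i - 1) m p) A B := by
  constructor
  · rintro ⟨m, p, ⟨j, hp, h0, hm, hs⟩, hB, hA⟩
    cases m with
    | zero => exact .inl (hm ▸ hB)
    | succ m =>
      have h1 := hs m (by omega)
      refine .inr ⟨hm ▸ hA (m + 1) (by omega) le_rfl, by omega, m, p,
        ⟨j, ⟨fun k hk => hp.1 _ (by omega), by omega⟩, h0, by omega, fun k hk => hs _ (by omega)⟩,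
        hB, fun k h1 hk => hA _ h1 (by omega)⟩
  · rintro (hB | ⟨hA, hi', m, p, ⟨j, hp, h0, hm, hs⟩, hB, hA'⟩)
    · exact ⟨0, fun _ => i, ⟨i, ⟨by omega, hi⟩, rfl, rfl, by omega⟩, hB, by omega⟩
    · refine ⟨m + 1, fun t => if t ≤ m then p t else i,
        ⟨j, ⟨?_, by simpa using hi⟩, by simpa using h0, by simp, ?_⟩, by simpa using hB, ?_⟩
      · intro k hk
        rcases Nat.lt_succ_iff_lt_or_eq.1 hk with h | rfl
        · simpa [h.le, Nat.succ_le_iff.2 h] using hp.1 k h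
        · simp [hm]; omega
      · intro k hk
        rcases Nat.lt_succ_iff_lt_or_eq.1 hk with h | rfl
        · simpa [h.le, Nat.succ_le_iff.2 h] using hs k h
        · simp [hm]; omega
      · intro k h1 hk
        by_cases h : k ≤ m
        · simpa [h] using hA' k h1 h
        · simpa [h] using hA

/-- Which step a summary path takes depends on its target, but the expansion does not mention the
target. The point is that a linear step taken where the chain jump was compulsory does no harm:
chains do not cross, so the remaining path passes through the end of that chain, and the part before
it can be replaced by the jump. -/
theorem sumUntil_iff {O : Set Prec} (hi : i ≤ w.length + 1) :
    untilOn (fun m p => ∃ j, FwdSummaryPath M w O i j m p) A B ↔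
      B i ∨ A i ∧ ((∃ h, chiFwd M w i h ∧
          untilOn (fun m p => ∃ j, FwdSummaryPath M w O h j m p) A B) ∨
        (i + 1 ≤ w.length + 1 ∧ untilOn (fun m p => ∃ j, FwdSummaryPath M w O (i + 1) j m p) A B) ∧
          ∃ r ∈ O, rel M w i (i + 1) = some r) := by
  have cons : ∀ i' m p j, i < i' → FwdSummaryPath M w O i' j m p → (∀ k, k < m → A (p k)) →
      B (p m) → A i → ((chiFwd M w i i' ∧ i' ≤ j) ∨
        ((¬ ∃ h, chiFwd M w i h ∧ h ≤ j) ∧ i' = i + 1 ∧ ∃ r ∈ O, rel M w i i' = some r)) →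
      untilOn (fun m p => ∃ j, FwdSummaryPath M w O i j m p) A B := by
    rintro i' m p j hii ⟨hp, h0, hm, hs⟩ hA' hB hA hstep
    refine ⟨m + 1, fun t => t.casesOn i p, ⟨j, ⟨?_, hp.2⟩, rfl, hm, ?_⟩, ?_, hB⟩
    · rintro (_ | k) hk
      · show i < p 0
        omega
      · exact hp.1 k (by omega)
    · rintro (_ | k) hk
      · subst h0
        exact hstep
      · exact hs k (by omega)
    · rintro (_ | k) hk
      · exact hA
      · exact hA' k (by omega)
  have mono : ∀ {i' j m p}, FwdSummaryPath M w O i' j m p → ∀ k, k ≤ m → i' ≤ p k := by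
    intro i' j m p hp k
    induction k with
    | zero => intro _; exact hp.2.1.ge
    | succ k ih => intro hk; have := hp.1.1 k hk; have := ih (by omega); omega
  constructor
  · rintro ⟨m, p, ⟨j, hp, h0, hm, hs⟩, hA, hB⟩
    cases m with
    | zero => exact .inl (h0 ▸ hB)
    | succ m =>
      have hrest : FwdSummaryPath M w O (p 1) j m fun t => p (t + 1) :=
        ⟨⟨fun k hk => hp.1 _ (by omega), hp.2⟩, rfl, hm, fun k hk => hs _ (by omega)⟩
      have huntil : untilOn (fun m p' => ∃ j, FwdSummaryPath M w O (p 1) j m p') A B :=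
        ⟨m, _, ⟨j, hrest⟩, fun k hk => hA _ (by omega), hB⟩
      refine .inr ⟨h0 ▸ hA 0 (by omega), ?_⟩
      have hs0 := hs 0 (by omega)
      simp only [h0, zero_add] at hs0
      rcases hs0 with ⟨h1, -⟩ | ⟨-, h1, h2⟩
      · exact .inl ⟨p 1, h1, huntil⟩
      · have := mono hrest m le_rfl
        have := hp.2
        rw [h1] at huntil h2
        exact .inr ⟨⟨by omega, huntil⟩, h2⟩
  · rintro (hB | ⟨hA, ⟨h, hh, m, p, ⟨j, hp⟩, hA', hB⟩ | ⟨⟨hi', m, p, ⟨j, hp⟩, hA', hB⟩, hO⟩⟩)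
    · exact ⟨0, fun _ => i, ⟨i, ⟨by omega, hi⟩, rfl, rfl, by omega⟩, by omega, hB⟩
    · have h1 := mono hp m le_rfl
      have h2 := (chi_iff.1 hh.1).1.1.lt
      exact cons h m p j h2 hp hA' hB hA (.inl ⟨hh, by rw [← hp.2.2.1]; exact h1⟩)
    · by_cases hex : ∃ h, chiFwd M w i h ∧ h ≤ j
      · obtain ⟨h, hh, hhj⟩ := hex
        have hih := chi_iff.1 hh.1
        -- A path starting below `h` inside the chain cannot jump over `h`: its jumps are chains
        -- starting strictly inside `(i, h)`.
        have hcross : ∃ t, t ≤ m ∧ p t = h := by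
          have hlt := hih.1.1.lt
          have : ∀ t, t ≤ m → (∃ s, s ≤ t ∧ p s = h) ∨ p t < h := by
            intro t
            induction t with
            | zero =>
              intro _
              rw [hp.2.1]
              right
              omega
            | succ t ih =>
              intro ht
              rcases ih (by omega) with ⟨s, h1, h2⟩ | h1
              · exact .inl ⟨s, by omega, h2⟩
              · have h3 : p (t + 1) ≤ h := by
                  rcases hp.2.2.2 t ht with ⟨h4, -⟩ | ⟨-, h4, -⟩
                  · have := mono hp t (by omega)
                    exact hih.1.1.noncrossing (chi_iff.1 h4.1).1.1 (by omega) h1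
                  · omega
                rcases Nat.lt_or_eq_of_le h3 with h3 | h3
                · exact .inr h3
                · exact .inl ⟨t + 1, le_rfl, h3⟩
          rcases this m le_rfl with h1 | h1
          · exact h1
          · rw [hp.2.2.1] at h1
            omega
        obtain ⟨t, ht, hpt⟩ := hcross
        -- The detour up to `h` is discarded and replaced by the jump.
        refine cons h (m - t) (fun s => p (t + s)) j hih.1.1.lt
          ⟨⟨fun k hk => hp.1.1 (t + k) (by omega), ?_⟩, hpt, ?_,
            fun k hk => hp.2.2.2 (t + k) (by omega)⟩ (fun k hk => hA' (t + k) (by omega)) ?_ hA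
          (.inl ⟨hh, hhj⟩)
        · show p (t + (m - t)) ≤ _
          rw [Nat.add_sub_cancel' ht]; exact hp.1.2
        · show p (t + (m - t)) = _
          rw [Nat.add_sub_cancel' ht]; exact hp.2.2.1
        · rw [Nat.add_sub_cancel' ht]; exact hB
      · exact cons (i + 1) m p j (by omega) hp hA' hB hA (.inr ⟨hex, rfl, hO⟩)

/-- The mirror image of `sumUntil_iff`: a backward path starting inside the maximal chain that ends
in `i` and reaching its start `h` or beyond must pass through `h`. -/
theorem sumSince_iff {O : Set Prec} (hi : i ≤ w.length + 1) :
    sinceOn (fun m p => ∃ j, BwdSummaryPath M w O j i m p) A B ↔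
      B i ∨ A i ∧ ((∃ h, chiBwd M w h i ∧
          sinceOn (fun m p => ∃ j, BwdSummaryPath M w O j h m p) A B) ∨
        (1 ≤ i ∧ sinceOn (fun m p => ∃ j, BwdSummaryPath M w O j (i - 1) m p) A B) ∧
          ∃ r ∈ O, rel M w (i - 1) i = some r) := by
  have snoc : ∀ i' m p j, i' < i → BwdSummaryPath M w O j i' m p → B (p 0) →
      (∀ k, 1 ≤ k → k ≤ m → A (p k)) → A i → ((chiBwd M w i' i ∧ j ≤ i') ∨
        ((¬ ∃ h, chiBwd M w h i ∧ j ≤ h) ∧ i = i' + 1 ∧ ∃ r ∈ O, rel M w i' i = some r)) →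
      sinceOn (fun m p => ∃ j, BwdSummaryPath M w O j i m p) A B := by
    rintro i' m p j hii ⟨hp, h0, hm, hs⟩ hB hA' hA hstep
    refine ⟨m + 1, fun t => if t ≤ m then p t else i,
      ⟨j, ⟨?_, by simpa using hi⟩, by simpa using h0, by simp, ?_⟩, by simpa using hB, ?_⟩
    · intro k hk
      rcases Nat.lt_succ_iff_lt_or_eq.1 hk with h | rfl
      · simpa [h.le, Nat.succ_le_iff.2 h] using hp.1 k h
      · simpa [hm] using hii
    · intro k hk
      rcases Nat.lt_succ_iff_lt_or_eq.1 hk with h | rfl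
      · simpa [h.le, Nat.succ_le_iff.2 h] using hs k h
      · simpa [hm] using hstep
    · intro k h1 hk
      by_cases h : k ≤ m
      · simpa [h] using hA' k h1 h
      · simpa [h] using hA
  have mono : ∀ {i' j m p}, BwdSummaryPath M w O j i' m p → ∀ k, k ≤ m → p (m - k) ≤ i' := by
    intro i' j m p hp k
    induction k with
    | zero => intro _; exact hp.2.2.1.le
    | succ k ih =>
      intro hk
      have h1 := hp.1.1 (m - (k + 1)) (by omega)
      rw [show m - (k + 1) + 1 = m - k by omega] at h1
      have := ih (by omega)
      omega
  constructor
  · rintro ⟨m, p, ⟨j, hp, h0, hm, hs⟩, hB, hA⟩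
    cases m with
    | zero => exact .inl (hm ▸ hB)
    | succ m =>
      have hlt := hp.1 m (by omega)
      have hrest : BwdSummaryPath M w O j (p m) m p :=
        ⟨⟨fun k hk => hp.1 _ (by omega), by omega⟩, h0, rfl, fun k hk => hs _ (by omega)⟩
      have hsince : sinceOn (fun m' p' => ∃ j, BwdSummaryPath M w O j (p m) m' p') A B :=
        ⟨m, _, ⟨j, hrest⟩, hB, fun k h1 hk => hA _ h1 (by omega)⟩
      refine .inr ⟨hm ▸ hA (m + 1) (by omega) le_rfl, ?_⟩
      have hs0 := hs m (by omega)
      rw [hm] at hs0 hlt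
      rcases hs0 with ⟨h1, -⟩ | ⟨-, h1, h2⟩
      · exact .inl ⟨p m, h1, hsince⟩
      · rw [show p m = i - 1 by omega] at hsince h2
        exact .inr ⟨⟨by omega, hsince⟩, h2⟩
  · rintro (hB | ⟨hA, ⟨h, hh, m, p, ⟨j, hp⟩, hB, hA'⟩ | ⟨⟨hi', m, p, ⟨j, hp⟩, hB, hA'⟩, hO⟩⟩)
    · exact ⟨0, fun _ => i, ⟨i, ⟨by omega, hi⟩, rfl, rfl, by omega⟩, hB, by omega⟩
    · have h1 := mono hp m le_rfl
      rw [Nat.sub_self, hp.2.1] at h1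
      have h2 := (chi_iff.1 hh.1).1.1.lt
      exact snoc h m p j h2 hp hB hA' hA (.inl ⟨hh, h1⟩)
    · by_cases hex : ∃ h, chiBwd M w h i ∧ j ≤ h
      · obtain ⟨h, hh, hhj⟩ := hex
        have hih := chi_iff.1 hh.1
        have hcross : ∃ t, t ≤ m ∧ p t = h := by
          have hlt := hih.1.1.lt
          have : ∀ t, t ≤ m → (∃ s, s ≤ m ∧ p s = h) ∨ h < p (m - t) := by
            intro t
            induction t with
            | zero =>
              intro _
              rw [Nat.sub_zero, hp.2.2.1]
              right
              omega
            | succ t ih =>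
              intro ht
              rcases ih (by omega) with h1 | h1
              · exact .inl h1
              · have hlt' := hp.1.1 (m - (t + 1)) (by omega)
                have hst := hp.2.2.2 (m - (t + 1)) (by omega)
                have hmt := mono hp t (by omega)
                rw [show m - (t + 1) + 1 = m - t by omega] at hst hlt'
                have h3 : h ≤ p (m - (t + 1)) := by
                  rcases hst with ⟨h4, -⟩ | ⟨-, h4, -⟩
                  · by_contra h5
                    have := (chi_iff.1 h4.1).1.1.noncrossing hih.1.1 (by omega) h1
                    omega
                  · omega
                rcases Nat.lt_or_eq_of_le h3 with h3 | h3
                · exact .inr h3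
                · exact .inl ⟨m - (t + 1), by omega, h3.symm⟩
          rcases this m le_rfl with h1 | h1
          · exact h1
          · rw [Nat.sub_self, hp.2.1] at h1
            omega
        obtain ⟨t, ht, hpt⟩ := hcross
        have := hih.1.1.lt
        exact snoc h t p j hih.1.1.lt
          ⟨⟨fun k hk => hp.1.1 k (by omega), by omega⟩, hp.2.1, hpt,
            fun k hk => hp.2.2.2 k (by omega)⟩ hB (fun k h1 hk => hA' k h1 (by omega)) hA
          (.inl ⟨hh, hhj⟩)
      · exact snoc (i - 1) m p j (by omega) hp hB hA' hA (.inr ⟨hex, by omega, hO⟩)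

end Recurrences

section Closure

variable {AP : Type*}

/-! ## The size of the closure -/

/-- The formulas that the main operator of a formula contributes to the closure. -/
def Formula.node : Formula AP → List (XFormula AP)
  | chainNext ψ => [.chainNext ψ.toX, .aux .pend (.chainNext ψ.toX), .aux .fin (.chainNext ψ.toX)]
  | chainBack ψ => [.chainBack ψ.toX, .aux .pend (.chainBack ψ.toX), .aux .fin (.chainBack ψ.toX)]
  | Formula.until ψ θ => [(Formula.until ψ θ).toX, .next (Formula.until ψ θ).toX]
  | since ψ θ => [(since ψ θ).toX, .back (since ψ θ).toX]
  | sumUntil O ψ θ => [(sumUntil O ψ θ).toX, .next (sumUntil O ψ θ).toX,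
      .chainNext (sumUntil O ψ θ).toX, .aux .pend (.chainNext (sumUntil O ψ θ).toX),
      .aux .fin (.chainNext (sumUntil O ψ θ).toX)]
  | sumSince O ψ θ => [(sumSince O ψ θ).toX, .back (sumSince O ψ θ).toX,
      .chainBack (sumSince O ψ θ).toX, .aux .pend (.chainBack (sumSince O ψ θ).toX),
      .aux .fin (.chainBack (sumSince O ψ θ).toX)]
  | yieldUntil ψ θ => [(yieldUntil ψ θ).toX, .aux .pend (yieldUntil ψ θ).toX,
      .next (.aux .pend (yieldUntil ψ θ).toX), .aux .fin (yieldUntil ψ θ).toX]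
  | yieldSince ψ θ => [(yieldSince ψ θ).toX, .aux .pend (yieldSince ψ θ).toX,
      .next (.aux .pend (yieldSince ψ θ).toX), .aux .fin (yieldSince ψ θ).toX,
      .aux .acc (yieldSince ψ θ).toX]
  | takeUntil ψ θ => [(takeUntil ψ θ).toX, .aux .pend (takeUntil ψ θ).toX,
      .aux .fin (takeUntil ψ θ).toX, .chainBack ψ.toX, .aux .pend (.chainBack ψ.toX),
      .aux .fin (.chainBack ψ.toX), .chainBack θ.toX, .aux .pend (.chainBack θ.toX),
      .aux .fin (.chainBack θ.toX)]
  | takeSince ψ θ => [(takeSince ψ θ).toX, .aux .pend (takeSince ψ θ).toX,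
      .aux .fin (takeSince ψ θ).toX, .chainBack ψ.toX, .aux .pend (.chainBack ψ.toX),
      .aux .fin (.chainBack ψ.toX), .chainBack θ.toX, .aux .pend (.chainBack θ.toX),
      .aux .fin (.chainBack θ.toX)]
  | f => [f.toX]

/-- The formulas that all the operators of a formula contribute to the closure. -/
def Formula.clo : Formula AP → List (XFormula AP)
  | prop p => (prop p).node
  | neg ψ => (neg ψ).node ++ ψ.clo
  | next ψ => (next ψ).node ++ ψ.clo
  | back ψ => (back ψ).node ++ ψ.clo
  | chainNext ψ => (chainNext ψ).node ++ ψ.clo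
  | chainBack ψ => (chainBack ψ).node ++ ψ.clo
  | and ψ θ => (and ψ θ).node ++ (ψ.clo ++ θ.clo)
  | Formula.until ψ θ => (Formula.until ψ θ).node ++ (ψ.clo ++ θ.clo)
  | since ψ θ => (since ψ θ).node ++ (ψ.clo ++ θ.clo)
  | sumUntil O ψ θ => (sumUntil O ψ θ).node ++ (ψ.clo ++ θ.clo)
  | sumSince O ψ θ => (sumSince O ψ θ).node ++ (ψ.clo ++ θ.clo)
  | yieldUntil ψ θ => (yieldUntil ψ θ).node ++ (ψ.clo ++ θ.clo)
  | yieldSince ψ θ => (yieldSince ψ θ).node ++ (ψ.clo ++ θ.clo)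
  | takeUntil ψ θ => (takeUntil ψ θ).node ++ (ψ.clo ++ θ.clo)
  | takeSince ψ θ => (takeSince ψ θ).node ++ (ψ.clo ++ θ.clo)

/-- The largest contribution of one operator is nine, attained by the take-precedence operators:
three symbols of their own and, for each of the two operands, its matching back with two auxiliary
symbols. -/
theorem Formula.length_clo_le (f : Formula AP) : f.clo.length ≤ 9 * f.length := by
  induction f <;>
    simp only [clo, node, Formula.length, List.length_append, List.length_cons,
      List.length_nil] <;> omega

theorem Formula.toX_mem_clo (f : Formula AP) : f.toX ∈ f.clo := by
  cases f <;> simp [clo, node, toX]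

/-- Each `node` contains the whole chain of formulas generated by its operator down to its operands,
and these head the lists of the subformulas. So nothing new is generated across operators, and the
closure stays linear. -/
theorem Formula.mem_clo_of_requires (f : Formula AP) :
    ∀ {η ψ : XFormula AP}, η ∈ f.clo → Requires η ψ → ψ ∈ f.clo := by
  induction f with
  | prop p =>
    intro η ψ hη hr
    simp only [clo, node, toX, List.mem_cons, List.not_mem_nil, or_false] at hη
    subst hη
    cases hr
  | neg ψ ih | next ψ ih | back ψ ih | chainNext ψ ih | chainBack ψ ih =>
    intro η χ hη hr
    have h1 := ψ.toX_mem_clo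
    simp only [clo, List.mem_append] at hη ⊢
    rcases hη with hη | hη
    · simp only [node, toX, List.mem_cons, List.not_mem_nil, or_false] at hη
      rcases hη with rfl | rfl | rfl <;> cases hr <;> simp [node, toX, h1]
    · exact .inr (ih hη hr)
  | sumUntil O ψ θ ih ih' | sumSince O ψ θ ih ih' | _ ψ θ ih ih' =>
    intro η χ hη hr
    have h1 := ψ.toX_mem_clo
    have h2 := θ.toX_mem_clo
    simp only [clo, List.mem_append] at hη ⊢
    rcases hη with hη | hη | hη
    · simp only [node, toX, List.mem_cons, List.not_mem_nil, or_false] at hη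
      rcases hη with rfl | rfl | rfl | rfl | rfl | rfl | rfl | rfl | rfl <;> cases hr <;>
        simp [node, toX, h1, h2]
    · exact .inr (.inl (ih hη hr))
    · exact .inr (.inr (ih' hη hr))

/-- The elements of the closure other than the added negations. -/
def Formula.core (φ : Formula AP) : Set (XFormula AP) :=
  {χ | χ ∈ φ.clo} ∪ Set.range XFormula.prop

/-- Negations are added once only and require nothing but the formula they negate, so they at most
double the set. -/
theorem closure_subset (φ : Formula AP) : closure φ ⊆ φ.core ∪ XFormula.neg '' φ.core := by
  intro χ hχ
  induction hχ with
  | self => exact .inl (.inl φ.toX_mem_clo)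
  | prop p => exact .inl (.inr ⟨p, rfl⟩)
  | neg ψ _ hne ih =>
    rcases ih with h | ⟨θ, _, rfl⟩
    · exact .inr ⟨ψ, h, rfl⟩
    · exact absurd rfl (hne θ)
  | requires η ψ _ hr ih =>
    rcases ih with (h | ⟨p, rfl⟩) | ⟨θ, h, rfl⟩
    · exact .inl (.inl (φ.mem_clo_of_requires h hr))
    · cases hr
    · cases hr
      exact .inl h

theorem core_finite [Finite AP] (φ : Formula AP) : φ.core.Finite :=
  φ.clo.finite_toSet.union (Set.finite_range _)

theorem ncard_core_le [Fintype AP] (φ : Formula AP) :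
    φ.core.ncard ≤ 9 * φ.length + (Fintype.card AP + 1) := by
  classical
  refine (Set.ncard_union_le _ _).trans (Nat.add_le_add ?_ ?_)
  · rw [show {χ | χ ∈ φ.clo} = (φ.clo.toFinset : Set (XFormula AP)) by ext; simp,
      Set.ncard_coe_finset]
    exact (List.toFinset_card_le _).trans φ.length_clo_le
  · rw [← Set.image_univ]
    refine (Set.ncard_image_le Set.finite_univ).trans ?_
    simp [Set.ncard_univ, Nat.card_eq_fintype_card]

theorem closure_finite [Finite AP] (φ : Formula AP) : (closure φ).Finite :=
  ((core_finite φ).union ((core_finite φ).image _)).subset (closure_subset φ)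

theorem Formula.one_le_length (f : Formula AP) : 1 ≤ f.length := by
  cases f <;> simp [Formula.length]

/-- The count is at most twice `9 * φ.length + card AP + 1`; the additive constant is absorbed
because a formula has length at least one. -/
theorem ncard_closure_le [Fintype AP] (φ : Formula AP) :
    (closure φ).ncard ≤ 20 * (φ.length + Fintype.card AP) := by
  have h1 := Set.ncard_le_ncard (closure_subset φ)
    ((core_finite φ).union ((core_finite φ).image _))
  have h2 := Set.ncard_union_le φ.core (XFormula.neg '' φ.core)
  have h3 := Set.ncard_image_le (f := XFormula.neg) (core_finite φ)
  have h4 := ncard_core_le φ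
  have h5 := φ.one_le_length
  omega

/-! ## The shape of the elements of the closure -/

/-- OPTL formulas, auxiliary variants of OPTL formulas, and their nexts. -/
def Shape (χ : XFormula AP) : Prop :=
  ∃ f : Formula AP, χ = f.toX ∨ (∃ t, χ = .aux t f.toX) ∨ χ = .next (.aux .pend f.toX)

theorem Formula.shape_of_mem_clo (f : Formula AP) : ∀ {χ : XFormula AP}, χ ∈ f.clo → Shape χ := by
  have hX : ∀ f : Formula AP, Shape f.toX := fun f => ⟨f, .inl rfl⟩
  have hA : ∀ (f : Formula AP) t, Shape (.aux t f.toX) := fun f t => ⟨f, .inr (.inl ⟨t, rfl⟩)⟩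
  have hN : ∀ f : Formula AP, Shape (.next (.aux .pend f.toX)) := fun f => ⟨f, .inr (.inr rfl)⟩
  have h1 : ∀ f : Formula AP, Shape (.next f.toX) := fun f => hX (.next f)
  have h2 : ∀ f : Formula AP, Shape (.back f.toX) := fun f => hX (.back f)
  have h3 : ∀ f : Formula AP, Shape (.chainNext f.toX) := fun f => hX (.chainNext f)
  have h4 : ∀ f : Formula AP, Shape (.chainBack f.toX) := fun f => hX (.chainBack f)
  have h5 : ∀ (f : Formula AP) t, Shape (.aux t (.chainNext f.toX)) := fun f => hA (.chainNext f)
  have h6 : ∀ (f : Formula AP) t, Shape (.aux t (.chainBack f.toX)) := fun f => hA (.chainBack f)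
  have hnode : ∀ (f : Formula AP), ∀ χ ∈ f.node, Shape χ := by
    intro f χ hχ
    cases f <;> simp only [node, List.mem_cons, List.not_mem_nil, or_false] at hχ <;>
      rcases hχ with rfl | rfl | rfl | rfl | rfl | rfl | rfl | rfl | rfl <;>
      first
        | exact hX _ | exact hA _ _ | exact hN _ | exact h1 _ | exact h2 _ | exact h3 _
        | exact h4 _ | exact h5 _ _ | exact h6 _ _
  induction f with
  | prop p => intro χ hχ; exact hnode _ _ hχ
  | neg ψ ih | next ψ ih | back ψ ih | chainNext ψ ih | chainBack ψ ih =>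
    intro χ hχ
    rcases List.mem_append.1 hχ with h | h
    · exact hnode _ _ h
    · exact ih h
  | sumUntil O ψ θ ih ih' | sumSince O ψ θ ih ih' | _ ψ θ ih ih' =>
    intro χ hχ
    rcases List.mem_append.1 hχ with h | h
    · exact hnode _ _ h
    · exact (List.mem_append.1 h).elim ih ih'

theorem shape_of_mem_closure {φ : Formula AP} {χ : XFormula AP} (h : χ ∈ closure φ)
    (hneg : ∀ ψ, χ ≠ .neg ψ) : Shape χ := by
  rcases closure_subset φ h with (h | ⟨p, rfl⟩) | ⟨ψ, _, rfl⟩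
  · exact φ.shape_of_mem_clo h
  · exact ⟨.prop p, .inl rfl⟩
  · exact absurd rfl (hneg ψ)

/-- Atoms constrain all extended formulas, whereas semantics is available for OPTL formulas only.
This recovers the OPTL formula behind an until or since element, so nested auxiliary symbols need
not be considered. -/
theorem exists_toX {φ : Formula AP} {χ : XFormula AP} (h : χ ∈ closure φ)
    (hneg : ∀ ψ, χ ≠ .neg ψ) (haux : ∀ t ψ, χ ≠ .aux t ψ) (hnext : ∀ ψ, χ ≠ .next ψ) :
    ∃ f : Formula AP, f.toX = χ := by
  obtain ⟨f, rfl | ⟨t, rfl⟩ | rfl⟩ := shape_of_mem_closure h hneg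
  · exact ⟨f, rfl⟩
  · exact absurd rfl (haux _ _)
  · exact absurd rfl (hnext _)

/-! ## Finiteness of the atoms and size of automata over them -/

theorem atom_injective {φ : Formula AP} :
    Function.Injective fun Φ : Atom φ => (⟨Φ.1, Φ.2.subset⟩ : 𝒫 (closure φ)) := by
  intro Φ Θ h
  exact Subtype.ext (Subtype.mk.inj h)

theorem atom_finite [Finite AP] (φ : Formula AP) : Finite (Atom φ) := by
  have := (closure_finite φ).powerset.to_subtype
  exact Finite.of_injective _ atom_injective

theorem card_atom_le [Finite AP] (φ : Formula AP) :
    Nat.card (Atom φ) ≤ 2 ^ (closure φ).ncard := by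
  have := (closure_finite φ).powerset.to_subtype
  refine (Nat.card_le_card_of_injective _ atom_injective).trans ?_
  rw [Nat.card_coe_set_eq, Set.ncard_powerset _ (closure_finite φ)]

theorem ncard_le_natCard {α : Type*} [Finite α] (s : Set α) : s.ncard ≤ Nat.card α := by
  rw [← Set.ncard_univ]
  exact Set.ncard_le_ncard (Set.subset_univ s) Set.finite_univ

/-- With `N = φ.length + card AP` there are at most `2 ^ (20 * N)` atoms, so each transition
relation has at most `2 ^ (60 * N)` elements. Adding the states gives four such terms, and the
factor four is absorbed in the exponent. -/
theorem OPA.size_le [Fintype AP] {M : OPM (Set AP)} {φ : Formula AP} (A : OPA M (Atom φ)) :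
    A.size ≤ 2 ^ (64 * (φ.length + Fintype.card AP)) := by
  have := atom_finite φ
  have hq := card_atom_le φ
  have hc := ncard_closure_le φ
  have hl := φ.one_le_length
  have h1 := ncard_le_natCard A.push
  have h2 := ncard_le_natCard A.shift
  have h3 := ncard_le_natCard A.pop
  have ha : Nat.card (Set AP) = 2 ^ Fintype.card AP := by
    rw [Nat.card_eq_fintype_card, Fintype.card_set]
  simp only [Nat.card_prod, ha] at h1 h2 h3
  set N := φ.length + Fintype.card AP with hN
  have hQ : Nat.card (Atom φ) ≤ 2 ^ (20 * N) := hq.trans (Nat.pow_le_pow_right (by norm_num) hc)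
  have hL : 2 ^ Fintype.card AP ≤ 2 ^ N := Nat.pow_le_pow_right (by norm_num) (by omega)
  have hP : Nat.card (Atom φ) * (2 ^ Fintype.card AP * Nat.card (Atom φ)) ≤ 2 ^ (60 * N) :=
    (Nat.mul_le_mul hQ (Nat.mul_le_mul hL hQ)).trans (by
      rw [← pow_add, ← pow_add]; exact Nat.pow_le_pow_right (by norm_num) (by omega))
  have hR : Nat.card (Atom φ) * (Nat.card (Atom φ) * Nat.card (Atom φ)) ≤ 2 ^ (60 * N) :=
    (Nat.mul_le_mul hQ (Nat.mul_le_mul hQ hQ)).trans (by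
      rw [← pow_add, ← pow_add]; exact Nat.pow_le_pow_right (by norm_num) (by omega))
  have hS : (2 : ℕ) ^ (20 * N) ≤ 2 ^ (60 * N) := Nat.pow_le_pow_right (by norm_num) (by omega)
  have hF : 4 * (2 : ℕ) ^ (60 * N) ≤ 2 ^ (64 * N) := by
    rw [show (4 : ℕ) = 2 ^ 2 by norm_num, ← pow_add]
    exact Nat.pow_le_pow_right (by norm_num) (by omega)
  unfold OPA.size
  omega

end Closure

section Automaton

variable {AP : Type*}

/-! ## The automaton -/

open Classical in
/-- The letter described by the propositions of an atom, `none` if they include `#`. -/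
noncomputable def letterOf (Φ : Set (XFormula AP)) : Option (Set AP) :=
  if .prop none ∈ Φ then none else some {a | .prop (some a) ∈ Φ}

/-- Conditions on the last atom `Φ` of a position and the first atom `Θ` of the next one. -/
structure Enter (M : OPM (Set AP)) (φ : Formula AP) (Φ Θ : Set (XFormula AP)) : Prop where
  next : ∀ ψ : Formula AP, ψ.next.toX ∈ closure φ → (ψ.next.toX ∈ Φ ↔ ψ.toX ∈ Θ)
  back : ∀ ψ : Formula AP, ψ.back.toX ∈ closure φ → (ψ.back.toX ∈ Θ ↔ ψ.toX ∈ Φ)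
  -- The label entered belongs to two consecutive positions, which is not a chain; only pops produce
  -- chains, and they set `fin`.
  fin : ∀ η, .aux .fin η ∉ Θ
  chainNext : ∀ ψ : Formula AP, ψ.chainNext.toX ∈ closure φ →
    (.aux .pend ψ.chainNext.toX ∈ Θ ↔ ψ.chainNext.toX ∈ Φ)
  chainBack : ∀ ψ : Formula AP, ψ.chainBack.toX ∈ closure φ →
    (.aux .pend ψ.chainBack.toX ∈ Θ ↔ ψ.toX ∈ Φ)
  sumUntil : ∀ O (ψ θ : Formula AP), (Formula.sumUntil O ψ θ).toX ∈ closure φ →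
    ((Formula.sumUntil O ψ θ).toX ∈ Φ ↔ θ.toX ∈ Φ ∨ ψ.toX ∈ Φ ∧
      ((Formula.sumUntil O ψ θ).chainNext.toX ∈ Φ ∨ (Formula.sumUntil O ψ θ).next.toX ∈ Φ ∧
        ∃ r ∈ O, M.ext (letterOf Φ) (letterOf Θ) = some r))
  sumSince : ∀ O (ψ θ : Formula AP), (Formula.sumSince O ψ θ).toX ∈ closure φ →
    ((Formula.sumSince O ψ θ).toX ∈ Θ ↔ θ.toX ∈ Θ ∨ ψ.toX ∈ Θ ∧
      ((Formula.sumSince O ψ θ).chainBack.toX ∈ Θ ∨ (Formula.sumSince O ψ θ).back.toX ∈ Θ ∧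
        ∃ r ∈ O, M.ext (letterOf Φ) (letterOf Θ) = some r))
  yieldUntil : ∀ ψ θ : Formula AP, (ψ.yieldUntil θ).toX ∈ closure φ →
    (.aux .pend (ψ.yieldUntil θ).toX ∈ Θ ↔ (ψ.yieldUntil θ).toX ∈ Φ)
  yieldSince : ∀ ψ θ : Formula AP, (ψ.yieldSince θ).toX ∈ closure φ →
    (.aux .pend (ψ.yieldSince θ).toX ∈ Θ ↔ (ψ.yieldSince θ).toX ∈ Φ)
  yieldSince_acc : ∀ ψ θ : Formula AP, .aux .acc (ψ.yieldSince θ).toX ∉ Θ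
  takeUntil : ∀ ψ θ : Formula AP, .aux .pend (ψ.takeUntil θ).toX ∉ Θ
  -- The scan to the left starts at the position just read, so at entry its value is that of the
  -- operator in the new position. It is used up by pops and must be empty at `Leave`.
  takeSince : ∀ ψ θ : Formula AP, (ψ.takeSince θ).toX ∈ closure φ →
    (.aux .pend (ψ.takeSince θ).toX ∈ Θ ↔ (ψ.takeSince θ).toX ∈ Θ)

/-- Conditions on the last atom of a position, before its letter is read. -/
structure Leave (φ : Formula AP) (Φ : Set (XFormula AP)) : Prop where
  chainBack : ∀ ψ : Formula AP, ψ.chainBack.toX ∈ closure φ →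
    (ψ.chainBack.toX ∈ Φ ↔ .aux .fin ψ.chainBack.toX ∈ Φ ∧ .aux .pend ψ.chainBack.toX ∈ Φ)
  takeUntil : ∀ ψ θ : Formula AP, (ψ.takeUntil θ).toX ∈ closure φ →
    ((ψ.takeUntil θ).toX ∈ Φ ↔ .aux .pend (ψ.takeUntil θ).toX ∈ Φ)
  takeSince : ∀ ψ θ : Formula AP, .aux .pend (ψ.takeSince θ).toX ∉ Φ

/-- Conditions on an atom in which the topmost stack symbol is replaced or removed. -/
structure Close (φ : Formula AP) (Φ : Set (XFormula AP)) : Prop where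
  chainNext : ∀ ψ : Formula AP, ψ.chainNext.toX ∈ closure φ →
    (.aux .pend ψ.chainNext.toX ∈ Φ ↔ .aux .fin ψ.chainNext.toX ∈ Φ ∧ ψ.toX ∈ Φ)
  yieldUntil : ∀ ψ θ : Formula AP, .aux .pend (ψ.yieldUntil θ).toX ∉ Φ
  yieldSince : ∀ ψ θ : Formula AP, (ψ.yieldSince θ).toX ∈ closure φ →
    (.aux .pend (ψ.yieldSince θ).toX ∈ Φ ↔ .aux .acc (ψ.yieldSince θ).toX ∈ Φ)

open Classical in
/-- Conditions on the current atom `Φ`, the atom `Θ` on the stack and the atom `Ψ` reached by a pop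
transition. -/
structure Pop (φ : Formula AP) (Φ Θ Ψ : Set (XFormula AP)) : Prop where
  stay : ∀ f : Formula AP, f.toX ∈ Φ ↔ f.toX ∈ Ψ
  fin : ∀ η, .aux .fin η ∈ closure φ → .aux .fin η ∈ Ψ
  chainNext : ∀ ψ : Formula AP, ψ.chainNext.toX ∈ closure φ →
    (.aux .pend ψ.chainNext.toX ∈ Θ ↔ .aux .pend ψ.chainNext.toX ∈ Ψ)
  chainBack : ∀ ψ : Formula AP, ψ.chainBack.toX ∈ closure φ →
    (.aux .pend ψ.chainBack.toX ∈ Θ ↔ .aux .pend ψ.chainBack.toX ∈ Ψ)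
  yieldUntil : ∀ ψ θ : Formula AP, (ψ.yieldUntil θ).toX ∈ closure φ →
    (.aux .pend (ψ.yieldUntil θ).toX ∈ Θ ↔
      if .aux .fin (ψ.yieldUntil θ).toX ∈ Θ then
        θ.toX ∈ Θ ∨ ψ.toX ∈ Θ ∧ .aux .pend (ψ.yieldUntil θ).toX ∈ Ψ
      else .aux .pend (ψ.yieldUntil θ).toX ∈ Ψ)
  yieldSince : ∀ ψ θ : Formula AP, (ψ.yieldSince θ).toX ∈ closure φ →
    (.aux .pend (ψ.yieldSince θ).toX ∈ Θ ↔ .aux .pend (ψ.yieldSince θ).toX ∈ Ψ)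
  yieldSince_acc : ∀ ψ θ : Formula AP, (ψ.yieldSince θ).toX ∈ closure φ →
    (.aux .acc (ψ.yieldSince θ).toX ∈ Ψ ↔
      if .aux .fin (ψ.yieldSince θ).toX ∈ Θ then
        θ.toX ∈ Θ ∨ ψ.toX ∈ Θ ∧ .aux .acc (ψ.yieldSince θ).toX ∈ Θ
      else .aux .acc (ψ.yieldSince θ).toX ∈ Θ)
  -- The operands are evaluated in the left end of the popped pair, whose atom is no longer at hand.
  -- The `pend` symbols of their matching backs retain this information, which is why the closure
  -- contains these formulas.
  takeUntil : ∀ ψ θ : Formula AP, (ψ.takeUntil θ).toX ∈ closure φ →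
    (.aux .pend (ψ.takeUntil θ).toX ∈ Ψ ↔ .aux .fin (ψ.takeUntil θ).toX ∈ Φ ∧
      (.aux .pend θ.chainBack.toX ∈ Φ ∨
        .aux .pend ψ.chainBack.toX ∈ Φ ∧ .aux .pend (ψ.takeUntil θ).toX ∈ Φ))
  takeSince : ∀ ψ θ : Formula AP, (ψ.takeSince θ).toX ∈ closure φ →
    (.aux .pend (ψ.takeSince θ).toX ∈ Φ ↔
      if .aux .fin (ψ.takeSince θ).toX ∈ Φ then
        .aux .pend θ.chainBack.toX ∈ Φ ∨
          .aux .pend ψ.chainBack.toX ∈ Φ ∧ .aux .pend (ψ.takeSince θ).toX ∈ Ψ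
      else .aux .pend (ψ.takeSince θ).toX ∈ Ψ)

/-- Conditions on an atom for the initial position. -/
structure Start (φ : Formula AP) (Φ : Set (XFormula AP)) : Prop where
  props : ∀ p, .prop p ∈ Φ ↔ p = none
  back : ∀ ψ : Formula AP, ψ.back.toX ∉ Φ
  chainBack : ∀ ψ : Formula AP, ψ.chainBack.toX ∉ Φ
  takeUntil : ∀ ψ θ : Formula AP, (ψ.takeUntil θ).toX ∉ Φ
  takeSince : ∀ ψ θ : Formula AP, (ψ.takeSince θ).toX ∉ Φ

/-- Conditions on an atom for the final position. -/
structure Stop (φ : Formula AP) (Φ : Set (XFormula AP)) : Prop where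
  props : ∀ p, .prop p ∈ Φ ↔ p = none
  next : ∀ ψ, .next ψ ∉ Φ
  chainNext : ∀ ψ : Formula AP, ψ.chainNext.toX ∉ Φ
  yieldUntil : ∀ ψ θ : Formula AP, (ψ.yieldUntil θ).toX ∉ Φ
  yieldSince : ∀ ψ θ : Formula AP, (ψ.yieldSince θ).toX ∉ Φ

/-- The automaton of a formula. -/
def automaton (M : OPM (Set AP)) (φ : Formula AP) : OPA M (Atom φ) where
  -- The run starts with position `1` as the next to read, so the atom of position `0` has no state
  -- of its own and is guessed here.
  init := {Φ | φ.toX ∈ Φ.1 ∧ ∃ Φ₀, IsAtom φ Φ₀ ∧ Start φ Φ₀ ∧ Enter M φ Φ₀ Φ.1}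
  -- The last pair `(0, w.length + 1)` is in relation `eq`, hence extremal on both sides, but no
  -- transition leaves it. Like a shift it carries both `Leave` and `Close`, whereas a push carries
  -- only `Leave` and a pop only `Close`.
  final := {Φ | Stop φ Φ.1 ∧ Leave φ Φ.1 ∧ Close φ Φ.1}
  push := {t | t.1.MayRead t.2.1 t.2.2 ∧ Enter M φ t.1.1 t.2.2.1 ∧ Leave φ t.1.1}
  shift := {t | t.1.MayRead t.2.1 t.2.2 ∧ Enter M φ t.1.1 t.2.2.1 ∧ Leave φ t.1.1 ∧ Close φ t.1.1}
  pop := {t | Close φ t.1.1 ∧ Pop φ t.1.1 t.2.1.1 t.2.2.1}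

theorem automaton_respectsAtoms (M : OPM (Set AP)) (φ : Formula AP) :
    (automaton M φ).RespectsAtoms where
  init _ h := h.1
  final _ h := ⟨Set.ext fun p => h.1.props p, h.1.next⟩
  push _ _ _ h := h.1
  shift _ _ _ h := h.1
  pop _ _ _ h := Set.ext fun p => (h.2.stay (.prop p)).symm

/-- A labelling of the adjacent pairs of positions satisfying the conditions of the automaton. -/
structure Coherent (M : OPM (Set AP)) (w : List (Set AP)) (φ : Formula AP)
    (Φ₀ : Set (XFormula AP)) (S : ℕ → ℕ → Set (XFormula AP)) : Prop where
  atom_zero : IsAtom φ Φ₀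
  atom : ∀ i j, IsAtom φ (S i j)
  start : Start φ Φ₀
  enter_zero : Enter M φ Φ₀ (S 0 1)
  ending : Stop φ (S 0 (w.length + 1))
  read : ∀ i j a, Act M w i j → rel M w i j ≠ some Prec.gt → letterAt w j = some a →
    ∀ p, .prop p ∈ S i j ↔ p ∈ some '' a
  enter : ∀ i j, Act M w i j → rel M w i j ≠ some Prec.gt → j ≤ w.length →
    Enter M φ (S i j) (S j (j + 1))
  leave : ∀ i j, Act M w i j → rel M w i j ≠ some Prec.gt → Leave φ (S i j)
  close : ∀ i j, Act M w i j → rel M w i j ≠ some Prec.lt → Close φ (S i j)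
  pop : ∀ i h k j, Open M w i h k → Act M w k j → rel M w k j = some Prec.gt →
    Pop φ (S k j) (S i h) (S i j)

theorem eq_zero_of_rel_last {L : Type*} {M : OPM L} {w : List L} {i : ℕ}
    (h : Act M w i (w.length + 1)) (hr : rel M w i (w.length + 1) ≠ some Prec.gt) : i = 0 := by
  by_contra h0
  have := h.1.lt
  exact hr (rel_last (by omega) (by omega))

theorem coherent_of_mem_language {M : OPM (Set AP)} {w : List (Set AP)} {φ : Formula AP}
    (h : w ∈ (automaton M φ).language) :
    Compatible M w ∧ ∃ Φ₀ S, Coherent M w φ Φ₀ S ∧ φ.toX ∈ S 0 1 := by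
  obtain ⟨hc, S, ⟨h0, Φ₀, ha, hs, he⟩, ⟨hf, hfl, hfc⟩, hL⟩ := (mem_language_iff _).1 h
  have hread : ∀ i j a, Act M w i j → rel M w i j ≠ some Prec.gt → letterAt w j = some a →
      (S i j).MayRead a (S j (j + 1)) ∧ Enter M φ (S i j).1 (S j (j + 1)).1 ∧
        Leave φ (S i j).1 := by
    intro i j a hij hr hja
    rcases hc.rel_cases hij with h | h | h
    · exact (hL i j hij).push a hja h
    · have := (hL i j hij).shift a hja h
      exact ⟨this.1, this.2.1, this.2.2.1⟩
    · exact absurd h hr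
  refine ⟨hc, Φ₀, fun i j => (S i j).1, ⟨ha, fun i j => (S i j).2, hs, he, hf, ?_, ?_, ?_, ?_, ?_⟩,
    h0⟩
  · intro i j a hij hr hja p
    exact Set.ext_iff.1 (hread i j a hij hr hja).1.props p
  · intro i j hij hr hj
    have := hij.1.lt
    obtain ⟨a, hja⟩ := letterAt_some (w := w) (j := j) (by omega) hj
    exact (hread i j a hij hr hja).2.1
  · intro i j hij hr
    have := hij.1.lt
    rcases Nat.lt_or_eq_of_le hij.2 with hj | rfl
    · obtain ⟨a, hja⟩ := letterAt_some (w := w) (j := j) (by omega) (by omega)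
      exact (hread i j a hij hr hja).2.2
    · obtain rfl := eq_zero_of_rel_last hij hr
      exact hfl
  · intro i j hij hr
    have := hij.1.lt
    rcases hc.rel_cases hij with h | h | h
    · exact absurd h hr
    · rcases Nat.lt_or_eq_of_le hij.2 with hj | rfl
      · obtain ⟨a, hja⟩ := letterAt_some (w := w) (j := j) (by omega) (by omega)
        exact ((hL i j hij).shift a hja h).2.2.2
      · obtain rfl := eq_zero_of_rel_last hij (by simp [h])
        exact hfc
    -- The condition `Close` for a pair in `gt` comes from a pop transition, so an open body ending
    -- in `i` must be exhibited.
    · have hi : 1 ≤ i := by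
        by_contra h1
        obtain rfl : i = 0 := by omega
        exact rel_zero_ne_gt h
      have := hij.2
      obtain ⟨i₀, h', o⟩ := hc.exists_open i hi (by omega)
      exact ((hL i j hij).pop i₀ h' o h).1
  · intro i h k j o hkj hr
    exact ((hL k j hkj).pop i h o hr).2

end Automaton

section Soundness

variable {AP : Type*} {M : OPM (Set AP)} {w : List (Set AP)} {φ : Formula AP}
  {Φ₀ : Set (XFormula AP)} {S : ℕ → ℕ → Set (XFormula AP)}

/-! ## Coherent labellings describe the semantics -/

theorem Requires.mem {η χ : XFormula AP} (h : η ∈ closure φ) (r : Requires η χ) :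
    χ ∈ closure φ := InClosure.requires η χ h r

/-- Every adjacent pair is a single step or arises by a pop from the two shorter pairs `(i, h)` and
`(k, j)`. This is the induction for symbols whose initial value is set on entry. -/
theorem Act.induction {L : Type*} {M : OPM L} {w : List L} {C : ℕ → ℕ → Prop}
    (base : ∀ i, i ≤ w.length → C i (i + 1))
    (step : ∀ i h k j, Open M w i h k → Act M w i h → Act M w k j → rel M w k j = some Prec.gt →
      C i h → C k j → C i j) : ∀ i j, Act M w i j → C i j := by
  intro i j
  induction hN : j - i using Nat.strong_induction_on generalizing i j with
  | _ N IH =>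
  intro hij
  have hlt := hij.1.lt
  by_cases hne : i + 1 = j
  · subst hne
    exact base i (by have := hij.2; omega)
  · obtain ⟨h, k, o, ha, hr⟩ := (hij.1.chain hne).exists_open
    have := o.lt
    have := o.le
    have := ha.lt
    have := hij.2
    have h1 : Act M w i h := ⟨o.1, by omega⟩
    have h2 : Act M w k j := ⟨ha, hij.2⟩
    exact step i h k j o h1 h2 hr (IH _ (by omega) i h rfl h1) (IH _ (by omega) k j rfl h2)

/-- The formula `f` belongs to the atoms of position `j`. -/
def Holds (Φ₀ : Set (XFormula AP)) (S : ℕ → ℕ → Set (XFormula AP)) (f : Formula AP) (j : ℕ) :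
    Prop :=
  f.toX ∈ if j = 0 then Φ₀ else S (j - 1) j

theorem holds_zero {f : Formula AP} : Holds Φ₀ S f 0 ↔ f.toX ∈ Φ₀ := by simp [Holds]

namespace Coherent

/-- Pops keep ordinary formulas, so all labels of pairs with right end `j` agree on them; `Holds` is
thus a property of the position. -/
theorem mem_iff (C : Coherent M w φ Φ₀ S) {i j : ℕ} (h : Act M w i j) (f : Formula AP) :
    f.toX ∈ S i j ↔ Holds Φ₀ S f j := by
  refine Act.induction (C := fun i j => f.toX ∈ S i j ↔ Holds Φ₀ S f j) ?_ ?_ i j h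
  · intro i _
    simp [Holds]
  · intro i h k j o _ hkj hr _ ih
    rw [← ih]
    exact ((C.pop i h k j o hkj hr).stay f).symm

theorem holds_prop (C : Coherent M w φ Φ₀ S) (hc : Compatible M w) {j : ℕ}
    (hj : j ≤ w.length + 1) (p : Option AP) : Holds Φ₀ S (.prop p) j ↔ p ∈ label w j := by
  rcases Nat.eq_zero_or_pos j with rfl | h1
  · rw [holds_zero]
    exact (C.start.props p).trans (by simp [label, letterAt])
  rcases Nat.lt_or_eq_of_le hj with h2 | rfl
  · obtain ⟨i, hi, hr⟩ := hc.exists_left h1 hj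
    obtain ⟨a, ha⟩ := letterAt_some (w := w) h1 (by omega)
    rw [← C.mem_iff hi]
    exact (C.read i j a hi hr ha p).trans (by simp [label, ha])
  · have h : letterAt w (w.length + 1) = none := letterAt_none (by omega)
    obtain ⟨i, hi, hr⟩ := hc.exists_left h1 hj
    obtain rfl := eq_zero_of_rel_last hi hr
    rw [← C.mem_iff hi]
    exact (C.ending.props p).trans (by simp [label, h])

theorem _root_.OPTL.letterOf_eq {j : ℕ} {Φ : Set (XFormula AP)}
    (h : ∀ p, .prop p ∈ Φ ↔ p ∈ label w j) : letterOf Φ = letterAt w j := by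
  unfold letterOf
  rw [h]
  cases hl : letterAt w j with
  | none => simp [label, hl]
  | some a => simp [h, label, hl]

/-- Every position before the final `#` has a label from which it is left: that of its farthest left
neighbour, or the guessed atom for position `0`. The entry conditions can thus be used uniformly at
all positions. -/
theorem exists_enter (C : Coherent M w φ Φ₀ S) (hc : Compatible M w) {j : ℕ}
    (hj : j ≤ w.length) : ∃ Φ, IsAtom φ Φ ∧ (∀ f : Formula AP, f.toX ∈ Φ ↔ Holds Φ₀ S f j) ∧
      Enter M φ Φ (S j (j + 1)) ∧ M.ext (letterOf Φ) (letterOf (S j (j + 1))) =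
        rel M w j (j + 1) := by
  have key : ∀ Φ, (∀ f : Formula AP, f.toX ∈ Φ ↔ Holds Φ₀ S f j) →
      M.ext (letterOf Φ) (letterOf (S j (j + 1))) = rel M w j (j + 1) := by
    intro Φ hΦ
    rw [rel, letterOf_eq (w := w) (j := j), letterOf_eq (w := w) (j := j + 1)]
    · exact fun p => (C.mem_iff (act_succ hj) (.prop p)).trans (C.holds_prop hc (by omega) p)
    · exact fun p => (hΦ (.prop p)).trans (C.holds_prop hc (by omega) p)
  rcases Nat.eq_zero_or_pos j with rfl | h1
  · exact ⟨Φ₀, C.atom_zero, fun f => holds_zero.symm, C.enter_zero, key _ fun f => holds_zero.symm⟩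
  · obtain ⟨i, hi, hr⟩ := hc.exists_left h1 (by omega)
    exact ⟨S i j, C.atom i j, C.mem_iff hi, C.enter i j hi hr hj, key _ (C.mem_iff hi)⟩

theorem exists_atom (C : Coherent M w φ Φ₀ S) {j : ℕ} (hj : j ≤ w.length + 1) :
    ∃ Φ, IsAtom φ Φ ∧ (∀ f : Formula AP, f.toX ∈ Φ ↔ Holds Φ₀ S f j) := by
  rcases Nat.eq_zero_or_pos j with rfl | h1
  · exact ⟨Φ₀, C.atom_zero, fun f => holds_zero.symm⟩
  · have := act_succ (M := M) (w := w) (i := j - 1) (by omega)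
    rw [Nat.sub_add_cancel h1] at this
    exact ⟨S (j - 1) j, C.atom _ _, C.mem_iff this⟩

theorem stop_holds (C : Coherent M w φ Φ₀ S) (hc : Compatible M w) (f : Formula AP) :
    f.toX ∈ S 0 (w.length + 1) ↔ Holds Φ₀ S f (w.length + 1) := by
  obtain ⟨i, hi, hr⟩ := hc.exists_left (j := w.length + 1) (by omega) le_rfl
  obtain rfl := eq_zero_of_rel_last hi hr
  exact C.mem_iff hi f

theorem fin_iff (C : Coherent M w φ Φ₀ S) {i j : ℕ} (h : Act M w i j) (η : Formula AP)
    (hη : .aux .fin η.toX ∈ closure φ) (hc : Compatible M w) : .aux .fin η.toX ∈ S i j ↔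
        i + 1 ≠ j := by
  refine Act.induction (C := fun i j => .aux .fin η.toX ∈ S i j ↔ i + 1 ≠ j) ?_ ?_ i j h
  · intro i hi
    obtain ⟨Φ, -, -, he, -⟩ := C.exists_enter hc hi
    simpa using he.fin η.toX
  · intro i h k j o _ hkj hr _ _
    have := (o.chain hkj.1 hr).add_one_lt
    exact iff_of_true ((C.pop i h k j o hkj hr).fin η.toX hη) this.ne

/-! ### Next and back -/

theorem holds_next (C : Coherent M w φ Φ₀ S) (hc : Compatible M w) {j : ℕ}
    (hj : j ≤ w.length + 1) {ψ : Formula AP} (h : ψ.next.toX ∈ closure φ) :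
    Holds Φ₀ S ψ.next j ↔ j + 1 ≤ w.length + 1 ∧ Holds Φ₀ S ψ (j + 1) := by
  rcases Nat.lt_or_eq_of_le hj with h2 | rfl
  · obtain ⟨Φ, -, hΦ, he, -⟩ := C.exists_enter hc (j := j) (by omega)
    rw [← hΦ, he.next ψ h, C.mem_iff (act_succ (by omega))]
    exact ⟨fun h => ⟨by omega, h⟩, fun h => h.2⟩
  · rw [← C.stop_holds hc]
    exact iff_of_false (C.ending.next _) (by omega)

theorem holds_back (C : Coherent M w φ Φ₀ S) (hc : Compatible M w) {j : ℕ}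
    (hj : j ≤ w.length + 1) {ψ : Formula AP} (h : ψ.back.toX ∈ closure φ) :
    Holds Φ₀ S ψ.back j ↔ 1 ≤ j ∧ Holds Φ₀ S ψ (j - 1) := by
  cases j with
  | zero =>
    rw [holds_zero]
    exact iff_of_false (C.start.back _) (by omega)
  | succ j =>
    obtain ⟨Φ, -, hΦ, he, -⟩ := C.exists_enter hc (j := j) (by omega)
    rw [← C.mem_iff (act_succ (by omega)), he.back ψ h, hΦ]
    simp

/-! ### Matching next and back -/

/-- The value is set when `i` is read and passed through the stacked state at each pop, so it is the
same at all pairs with left end `i`. It is checked at the farthest one in `holds_chainNext`. -/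
theorem chainNext_pend (C : Coherent M w φ Φ₀ S) (hc : Compatible M w) {i j : ℕ}
    (hij : Act M w i j) {ψ : Formula AP} (h : ψ.chainNext.toX ∈ closure φ) :
    .aux .pend ψ.chainNext.toX ∈ S i j ↔ Holds Φ₀ S ψ.chainNext i := by
  refine Act.induction
    (C := fun i j => .aux .pend ψ.chainNext.toX ∈ S i j ↔ Holds Φ₀ S ψ.chainNext i) ?_ ?_ i j hij
  · intro i hi
    obtain ⟨Φ, -, hΦ, he, -⟩ := C.exists_enter hc hi
    rw [← hΦ, he.chainNext ψ h]
  · intro i h' k j o _ hkj hr ih _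
    rw [← ih, (C.pop i h' k j o hkj hr).chainNext ψ h]

theorem chainBack_pend (C : Coherent M w φ Φ₀ S) (hc : Compatible M w) {i j : ℕ}
    (hij : Act M w i j) {ψ : Formula AP} (h : ψ.chainBack.toX ∈ closure φ) :
    .aux .pend ψ.chainBack.toX ∈ S i j ↔ Holds Φ₀ S ψ i := by
  refine Act.induction
    (C := fun i j => .aux .pend ψ.chainBack.toX ∈ S i j ↔ Holds Φ₀ S ψ i) ?_ ?_ i j hij
  · intro i hi
    obtain ⟨Φ, -, hΦ, he, -⟩ := C.exists_enter hc hi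
    rw [← hΦ, he.chainBack ψ h]
  · intro i h' k j o _ hkj hr ih _
    rw [← ih, (C.pop i h' k j o hkj hr).chainBack ψ h]

theorem holds_chainNext (C : Coherent M w φ Φ₀ S) (hc : Compatible M w) {j : ℕ}
    (hj : j ≤ w.length + 1) {ψ : Formula AP} (h : ψ.chainNext.toX ∈ closure φ) :
    Holds Φ₀ S ψ.chainNext j ↔ ∃ k, chiFwd M w j k ∧ Holds Φ₀ S ψ k := by
  rcases Nat.lt_or_eq_of_le hj with h2 | rfl
  · obtain ⟨k, hk, hr⟩ := hc.exists_right (k := j) (by omega)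
    rw [← C.chainNext_pend hc hk h, (C.close j k hk hr).chainNext ψ h,
      C.fin_iff hk ψ.chainNext (Requires.mem h (.chainNext_fin _)) hc, C.mem_iff hk]
    constructor
    · exact fun h => ⟨k, (chiFwd_iff hk hr k).2 ⟨rfl, h.1⟩, h.2⟩
    · rintro ⟨k', h1, h2⟩
      obtain ⟨rfl, h3⟩ := (chiFwd_iff hk hr k').1 h1
      exact ⟨h3, h2⟩
  · rw [← C.stop_holds hc]
    refine iff_of_false (C.ending.chainNext _) ?_
    rintro ⟨k, h1, -⟩
    obtain ⟨⟨h2, h3⟩, -⟩ := chi_iff.1 h1.1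
    have := h2.lt
    omega

theorem holds_chainBack (C : Coherent M w φ Φ₀ S) (hc : Compatible M w) {j : ℕ}
    (hj : j ≤ w.length + 1) {ψ : Formula AP} (h : ψ.chainBack.toX ∈ closure φ) :
    Holds Φ₀ S ψ.chainBack j ↔ ∃ i, chiBwd M w i j ∧ Holds Φ₀ S ψ i := by
  rcases Nat.eq_zero_or_pos j with rfl | h1
  · rw [holds_zero]
    refine iff_of_false (C.start.chainBack _) ?_
    rintro ⟨k, h1, -⟩
    have := (chi_iff.1 h1.1).1.1.lt
    omega
  · obtain ⟨i, hi, hr⟩ := hc.exists_left h1 hj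
    rw [← C.mem_iff hi, (C.leave i j hi hr).chainBack ψ h,
      C.fin_iff hi ψ.chainBack (Requires.mem h (.chainBack_fin _)) hc, C.chainBack_pend hc hi h]
    constructor
    · exact fun h => ⟨i, (chiBwd_iff hi hr i).2 ⟨rfl, h.1⟩, h.2⟩
    · rintro ⟨i', h1, h2⟩
      obtain ⟨rfl, h3⟩ := (chiBwd_iff hi hr i').1 h1
      exact ⟨h3, h2⟩

/-! ### Summary operators -/

/-- Before the final position the entry condition gives the expansion with its precedence test. At
the final position there is no next or matching next, so the weaker conditions on atoms already
suffice. -/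
theorem holds_sumUntil (C : Coherent M w φ Φ₀ S) (hc : Compatible M w) {j : ℕ}
    (hj : j ≤ w.length + 1) {O : Set Prec} {ψ θ : Formula AP}
    (h : (Formula.sumUntil O ψ θ).toX ∈ closure φ) :
    Holds Φ₀ S (.sumUntil O ψ θ) j ↔ Holds Φ₀ S θ j ∨ Holds Φ₀ S ψ j ∧
      ((∃ k, chiFwd M w j k ∧ Holds Φ₀ S (.sumUntil O ψ θ) k) ∨
        (j + 1 ≤ w.length + 1 ∧ Holds Φ₀ S (.sumUntil O ψ θ) (j + 1)) ∧
          ∃ r ∈ O, rel M w j (j + 1) = some r) := by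
  have h1 : (Formula.sumUntil O ψ θ).chainNext.toX ∈ closure φ :=
      Requires.mem h (.sumUntil_chain _ _ _)
  have h2 : (Formula.sumUntil O ψ θ).next.toX ∈ closure φ := Requires.mem h (.sumUntil_next _ _ _)
  rw [← C.holds_chainNext hc hj h1, ← C.holds_next hc hj h2]
  rcases Nat.lt_or_eq_of_le hj with h3 | rfl
  · obtain ⟨Φ, -, hΦ, he, hr⟩ := C.exists_enter hc (j := j) (by omega)
    have := he.sumUntil O ψ θ h
    rw [hr] at this
    simpa only [hΦ] using this
  · have h3 := C.ending.next (Formula.sumUntil O ψ θ).toX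
    have h4 := C.ending.chainNext (Formula.sumUntil O ψ θ)
    simp only [← C.stop_holds hc]
    constructor
    · intro h5
      rcases (C.atom _ _).sumUntil_mp O ψ.toX θ.toX h5 with h6 | ⟨-, h6⟩ | ⟨-, h6⟩
      · exact .inl h6
      · exact absurd h6 h4
      · exact absurd h6 h3
    · rintro (h5 | ⟨-, h5 | ⟨h5, -⟩⟩)
      · exact (C.atom _ _).sumUntil_mpr O ψ.toX θ.toX h (.inl h5)
      · exact absurd h5 h4
      · exact absurd h5 h3

theorem holds_sumSince (C : Coherent M w φ Φ₀ S) (hc : Compatible M w) {j : ℕ}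
    (hj : j ≤ w.length + 1) {O : Set Prec} {ψ θ : Formula AP}
    (h : (Formula.sumSince O ψ θ).toX ∈ closure φ) :
    Holds Φ₀ S (.sumSince O ψ θ) j ↔ Holds Φ₀ S θ j ∨ Holds Φ₀ S ψ j ∧
      ((∃ k, chiBwd M w k j ∧ Holds Φ₀ S (.sumSince O ψ θ) k) ∨
        (1 ≤ j ∧ Holds Φ₀ S (.sumSince O ψ θ) (j - 1)) ∧
          ∃ r ∈ O, rel M w (j - 1) j = some r) := by
  have h1 : (Formula.sumSince O ψ θ).chainBack.toX ∈ closure φ :=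
      Requires.mem h (.sumSince_chain _ _ _)
  have h2 : (Formula.sumSince O ψ θ).back.toX ∈ closure φ := Requires.mem h (.sumSince_back _ _ _)
  rw [← C.holds_chainBack hc hj h1, ← C.holds_back hc hj h2]
  cases j with
  | zero =>
    have h3 := C.start.back (Formula.sumSince O ψ θ)
    have h4 := C.start.chainBack (Formula.sumSince O ψ θ)
    simp only [holds_zero]
    constructor
    · intro h5
      rcases C.atom_zero.sumSince_mp O ψ.toX θ.toX h5 with h6 | ⟨-, h6⟩ | ⟨-, h6⟩
      · exact .inl h6
      · exact absurd h6 h4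
      · exact absurd h6 h3
    · rintro (h5 | ⟨-, h5 | ⟨h5, -⟩⟩)
      · exact C.atom_zero.sumSince_mpr O ψ.toX θ.toX h (.inl h5)
      · exact absurd h5 h4
      · exact absurd h5 h3
  | succ j =>
    obtain ⟨Φ, -, hΦ, he, hr⟩ := C.exists_enter hc (j := j) (by omega)
    have := he.sumSince O ψ θ h
    rw [hr] at this
    simpa only [C.mem_iff (act_succ (M := M) (w := w) (i := j) (by omega)), Nat.add_sub_cancel]
      using this

/-! ### Hierarchical operators -/

/-- Here the known value is at the far end: `Close` forbids the symbol at the farthest neighbour of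
`i`. The induction therefore runs from right to left over the neighbours of `i`. -/
theorem yieldUntil_pend (C : Coherent M w φ Φ₀ S) (hc : Compatible M w) {ψ θ : Formula AP}
    (h : (ψ.yieldUntil θ).toX ∈ closure φ) {i : ℕ} :
    ∀ d j, w.length + 1 ≤ j + d → Act M w i j → (.aux .pend (ψ.yieldUntil θ).toX ∈ S i j ↔
      YieldU M w (Holds Φ₀ S ψ) (Holds Φ₀ S θ) i j) := by
  intro d
  induction d with
  | zero =>
    intro j hd hij
    obtain rfl : j = w.length + 1 := by have := hij.2; omega
    exact iff_of_false ((C.close _ _ hij rel_last_ne_lt).yieldUntil ψ θ)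
      (not_yieldU hij rel_last_ne_lt)
  | succ d ih =>
    intro j hd hij
    by_cases hr : rel M w i j = some Prec.lt
    · obtain ⟨k, j', o, hkj, hr'⟩ := hc.exists_close hij hr
      have := o.le
      have := hkj.1.lt
      rw [(C.pop _ _ _ _ o hkj hr').yieldUntil ψ θ h, YieldU.step o hkj hr',
        ← ih j' (by omega) ((o.chain hkj.1 hr').act hkj.2)]
      simp only [C.fin_iff hij (ψ.yieldUntil θ) (Requires.mem h (.yieldUntil_fin _ _)) hc,
          C.mem_iff hij]
    · exact iff_of_false ((C.close _ _ hij hr).yieldUntil ψ θ) (not_yieldU hij hr)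

theorem holds_yieldUntil (C : Coherent M w φ Φ₀ S) (hc : Compatible M w) {j : ℕ}
    (hj : j ≤ w.length + 1) {ψ θ : Formula AP} (h : (ψ.yieldUntil θ).toX ∈ closure φ) :
    Holds Φ₀ S (ψ.yieldUntil θ) j ↔
      YieldU M w (Holds Φ₀ S ψ) (Holds Φ₀ S θ) j (j + 1) := by
  rcases Nat.lt_or_eq_of_le hj with h3 | rfl
  · obtain ⟨Φ, -, hΦ, he, hr⟩ := C.exists_enter hc (j := j) (by omega)
    rw [← hΦ, ← he.yieldUntil ψ θ h,
      C.yieldUntil_pend hc h (w.length + 1) _ (by omega) (act_succ (by omega))]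
  · rw [← C.stop_holds hc]
    refine iff_of_false (C.ending.yieldUntil _ _) ?_
    rintro ⟨k, -, h1, -⟩
    have := h1.lt
    have := h1.le
    omega

theorem yieldSince_pend (C : Coherent M w φ Φ₀ S) (hc : Compatible M w) {i j : ℕ}
    (hij : Act M w i j) {ψ θ : Formula AP} (h : (ψ.yieldSince θ).toX ∈ closure φ) :
    .aux .pend (ψ.yieldSince θ).toX ∈ S i j ↔ Holds Φ₀ S (ψ.yieldSince θ) i := by
  refine Act.induction (C := fun i j => .aux .pend (ψ.yieldSince θ).toX ∈ S i j ↔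
    Holds Φ₀ S (ψ.yieldSince θ) i) ?_ ?_ i j hij
  · intro i hi
    obtain ⟨Φ, -, hΦ, he, -⟩ := C.exists_enter hc hi
    rw [← hΦ, he.yieldSince ψ θ h]
  · intro i h' k j o _ hkj hr ih _
    rw [← ih, (C.pop i h' k j o hkj hr).yieldSince ψ θ h]

theorem yieldSince_acc (C : Coherent M w φ Φ₀ S) (hc : Compatible M w) {i j : ℕ}
    (hij : Act M w i j) {ψ θ : Formula AP} (h : (ψ.yieldSince θ).toX ∈ closure φ) :
    .aux .acc (ψ.yieldSince θ).toX ∈ S i j ↔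
      YieldS M w (Holds Φ₀ S ψ) (Holds Φ₀ S θ) i j := by
  refine Act.induction (C := fun i j => .aux .acc (ψ.yieldSince θ).toX ∈ S i j ↔
    YieldS M w (Holds Φ₀ S ψ) (Holds Φ₀ S θ) i j) ?_ ?_ i j hij
  · intro i hi
    obtain ⟨Φ, -, hΦ, he, -⟩ := C.exists_enter hc hi
    exact iff_of_false (he.yieldSince_acc ψ θ) not_yieldS
  · intro i h' k j o hih hkj hr ih _
    rw [(C.pop i h' k j o hkj hr).yieldSince_acc ψ θ h, YieldS.step o hkj hr]
    simp only [ih, C.fin_iff hih (ψ.yieldSince θ) (Requires.mem h (.yieldSince_fin _ _)) hc,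
        C.mem_iff hih]

theorem holds_yieldSince (C : Coherent M w φ Φ₀ S) (hc : Compatible M w) {j : ℕ}
    (hj : j ≤ w.length + 1) {ψ θ : Formula AP} (h : (ψ.yieldSince θ).toX ∈ closure φ) :
    Holds Φ₀ S (ψ.yieldSince θ) j ↔
      YieldS M w (Holds Φ₀ S ψ) (Holds Φ₀ S θ) j (w.length + 2) := by
  rcases Nat.lt_or_eq_of_le hj with h3 | rfl
  · obtain ⟨k, hk, hr⟩ := hc.exists_right (k := j) (by omega)
    rw [yieldS_full hk hr, ← C.yieldSince_acc hc hk h, ← (C.close j k hk hr).yieldSince ψ θ h,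
      C.yieldSince_pend hc hk h]
  · rw [← C.stop_holds hc]
    refine iff_of_false (C.ending.yieldSince _ _) ?_
    rintro ⟨k, -, h1, -⟩
    have := h1.lt
    have := h1.le
    omega

/-- The symbol is absent at entry, where nothing lies between the two positions, and each pop adds
the popped position `k` to the scan. The result is read off at the farthest left neighbour. -/
theorem takeUntil_pend (C : Coherent M w φ Φ₀ S) (hc : Compatible M w) {i j : ℕ}
    (hij : Act M w i j) {ψ θ : Formula AP} (h : (ψ.takeUntil θ).toX ∈ closure φ) :
    .aux .pend (ψ.takeUntil θ).toX ∈ S i j ↔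
      TakeU M w (Holds Φ₀ S ψ) (Holds Φ₀ S θ) i j := by
  refine Act.induction (C := fun i j => .aux .pend (ψ.takeUntil θ).toX ∈ S i j ↔
    TakeU M w (Holds Φ₀ S ψ) (Holds Φ₀ S θ) i j) ?_ ?_ i j hij
  · intro i hi
    obtain ⟨Φ, -, hΦ, he, -⟩ := C.exists_enter hc hi
    exact iff_of_false (he.takeUntil ψ θ) (not_takeU rfl)
  · intro i h' k j o _ hkj hr _ ih
    rw [(C.pop i h' k j o hkj hr).takeUntil ψ θ h, TakeU.step o hkj hr, ih,
      C.fin_iff hkj (ψ.takeUntil θ) (Requires.mem h (.takeUntil_fin _ _)) hc,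
      C.chainBack_pend hc hkj (Requires.mem h (.takeUntil_left _ _)),
      C.chainBack_pend hc hkj (Requires.mem h (.takeUntil_right _ _))]

theorem holds_takeUntil (C : Coherent M w φ Φ₀ S) (hc : Compatible M w) {j : ℕ}
    (hj : j ≤ w.length + 1) {ψ θ : Formula AP} (h : (ψ.takeUntil θ).toX ∈ closure φ) :
    Holds Φ₀ S (ψ.takeUntil θ) j ↔ ∃ k, TakeStart M w j k ∧ Holds Φ₀ S θ k ∧
      ∀ x, x < k → TakeStart M w j x → Holds Φ₀ S ψ x := by
  rcases Nat.eq_zero_or_pos j with rfl | h1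
  · rw [holds_zero]
    refine iff_of_false (C.start.takeUntil _ _) ?_
    rintro ⟨k, h1, -⟩
    have := h1.lt
    omega
  · obtain ⟨i, hi, hr⟩ := hc.exists_left h1 hj
    rw [takeU_full hi hr, ← C.takeUntil_pend hc hi h, ← C.mem_iff hi,
      (C.leave i j hi hr).takeUntil ψ θ h]

/-- The known value is at the farthest left neighbour of `j`, where `Leave` forbids the symbol, so
the induction is on the left end. -/
theorem takeSince_pend (C : Coherent M w φ Φ₀ S) (hc : Compatible M w) {ψ θ : Formula AP}
    (h : (ψ.takeSince θ).toX ∈ closure φ) {i j : ℕ} (hij : Act M w i j) :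
    .aux .pend (ψ.takeSince θ).toX ∈ S i j ↔
      TakeS M w (Holds Φ₀ S ψ) (Holds Φ₀ S θ) i j := by
  induction i using Nat.strong_induction_on with
  | _ i IH =>
  have hlt := hij.1.lt
  have hle := hij.2
  by_cases hr : rel M w i j = some Prec.gt
  · have hi : 1 ≤ i := by
      by_contra h1
      obtain rfl : i = 0 := by omega
      exact rel_zero_ne_gt hr
    obtain ⟨i₀, h', o⟩ := hc.exists_open i hi (by omega)
    have := o.lt
    have := o.le
    rw [(C.pop _ _ _ _ o hij hr).takeSince ψ θ h, TakeS.step o hij hr,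
      ← IH i₀ (by omega) ((o.chain hij.1 hr).act hij.2)]
    simp only [C.fin_iff hij (ψ.takeSince θ) (Requires.mem h (.takeSince_fin _ _)) hc,
      C.chainBack_pend hc hij (Requires.mem h (.takeSince_left _ _)),
      C.chainBack_pend hc hij (Requires.mem h (.takeSince_right _ _))]
  · exact iff_of_false ((C.leave i j hij hr).takeSince ψ θ) (not_takeS hij hr)

theorem holds_takeSince (C : Coherent M w φ Φ₀ S) (hc : Compatible M w) {j : ℕ}
    (hj : j ≤ w.length + 1) {ψ θ : Formula AP} (h : (ψ.takeSince θ).toX ∈ closure φ) :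
    Holds Φ₀ S (ψ.takeSince θ) j ↔
      TakeS M w (Holds Φ₀ S ψ) (Holds Φ₀ S θ) (j - 1) j := by
  cases j with
  | zero =>
    rw [holds_zero]
    refine iff_of_false (C.start.takeSince _ _) ?_
    rintro ⟨k, -, h1, -⟩
    have := h1.lt
    omega
  | succ j =>
    obtain ⟨Φ, -, hΦ, he, hr⟩ := C.exists_enter hc (j := j) (by omega)
    have hact := act_succ (M := M) (w := w) (i := j) (by omega)
    rw [← C.mem_iff hact, ← he.takeSince ψ θ h, C.takeSince_pend hc h hact, Nat.add_sub_cancel]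

/-! ### Correctness -/

/-- Linear and summary operators satisfy the same expansion on both sides; an inner induction on the
distance to the end (or beginning) makes the solution unique. The hierarchical operators are already
expressed by their operands through the scans. -/
theorem holds_iff_sat (C : Coherent M w φ Φ₀ S) (hc : Compatible M w) (f : Formula AP) :
    f.toX ∈ closure φ → ∀ j, j ≤ w.length + 1 → (Holds Φ₀ S f j ↔ Sat M w f j) := by
  induction f with
  | prop p => intro _ j hj; exact C.holds_prop hc hj p
  | neg ψ ih =>
    intro h j hj
    obtain ⟨Φ, ha, hΦ⟩ := C.exists_atom hj
    rw [Sat, ← ih (Requires.mem h (.neg _)) j hj, ← hΦ, ← hΦ, ha.neg ψ.toX h, not_not]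
    rfl
  | and ψ θ ih ih' =>
    intro h j hj
    obtain ⟨Φ, ha, hΦ⟩ := C.exists_atom hj
    rw [Sat, ← ih (Requires.mem h (.and_left _ _)) j hj,
        ← ih' (Requires.mem h (.and_right _ _)) j hj, ← hΦ, ← hΦ,
      ← hΦ]
    exact ha.and ψ.toX θ.toX h
  | next ψ ih =>
    intro h j hj
    rw [Sat, C.holds_next hc hj h]
    exact and_congr_right fun h1 => ih (Requires.mem h (.next _)) _ h1
  | back ψ ih =>
    intro h j hj
    rw [Sat, C.holds_back hc hj h]
    exact and_congr_right fun h1 => ih (Requires.mem h (.back _)) _ (by omega)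
  | chainNext ψ ih =>
    intro h j hj
    rw [Sat, C.holds_chainNext hc hj h]
    exact exists_congr fun k => and_congr_right fun h1 =>
        ih (Requires.mem h (.chainNext _)) _ h1.1.1
  | chainBack ψ ih =>
    intro h j hj
    rw [Sat, C.holds_chainBack hc hj h]
    refine exists_congr fun k => and_congr_right fun h1 => ih (Requires.mem h (.chainBack _)) _ ?_
    have := (chi_iff.1 h1.1).1.1.lt
    omega
  | since ψ θ ih ih' =>
    intro h j
    induction j using Nat.strong_induction_on with
    | _ j IH =>
    intro hj
    obtain ⟨Φ, ha, hΦ⟩ := C.exists_atom hj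
    rw [Sat, since_iff hj, ← ih (Requires.mem h (.since_left _ _)) j hj,
      ← ih' (Requires.mem h (.since_right _ _)) j hj]
    have h1 : Holds Φ₀ S (ψ.since θ) j ↔ Holds Φ₀ S θ j ∨
        Holds Φ₀ S ψ j ∧ Holds Φ₀ S (ψ.since θ).back j := by
      simp only [← hΦ]
      exact ha.since_iff ψ.toX θ.toX h
    rw [h1, C.holds_back hc hj (ψ := ψ.since θ) (Requires.mem h (.since_back _ _))]
    refine or_congr_right (and_congr_right fun _ => and_congr_right fun h2 => ?_)
    rw [IH _ (by omega) (by omega), Sat]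
  | sumUntil O ψ θ ih ih' =>
    intro h j hj
    induction hd : w.length + 1 - j using Nat.strong_induction_on generalizing j with
    | _ d IH =>
    rw [Sat, sumUntil_iff hj, ← ih (Requires.mem h (.sumUntil_left _ _ _)) j hj,
      ← ih' (Requires.mem h (.sumUntil_right _ _ _)) j hj, C.holds_sumUntil hc hj h]
    refine or_congr_right (and_congr_right fun _ => or_congr ?_ (and_congr_left fun _ => ?_))
    · refine exists_congr fun k => and_congr_right fun h1 => ?_
      have h2 := (chi_iff.1 h1.1).1
      have := h2.1.lt
      have := h2.2
      rw [IH _ (by omega) k h2.2 rfl, Sat]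
    · refine and_congr_right fun h2 => ?_
      rw [IH _ (by omega) _ h2 rfl, Sat]
  | sumSince O ψ θ ih ih' =>
    intro h j
    induction j using Nat.strong_induction_on with
    | _ j IH =>
    intro hj
    rw [Sat, sumSince_iff hj, ← ih (Requires.mem h (.sumSince_left _ _ _)) j hj,
      ← ih' (Requires.mem h (.sumSince_right _ _ _)) j hj, C.holds_sumSince hc hj h]
    refine or_congr_right (and_congr_right fun _ => or_congr ?_ (and_congr_left fun _ => ?_))
    · refine exists_congr fun k => and_congr_right fun h1 => ?_
      have := (chi_iff.1 h1.1).1.1.lt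
      rw [IH k (by omega) (by omega), Sat]
    · refine and_congr_right fun h2 => ?_
      rw [IH _ (by omega) (by omega), Sat]
  | yieldUntil ψ θ ih ih' =>
    intro h j hj
    rw [Sat, yieldUntil_iff, C.holds_yieldUntil hc hj h]
    refine exists_congr fun k => and_congr_right fun _ => and_congr_right fun h1 => and_congr
      (ih' (Requires.mem h (.yieldUntil_right _ _)) k h1.le) (forall_congr' fun x =>
          forall_congr' fun _ =>
      forall_congr' fun _ => forall_congr' fun h2 =>
          ih (Requires.mem h (.yieldUntil_left _ _)) x h2.le)
  | yieldSince ψ θ ih ih' =>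
    intro h j hj
    rw [Sat, yieldSince_iff, C.holds_yieldSince hc hj h]
    refine exists_congr fun k => and_congr_right fun _ => and_congr_right fun h1 => and_congr
      (ih' (Requires.mem h (.yieldSince_right _ _)) k h1.le) (forall_congr' fun x =>
          forall_congr' fun _ =>
      forall_congr' fun _ => forall_congr' fun h2 =>
          ih (Requires.mem h (.yieldSince_left _ _)) x h2.le)
  | takeUntil ψ θ ih ih' =>
    intro h j hj
    have h1 : ψ.toX ∈ closure φ :=
        Requires.mem (Requires.mem h (.takeUntil_left _ _)) (.chainBack _)
    have h2 : θ.toX ∈ closure φ :=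
        Requires.mem (Requires.mem h (.takeUntil_right _ _)) (.chainBack _)
    rw [Sat, takeUntil_iff, C.holds_takeUntil hc hj h]
    refine exists_congr fun k => and_congr_right fun h3 => and_congr
      (ih' h2 k (h3.lt.le.trans hj)) (forall_congr' fun x => forall_congr' fun _ =>
      forall_congr' fun h4 => ih h1 x (h4.lt.le.trans hj))
  | takeSince ψ θ ih ih' =>
    intro h j hj
    have h1 : ψ.toX ∈ closure φ :=
        Requires.mem (Requires.mem h (.takeSince_left _ _)) (.chainBack _)
    have h2 : θ.toX ∈ closure φ :=
        Requires.mem (Requires.mem h (.takeSince_right _ _)) (.chainBack _)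
    rw [Sat, takeSince_iff, C.holds_takeSince hc hj h]
    refine exists_congr fun k => and_congr_right fun _ => and_congr_right fun h3 => and_congr
      (ih' h2 k (h3.lt.le.trans hj)) (forall_congr' fun x => forall_congr' fun _ =>
      forall_congr' fun _ => forall_congr' fun h4 => ih h1 x (h4.lt.le.trans hj))
  -- The only constructor left is the linear until.
  | _ ψ θ ih ih' =>
    intro h j hj
    induction hd : w.length + 1 - j using Nat.strong_induction_on generalizing j with
    | _ d IH =>
    obtain ⟨Φ, ha, hΦ⟩ := C.exists_atom hj
    rw [Sat, until_iff hj, ← ih (Requires.mem h (.until_left _ _)) j hj,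
      ← ih' (Requires.mem h (.until_right _ _)) j hj]
    have h1 : Holds Φ₀ S (ψ.until θ) j ↔ Holds Φ₀ S θ j ∨
        Holds Φ₀ S ψ j ∧ Holds Φ₀ S (ψ.until θ).next j := by
      simp only [← hΦ]
      exact ha.until_iff ψ.toX θ.toX h
    rw [h1, C.holds_next hc hj (ψ := ψ.until θ) (Requires.mem h (.until_next _ _))]
    refine or_congr_right (and_congr_right fun _ => and_congr_right fun h2 => ?_)
    rw [IH _ (by omega) _ h2 rfl, Sat]

end Coherent

theorem models_of_mem_language (h : w ∈ (automaton M φ).language) :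
    Compatible M w ∧ Models M w φ := by
  obtain ⟨hc, Φ₀, S, C, h1⟩ := coherent_of_mem_language h
  refine ⟨hc, ?_⟩
  rw [C.mem_iff (act_succ (by omega)), C.holds_iff_sat hc φ .self 1 (by omega)] at h1
  exact h1

end Soundness

section Completeness

variable {AP : Type*} {M : OPM (Set AP)} {w : List (Set AP)} {φ : Formula AP}

/-! ## The labelling given by the semantics -/

/-- The OPTL formula behind an extended formula. -/
def XFormula.erase : XFormula AP → Formula AP
  | prop p => .prop p
  | neg ψ => .neg ψ.erase
  | and ψ θ => .and ψ.erase θ.erase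
  | next ψ => .next ψ.erase
  | back ψ => .back ψ.erase
  | chainNext ψ => .chainNext ψ.erase
  | chainBack ψ => .chainBack ψ.erase
  | XFormula.until ψ θ => .until ψ.erase θ.erase
  | since ψ θ => .since ψ.erase θ.erase
  | sumUntil O ψ θ => .sumUntil O ψ.erase θ.erase
  | sumSince O ψ θ => .sumSince O ψ.erase θ.erase
  | yieldUntil ψ θ => .yieldUntil ψ.erase θ.erase
  | yieldSince ψ θ => .yieldSince ψ.erase θ.erase
  | takeUntil ψ θ => .takeUntil ψ.erase θ.erase
  | takeSince ψ θ => .takeSince ψ.erase θ.erase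
  | aux _ η => η.erase

theorem Formula.erase_toX (f : Formula AP) : f.toX.erase = f := by
  induction f <;> simp_all [toX, XFormula.erase]

/-- The meaning of the auxiliary operators at the pair of positions `(i, j)`. -/
def AuxSat (M : OPM (Set AP)) (w : List (Set AP)) : Tag → Formula AP → ℕ → ℕ → Prop
  | .fin, _, i, j => i + 1 ≠ j
  | .pend, .chainNext ψ, i, _ => Sat M w ψ.chainNext i
  | .pend, .chainBack ψ, i, _ => Sat M w ψ i
  | .pend, .yieldUntil ψ θ, i, j => YieldU M w (Sat M w ψ) (Sat M w θ) i j
  | .pend, .yieldSince ψ θ, i, _ => Sat M w (ψ.yieldSince θ) i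
  | .acc, .yieldSince ψ θ, i, j => YieldS M w (Sat M w ψ) (Sat M w θ) i j
  | .pend, .takeUntil ψ θ, i, j => TakeU M w (Sat M w ψ) (Sat M w θ) i j
  | .pend, .takeSince ψ θ, i, j => TakeS M w (Sat M w ψ) (Sat M w θ) i j
  | _, _, _, _ => False

/-- Satisfaction of extended formulas at the pair of positions `(i, j)`. -/
def XSat (M : OPM (Set AP)) (w : List (Set AP)) : XFormula AP → ℕ → ℕ → Prop
  | .neg ψ, i, j => ¬ XSat M w ψ i j
  | .and ψ θ, i, j => XSat M w ψ i j ∧ XSat M w θ i j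
  -- The closure contains nexts of auxiliary symbols, so a next is evaluated at the pair `(j, j +
  -- 1)` entered after reading `j`, instead of being erased to an OPTL formula.
  | .next ψ, _, j => j + 1 ≤ w.length + 1 ∧ XSat M w ψ j (j + 1)
  | .aux t η, i, j => AuxSat M w t η.erase i j
  | χ, _, j => Sat M w χ.erase j

theorem xSat_toX (f : Formula AP) : ∀ i j, XSat M w f.toX i j ↔ Sat M w f j := by
  induction f with
  | neg ψ ih => intro i j; exact not_congr (ih i j)
  | and ψ θ ih ih' => intro i j; exact and_congr (ih i j) (ih' i j)
  | next ψ ih => intro i j; exact and_congr_right fun _ => ih _ _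
  | _ => intro i j; simp [Formula.toX, XSat, XFormula.erase, Formula.erase_toX]

/-- The formulas of the closure satisfied at the pair of positions `(i, j)`. -/
def truth (M : OPM (Set AP)) (w : List (Set AP)) (φ : Formula AP) (i j : ℕ) :
    Set (XFormula AP) :=
  {χ | χ ∈ closure φ ∧ XSat M w χ i j}

theorem toX_mem_truth {f : Formula AP} {i j : ℕ} (h : f.toX ∈ closure φ) :
    f.toX ∈ truth M w φ i j ↔ Sat M w f j :=
  (and_iff_right h).trans (xSat_toX f i j)

theorem aux_mem_truth {t : Tag} {f : Formula AP} {i j : ℕ} (h : .aux t f.toX ∈ closure φ) :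
    .aux t f.toX ∈ truth M w φ i j ↔ AuxSat M w t f i j := by
  refine (and_iff_right h).trans ?_
  rw [XSat, Formula.erase_toX]

theorem isAtom_truth {i j : ℕ} (hj : j ≤ w.length + 1) : IsAtom φ (truth M w φ i j) where
  subset _ h := h.1
  neg ψ h := by
    have := Requires.mem h (.neg _)
    simp [truth, h, this, XSat]
  and ψ θ h := by
    have h1 := Requires.mem h (.and_left _ _)
    have h2 := Requires.mem h (.and_right _ _)
    simp [truth, h, h1, h2, XSat]
  until_iff ψ θ h := by
    obtain ⟨f, hf⟩ := exists_toX h (by simp) (by simp) (by simp)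
    cases f <;> cases hf
    rename_i ψ θ
    refine (toX_mem_truth (f := ψ.until θ) h).trans (Iff.trans ?_ (or_congr
      (toX_mem_truth (Requires.mem h (.until_right _ _))) (and_congr
      (toX_mem_truth (Requires.mem h (.until_left _ _)))
      (toX_mem_truth (f := (ψ.until θ).next) (Requires.mem h (.until_next _ _))))).symm)
    exact until_iff hj
  since_iff ψ θ h := by
    obtain ⟨f, hf⟩ := exists_toX h (by simp) (by simp) (by simp)
    cases f <;> cases hf
    rename_i ψ θ
    refine (toX_mem_truth (f := ψ.since θ) h).trans (Iff.trans ?_ (or_congr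
      (toX_mem_truth (Requires.mem h (.since_right _ _))) (and_congr
      (toX_mem_truth (Requires.mem h (.since_left _ _)))
      (toX_mem_truth (f := (ψ.since θ).back) (Requires.mem h (.since_back _ _))))).symm)
    exact since_iff hj
  sumUntil_mp O ψ θ h' := by
    have h := h'.1
    obtain ⟨f, hf⟩ := exists_toX h (by simp) (by simp) (by simp)
    cases f <;> cases hf
    rename_i ψ θ
    have h1 := (toX_mem_truth (f := .sumUntil O ψ θ) h).1 h'
    rw [Sat, sumUntil_iff hj] at h1
    rcases h1 with h1 | ⟨h1, h2 | h2⟩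
    · exact .inl ((toX_mem_truth (Requires.mem h (.sumUntil_right _ _ _))).2 h1)
    · exact .inr (.inl ⟨(toX_mem_truth (Requires.mem h (.sumUntil_left _ _ _))).2 h1,
        (toX_mem_truth (f := (Formula.sumUntil O ψ θ).chainNext)
          (Requires.mem h (.sumUntil_chain _ _ _))).2 h2⟩)
    · exact .inr (.inr ⟨(toX_mem_truth (Requires.mem h (.sumUntil_left _ _ _))).2 h1,
        (toX_mem_truth (f := (Formula.sumUntil O ψ θ).next)
          (Requires.mem h (.sumUntil_next _ _ _))).2 h2.1⟩)
  sumUntil_mpr O ψ θ h h' := by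
    obtain ⟨f, hf⟩ := exists_toX h (by simp) (by simp) (by simp)
    cases f <;> cases hf
    rename_i ψ θ
    refine (toX_mem_truth (f := .sumUntil O ψ θ) h).2 ?_
    rw [Sat, sumUntil_iff hj]
    rcases h' with h1 | ⟨h1, h2⟩
    · exact .inl ((toX_mem_truth (Requires.mem h (.sumUntil_right _ _ _))).1 h1)
    · exact .inr ⟨(toX_mem_truth (Requires.mem h (.sumUntil_left _ _ _))).1 h1,
        .inl ((toX_mem_truth (f := (Formula.sumUntil O ψ θ).chainNext)
          (Requires.mem h (.sumUntil_chain _ _ _))).1 h2)⟩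
  sumSince_mp O ψ θ h' := by
    have h := h'.1
    obtain ⟨f, hf⟩ := exists_toX h (by simp) (by simp) (by simp)
    cases f <;> cases hf
    rename_i ψ θ
    have h1 := (toX_mem_truth (f := .sumSince O ψ θ) h).1 h'
    rw [Sat, sumSince_iff hj] at h1
    rcases h1 with h1 | ⟨h1, h2 | h2⟩
    · exact .inl ((toX_mem_truth (Requires.mem h (.sumSince_right _ _ _))).2 h1)
    · exact .inr (.inl ⟨(toX_mem_truth (Requires.mem h (.sumSince_left _ _ _))).2 h1,
        (toX_mem_truth (f := (Formula.sumSince O ψ θ).chainBack)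
          (Requires.mem h (.sumSince_chain _ _ _))).2 h2⟩)
    · exact .inr (.inr ⟨(toX_mem_truth (Requires.mem h (.sumSince_left _ _ _))).2 h1,
        (toX_mem_truth (f := (Formula.sumSince O ψ θ).back)
          (Requires.mem h (.sumSince_back _ _ _))).2 h2.1⟩)
  sumSince_mpr O ψ θ h h' := by
    obtain ⟨f, hf⟩ := exists_toX h (by simp) (by simp) (by simp)
    cases f <;> cases hf
    rename_i ψ θ
    refine (toX_mem_truth (f := .sumSince O ψ θ) h).2 ?_
    rw [Sat, sumSince_iff hj]
    rcases h' with h1 | ⟨h1, h2⟩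
    · exact .inl ((toX_mem_truth (Requires.mem h (.sumSince_right _ _ _))).1 h1)
    · exact .inr ⟨(toX_mem_truth (Requires.mem h (.sumSince_left _ _ _))).1 h1,
        .inl ((toX_mem_truth (f := (Formula.sumSince O ψ θ).chainBack)
          (Requires.mem h (.sumSince_chain _ _ _))).1 h2)⟩
  yieldUntil ψ θ h' := by
    have h := h'.1
    obtain ⟨f, hf⟩ := exists_toX h (by simp) (by simp) (by simp)
    cases f <;> cases hf
    rename_i ψ θ
    have h1 := (toX_mem_truth (f := ψ.yieldUntil θ) h).1 h'
    rw [Sat, yieldUntil_iff] at h1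
    -- The witness lies to the right of `j`, so `j` is not the final position and a next can hold
    -- there.
    obtain ⟨k, h2, h3, -⟩ := id h1
    have := h3.le
    refine ⟨Requires.mem h (.yieldUntil_next _ _), by omega, ?_⟩
    exact ((aux_mem_truth (t := .pend) (f := ψ.yieldUntil θ)
      (Requires.mem h (.yieldUntil_pend _ _))).2 h1).2
  yieldSince ψ θ h' := by
    have h := h'.1
    obtain ⟨f, hf⟩ := exists_toX h (by simp) (by simp) (by simp)
    cases f <;> cases hf
    rename_i ψ θ
    have h1 := (toX_mem_truth (f := ψ.yieldSince θ) h).1 h'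
    have h1' := h1
    rw [Sat, yieldSince_iff] at h1'
    obtain ⟨k, h2, h3, -⟩ := h1'
    have := h3.le
    have := h3.lt
    refine ⟨Requires.mem h (.yieldSince_next _ _), by omega, ?_⟩
    exact ((aux_mem_truth (t := .pend) (f := ψ.yieldSince θ)
      (Requires.mem h (.yieldSince_pend _ _))).2 h1).2

/-! ### The semantic labelling meets the conditions of the automaton -/

theorem not_toX_mem {f : Formula AP} {i j : ℕ} (h : ¬ Sat M w f j) : f.toX ∉ truth M w φ i j :=
  fun h' => h ((toX_mem_truth h'.1).1 h')

theorem not_aux_mem {t : Tag} {f : Formula AP} {i j : ℕ} (h : ¬ AuxSat M w t f i j) :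
    .aux t f.toX ∉ truth M w φ i j :=
  fun h' => h ((aux_mem_truth h'.1).1 h')

theorem prop_mem_truth {p : Option AP} {i j : ℕ} :
    .prop p ∈ truth M w φ i j ↔ p ∈ label w j :=
  toX_mem_truth (f := .prop p) (.prop p)

theorem enter_truth {i j : ℕ} (hj : j ≤ w.length) :
    Enter M φ (truth M w φ i j) (truth M w φ j (j + 1)) := by
  have hrel : M.ext (letterOf (truth M w φ i j)) (letterOf (truth M w φ j (j + 1))) =
      rel M w j (j + 1) := by
    rw [rel, letterOf_eq (w := w) fun _ => prop_mem_truth,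
      letterOf_eq (w := w) fun _ => prop_mem_truth]
  constructor
  case next =>
    intro ψ h
    rw [toX_mem_truth h, toX_mem_truth (Requires.mem h (.next _)), Sat]
    exact and_iff_right (by omega)
  case back =>
    intro ψ h
    rw [toX_mem_truth h, toX_mem_truth (Requires.mem h (.back _)), Sat]
    exact and_iff_right (by omega)
  case fin =>
    rintro η ⟨-, h⟩
    simp [XSat, AuxSat] at h
  case chainNext =>
    intro ψ h
    rw [toX_mem_truth h, aux_mem_truth (f := ψ.chainNext) (Requires.mem h (.chainNext_pend _)),
        AuxSat]
  case chainBack =>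
    intro ψ h
    rw [aux_mem_truth (f := ψ.chainBack) (Requires.mem h (.chainBack_pend _)), AuxSat,
      toX_mem_truth (Requires.mem h (.chainBack _))]
  case sumUntil =>
    intro O ψ θ h
    rw [hrel, toX_mem_truth h, toX_mem_truth (Requires.mem h (.sumUntil_left _ _ _)),
      toX_mem_truth (Requires.mem h (.sumUntil_right _ _ _)),
      toX_mem_truth (f := (Formula.sumUntil O ψ θ).chainNext)
        (Requires.mem h (.sumUntil_chain _ _ _)),
      toX_mem_truth (f := (Formula.sumUntil O ψ θ).next) (Requires.mem h (.sumUntil_next _ _ _))]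
    exact sumUntil_iff (by omega)
  case sumSince =>
    intro O ψ θ h
    rw [hrel, toX_mem_truth h, toX_mem_truth (Requires.mem h (.sumSince_left _ _ _)),
      toX_mem_truth (Requires.mem h (.sumSince_right _ _ _)),
      toX_mem_truth (f := (Formula.sumSince O ψ θ).chainBack)
        (Requires.mem h (.sumSince_chain _ _ _)),
      toX_mem_truth (f := (Formula.sumSince O ψ θ).back) (Requires.mem h (.sumSince_back _ _ _))]
    exact sumSince_iff (by omega)
  case yieldUntil =>
    intro ψ θ h
    rw [toX_mem_truth h, aux_mem_truth (f := ψ.yieldUntil θ) (Requires.mem h (.yieldUntil_pend _ _)),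
      AuxSat, Sat,
      yieldUntil_iff]
  case yieldSince =>
    intro ψ θ h
    rw [toX_mem_truth h, aux_mem_truth (f := ψ.yieldSince θ) (Requires.mem h (.yieldSince_pend _ _)),
      AuxSat]
  case yieldSince_acc =>
    intro ψ θ
    exact not_aux_mem (f := ψ.yieldSince θ) not_yieldS
  case takeUntil =>
    intro ψ θ
    exact not_aux_mem (f := ψ.takeUntil θ) (not_takeU rfl)
  case takeSince =>
    intro ψ θ h
    rw [toX_mem_truth h, aux_mem_truth (f := ψ.takeSince θ) (Requires.mem h (.takeSince_pend _ _)),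
        AuxSat, Sat,
      takeSince_iff, Nat.add_sub_cancel]

theorem leave_truth {i j : ℕ} (hij : Act M w i j) (hr : rel M w i j ≠ some Prec.gt) :
    Leave φ (truth M w φ i j) := by
  constructor
  · intro ψ h
    rw [toX_mem_truth h, aux_mem_truth (f := ψ.chainBack) (Requires.mem h (.chainBack_pend _)),
      aux_mem_truth (f := ψ.chainBack) (Requires.mem h (.chainBack_fin _)), AuxSat, AuxSat, Sat]
    simp only [chiBwd_iff hij hr, and_assoc, exists_eq_left]
  · intro ψ θ h
    rw [toX_mem_truth h, aux_mem_truth (f := ψ.takeUntil θ) (Requires.mem h (.takeUntil_pend _ _)),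
        AuxSat, Sat,
      takeUntil_iff, takeU_full hij hr]
  · intro ψ θ
    exact not_aux_mem (f := ψ.takeSince θ) (not_takeS hij hr)

theorem close_truth {i j : ℕ} (hij : Act M w i j) (hr : rel M w i j ≠ some Prec.lt) :
    Close φ (truth M w φ i j) := by
  constructor
  · intro ψ h
    rw [toX_mem_truth (Requires.mem h (.chainNext _)),
      aux_mem_truth (f := ψ.chainNext) (Requires.mem h (.chainNext_pend _)),
      aux_mem_truth (f := ψ.chainNext) (Requires.mem h (.chainNext_fin _)), AuxSat, AuxSat, Sat]
    simp only [chiFwd_iff hij hr, and_assoc, exists_eq_left]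
  · intro ψ θ
    exact not_aux_mem (f := ψ.yieldUntil θ) (not_yieldU hij hr)
  · intro ψ θ h
    rw [aux_mem_truth (f := ψ.yieldSince θ) (Requires.mem h (.yieldSince_pend _ _)),
      aux_mem_truth (f := ψ.yieldSince θ) (Requires.mem h (.yieldSince_acc _ _)), AuxSat, AuxSat,
          Sat,
      yieldSince_iff, yieldS_full hij hr]

theorem pop_truth {i h k j : ℕ} (o : Open M w i h k) (hkj : Act M w k j)
    (hr : rel M w k j = some Prec.gt) :
    Pop φ (truth M w φ k j) (truth M w φ i h) (truth M w φ i j) := by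
  constructor
  case stay =>
    intro f
    exact and_congr_right fun _ => (xSat_toX f k j).trans (xSat_toX f i j).symm
  case fin =>
    intro η hη
    have := (o.chain hkj.1 hr).add_one_lt
    exact ⟨hη, this.ne⟩
  case chainNext =>
    intro ψ h
    rw [aux_mem_truth (f := ψ.chainNext) (Requires.mem h (.chainNext_pend _)),
      aux_mem_truth (f := ψ.chainNext) (Requires.mem h (.chainNext_pend _)), AuxSat, AuxSat]
  case chainBack =>
    intro ψ h
    rw [aux_mem_truth (f := ψ.chainBack) (Requires.mem h (.chainBack_pend _)),
      aux_mem_truth (f := ψ.chainBack) (Requires.mem h (.chainBack_pend _)), AuxSat, AuxSat]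
  case yieldUntil =>
    intro ψ θ h
    have h1 := Requires.mem h (.yieldUntil_pend _ _)
    simp only [aux_mem_truth (f := ψ.yieldUntil θ) h1,
      aux_mem_truth (f := ψ.yieldUntil θ) (Requires.mem h (.yieldUntil_fin _ _)),
      toX_mem_truth (Requires.mem h (.yieldUntil_left _ _)),
      toX_mem_truth (Requires.mem h (.yieldUntil_right _ _)), AuxSat]
    exact YieldU.step o hkj hr
  case yieldSince =>
    intro ψ θ h
    rw [aux_mem_truth (f := ψ.yieldSince θ) (Requires.mem h (.yieldSince_pend _ _)),
      aux_mem_truth (f := ψ.yieldSince θ) (Requires.mem h (.yieldSince_pend _ _)), AuxSat, AuxSat]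
  case yieldSince_acc =>
    intro ψ θ h
    have h1 := Requires.mem h (.yieldSince_acc _ _)
    simp only [aux_mem_truth (f := ψ.yieldSince θ) h1,
      aux_mem_truth (f := ψ.yieldSince θ) (Requires.mem h (.yieldSince_fin _ _)),
      toX_mem_truth (Requires.mem h (.yieldSince_left _ _)),
      toX_mem_truth (Requires.mem h (.yieldSince_right _ _)), AuxSat]
    exact YieldS.step o hkj hr
  case takeUntil =>
    intro ψ θ h
    have h1 := Requires.mem h (.takeUntil_pend _ _)
    have h2 := Requires.mem (Requires.mem h (.takeUntil_left _ _)) (.chainBack_pend _)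
    have h3 := Requires.mem (Requires.mem h (.takeUntil_right _ _)) (.chainBack_pend _)
    simp only [aux_mem_truth (f := ψ.takeUntil θ) h1,
      aux_mem_truth (f := ψ.takeUntil θ) (Requires.mem h (.takeUntil_fin _ _)),
      aux_mem_truth (f := ψ.chainBack) h2, aux_mem_truth (f := θ.chainBack) h3, AuxSat]
    exact TakeU.step o hkj hr
  case takeSince =>
    intro ψ θ h
    have h1 := Requires.mem h (.takeSince_pend _ _)
    have h2 := Requires.mem (Requires.mem h (.takeSince_left _ _)) (.chainBack_pend _)
    have h3 := Requires.mem (Requires.mem h (.takeSince_right _ _)) (.chainBack_pend _)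
    simp only [aux_mem_truth (f := ψ.takeSince θ) h1,
      aux_mem_truth (f := ψ.takeSince θ) (Requires.mem h (.takeSince_fin _ _)),
      aux_mem_truth (f := ψ.chainBack) h2, aux_mem_truth (f := θ.chainBack) h3, AuxSat]
    exact TakeS.step o hkj hr

theorem start_truth {i : ℕ} : Start φ (truth M w φ i 0) := by
  constructor
  · intro p
    rw [prop_mem_truth]
    simp [label, letterAt]
  · intro ψ
    exact not_toX_mem (by simp [Sat])
  · intro ψ
    refine not_toX_mem ?_
    rw [Sat]
    rintro ⟨k, h1, -⟩
    have := (chi_iff.1 h1.1).1.1.lt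
    omega
  · intro ψ θ
    refine not_toX_mem ?_
    rw [Sat, takeUntil_iff]
    rintro ⟨k, h1, -⟩
    have := h1.lt
    omega
  · intro ψ θ
    refine not_toX_mem ?_
    rw [Sat, takeSince_iff]
    rintro ⟨k, -, h1, -⟩
    have := h1.lt
    omega

theorem stop_truth {i : ℕ} : Stop φ (truth M w φ i (w.length + 1)) := by
  constructor
  · intro p
    have h : letterAt w (w.length + 1) = none := letterAt_none (by omega)
    rw [prop_mem_truth]
    simp [label, h]
  · rintro ψ ⟨-, h, -⟩
    omega
  · intro ψ
    refine not_toX_mem ?_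
    rw [Sat]
    rintro ⟨k, h1, -⟩
    obtain ⟨⟨h2, h3⟩, -⟩ := chi_iff.1 h1.1
    have := h2.lt
    omega
  · intro ψ θ
    refine not_toX_mem ?_
    rw [Sat, yieldUntil_iff]
    rintro ⟨k, -, h1, -⟩
    have := h1.lt
    have := h1.le
    omega
  · intro ψ θ
    refine not_toX_mem ?_
    rw [Sat, yieldSince_iff]
    rintro ⟨k, -, h1, -⟩
    have := h1.lt
    have := h1.le
    omega

theorem mayRead_truth {i j : ℕ} {a : Set AP} {Φ Θ : Atom φ} (hj : j ≤ w.length)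
    (ha : letterAt w j = some a) (hΦ : Φ.1 = truth M w φ i j)
    (hΘ : Θ.1 = truth M w φ j (j + 1)) : Φ.MayRead a Θ := by
  constructor
  · ext p
    show .prop p ∈ Φ.1 ↔ _
    rw [hΦ, prop_mem_truth]
    simp [label, ha]
  · intro ψ h
    rw [hΦ, hΘ]
    have h1 := Requires.mem h (.next _)
    exact (and_iff_right h).trans ((and_iff_right (by omega)).trans (and_iff_right h1).symm)
  · intro ψ h
    rw [hΦ, hΘ]
    obtain ⟨f, hf⟩ := exists_toX h (by simp) (by simp) (by simp)
    cases f <;> cases hf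
    exact (enter_truth hj).back _ h

/-- The word is labelled with the truth at each pair, and the local conditions are the recurrences
of the operators. Because `Leave` and `Close` are demanded only at extremal pairs, they hold
although the auxiliary symbols are partial evaluations elsewhere. -/
theorem mem_language_of_models (hc : Compatible M w) (hm : Models M w φ) :
    w ∈ (automaton M φ).language := by
  obtain ⟨S, hv⟩ : ∃ S : ℕ → ℕ → Atom φ, ∀ i j, j ≤ w.length + 1 →
      (S i j).1 = truth M w φ i j := by
    -- Beyond the word the label is an arbitrary atom; `truth` at `(0, 0)` serves as default.
    refine ⟨fun i j => if hj : j ≤ w.length + 1 then ⟨truth M w φ i j, isAtom_truth hj⟩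
      else ⟨truth M w φ 0 0, isAtom_truth (by omega)⟩, fun i j hj => ?_⟩
    simp [hj]
  refine (mem_language_iff _).2 ⟨hc, S, ?_⟩
  have hlast : Act M w 0 (w.length + 1) := by
    obtain ⟨i, hi, hr⟩ := hc.exists_left (j := w.length + 1) (by omega) le_rfl
    obtain rfl := eq_zero_of_rel_last hi hr
    exact hi
  refine ⟨⟨?_, truth M w φ 0 0, isAtom_truth (by omega), start_truth, ?_⟩, ⟨?_, ?_, ?_⟩, ?_⟩
  · rw [hv _ _ (by omega)]
    exact (toX_mem_truth .self).2 hm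
  · rw [hv _ _ (by omega)]
    exact enter_truth (by omega)
  · rw [hv _ _ le_rfl]
    exact stop_truth
  · rw [hv _ _ le_rfl]
    exact leave_truth hlast (by simp [rel_zero_last])
  · rw [hv _ _ le_rfl]
    exact close_truth hlast (by simp [rel_zero_last])
  · intro i j hij
    constructor
    · intro a ha hr
      have hj := (letterAt_bounds ha).2
      refine ⟨mayRead_truth hj ha (hv _ _ (by omega)) (hv _ _ (by omega)), ?_, ?_⟩
      · simp only [hv i j (by omega), hv j (j + 1) (by omega)]
        exact enter_truth hj
      · simp only [hv i j (by omega)]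
        exact leave_truth hij (by simp [hr])
    · intro a ha hr
      have hj := (letterAt_bounds ha).2
      refine ⟨mayRead_truth hj ha (hv _ _ (by omega)) (hv _ _ (by omega)), ?_, ?_, ?_⟩
      · simp only [hv i j (by omega), hv j (j + 1) (by omega)]
        exact enter_truth hj
      · simp only [hv i j (by omega)]
        exact leave_truth hij (by simp [hr])
      · simp only [hv i j (by omega)]
        exact close_truth hij (by simp [hr])
    · intro i₀ h o hr
      have := o.le
      have := hij.1.lt
      have hj := hij.2
      refine ⟨?_, ?_⟩
      · simp only [hv i j hj]
        exact close_truth hij (by simp [hr])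
      · simp only [hv i j hj, hv i₀ h (by omega), hv i₀ j hj]
        exact pop_truth o hij hr

theorem automaton_language (M : OPM (Set AP)) (φ : Formula AP) :
    (automaton M φ).language = {w | Compatible M w ∧ Models M w φ} :=
  Set.ext fun _ => ⟨models_of_mem_language, fun h => mem_language_of_models h.1 h.2⟩

end Completeness

end OPTL

theorem mainTheorem2 :
    ∃ C : ℕ, ∀ (AP : Type*) [Fintype AP] (M : OPTL.OPM (Set AP)) (φ : OPTL.Formula AP),
      (OPTL.closure φ).Finite ∧
      (OPTL.closure φ).ncard ≤ C * (φ.length + Fintype.card AP) ∧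
      Finite (OPTL.Atom φ) ∧
      ∃ A : OPTL.OPA M (OPTL.Atom φ),
        A.RespectsAtoms ∧
        A.language = {w | OPTL.Compatible M w ∧ OPTL.Models M w φ} ∧
        A.size ≤ 2 ^ (C * (φ.length + Fintype.card AP)) :=
  -- One constant for both bounds: `20` suffices for the closure and `64` is needed by the size
  -- estimate.
  ⟨64, fun _ _ M φ => ⟨OPTL.closure_finite φ,
    (OPTL.ncard_closure_le φ).trans (Nat.mul_le_mul_right _ (by norm_num)), OPTL.atom_finite φ,
    OPTL.automaton M φ, OPTL.automaton_respectsAtoms M φ, OPTL.automaton_language M φ,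
    OPTL.OPA.size_le _⟩⟩
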